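/- Let $k$ be a field and let $d,n\ge 1$ be integers. \textbf{Ordered sequences.} For $e\ge 1$ let $\mathbf{os}^{(e)}=\{\mu\in\mathbb Z^e : \mu_1\ge\mu_2\ge\dots\ge\mu_e\}$ and $\mathbf{os}^{(e)}_n=\{\mu\in\mathbf{os}^{(e)} : n-1\ge\mu_1,\ \mu_e\ge 0\}$. \textbf{Kupisch series.} A Kupisch series of type $\mathbb A_n$ is a tuple $\underline\ell=(\ell_0,\dots,\ell_{n-1})$ of positive integers with $\ell_0=1$ and $\ell_i\le\ell_{i-1}+1$ for $1\le i\le n-1$; put $\mathbf{os}^{(e)}_{\underline\ell}=\{\mu\in\mathbf{os}^{(e)}_n : \mu_1-\mu_e+1\le\ell_{\mu_1}\}$. A Kupisch series of type $\widetilde{\mathbb A}_{n-1}$ is a tuple $\underline\ell=(\ell_0,\dots,\ell_{n-1})$ of positive integers, with indices read modulo $n$, such that $\ell_i\le\ell_{i-1}+1$ for all $i\in\mathbb Z/n$; with $\tilde\ell$ its $n$-periodic extension to $\mathbb Z$, put $\mathbf{os}^{(e)}_{\tilde{\underline\ell}}=\{\mu\in\mathbf{os}^{(e)} : \mu_1-\mu_e+1\le\tilde\ell_{\mu_1}\}$.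 \textbf{Algebras.} Let $A^{(d)}$ be the incidence $k$-category of $\mathbb Z^d$ with the product order: its morphism space $x\to y$ is $k f_{yx}$ if $x\le y$ and $0$ otherwise, and $f_{zy}f_{yx}=f_{zx}$. Let $\varphi_d$ be its automorphism $\mu\mapsto\mu-(1,\dots,1)$. For $d\ge 2$ the higher Nakayama algebra $A^{(d)}_{\underline\ell}$ of type $\mathbb A_n$ is the quotient of $A^{(d)}$ by the ideal generated by the identities of all objects outside $\mathbf{os}^{(d)}_{\underline\ell}$, and $\tilde A^{(d)}_{\underline\ell}$, for $\underline\ell$ of type $\widetilde{\mathbb A}_{n-1}$, is the quotient of the orbit category $A^{(d)}/\varphi_d^n$ by the ideal generated by the identities of the orbits of all objects outside $\mathbf{os}^{(d)}_{\tilde{\underline\ell}}$. For $d=1$ they are the Nakayama algebras with Kupisch series $\underline\ell$: one takes the full subcategory of $A^{(1)}$ on $\{0,\dots,n-1\}$, respectively $A^{(1)}/\varphi_1^n$, modulo the paths $i-\ell_i\leadsto i$ with $\ell_{i-1}\ge\ell_i$ (where $1\le i\le n-1$ in type $\mathbb A_n$, and $i\in\mathbb Z$ and $\ell$ is replaced by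 $\tilde\ell$ in type $\widetilde{\mathbb A}_{n-1}$). These categories have finitely many non-zero objects and are regarded as unital $k$-algebras; modules are left modules, with $f_{yx}$ mapping the component at $y$ to the component at $x$. \textbf{Interval modules.} For $\lambda\in\mathbf{os}^{(d+1)}_{\underline\ell}$, respectively $\lambda\in\mathbf{os}^{(d+1)}_{\tilde{\underline\ell}}$, the interval module $M_\lambda$ has a $k$-basis $(b_\kappa)$ indexed by the $\kappa\in\mathbb Z^d$ with $(\lambda_2,\dots,\lambda_{d+1})\le\kappa\le(\lambda_1,\dots,\lambda_d)$; the morphism $f_{yx}$ sends $b_y$ to $b_x$ if $x\le y$ are both in this interval, and all other $b_\kappa$ to $0$. In type $\widetilde{\mathbb A}_{n-1}$ the push-down of this module is meant: the class of $f_{yx}$ in the orbit category acts as the sum of the $f_{y'x'}$ over all $(x',y')$ in the $\varphi_d^n$-orbit of $(x,y)$. \textbf{Cluster tilting.} A finite-dimensional module $M$ over a finite-dimensional algebra $\Lambda$ is $d$-cluster-tilting if $$\operatorname{add}M=\{X : \operatorname{Ext}^i_\Lambda(X,M)=0\ \text{for}\ 0<i<d\}=\{Y : \operatorname{Ext}^i_\Lambda(M,Y)=0\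 \text{for}\ 0<i<d\},$$ where $X,Y$ run over the finite-dimensional $\Lambda$-modules and $\operatorname{add}M$ consists of the direct summands of the modules $M^r$, $r\ge1$. The algebra $\Lambda$ is weakly $d$-representation-finite if it has a $d$-cluster-tilting module. \textbf{Theorem.} For every Kupisch series $\underline\ell$ of type $\mathbb A_n$ (respectively of type $\widetilde{\mathbb A}_{n-1}$) the finite-dimensional algebra $A^{(d)}_{\underline\ell}$ (respectively $\tilde A^{(d)}_{\underline\ell}$) is weakly $d$-representation-finite. More precisely, it has a $d$-cluster-tilting module whose indecomposable direct summands are, up to isomorphism, exactly the interval modules $M_\lambda$ with $\lambda\in\mathbf{os}^{(d+1)}_{\underline\ell}$ (respectively $\lambda\in\mathbf{os}^{(d+1)}_{\tilde{\underline\ell}}$), and all these $M_\lambda$ are indecomposable. -/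

import Mathlib

open CategoryTheory

noncomputable section

namespace HigherNakayama

universe u

/-! ### Weakly `d`-representation-finite algebras -/

section ClusterTilting

variable {Λ : Type u} [Ring Λ]

/-- `X` is a direct summand of `M`. -/
def IsSummand (X M : ModuleCat.{u} Λ) : Prop := Nonempty (Retract X M)

/-- `X ∈ add M`: `X` is a direct summand of `M ^ r` for some positive integer `r`. -/
def InAdd (M X : ModuleCat.{u} Λ) : Prop :=
  ∃ r : ℕ, 0 < r ∧ IsSummand X (ModuleCat.of Λ (Fin r → M))

/-- `M` is a `d`-cluster-tilting module over the finite-dimensional algebra `Λ`. Over such an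
algebra the finite-dimensional modules are the finitely generated ones, and the extension groups
of two of them may be computed in the category of all modules. -/
def IsClusterTilting (d : ℕ) (M : ModuleCat.{u} Λ) : Prop :=
  Module.Finite Λ M ∧
  (∀ X : ModuleCat.{u} Λ, Module.Finite Λ X →
    (InAdd M X ↔ ∀ i : ℕ, 1 ≤ i → i < d → Subsingleton (Abelian.Ext X M i))) ∧
  (∀ Y : ModuleCat.{u} Λ, Module.Finite Λ Y →
    (InAdd M Y ↔ ∀ i : ℕ, 1 ≤ i → i < d → Subsingleton (Abelian.Ext M Y i)))

/-- The algebra `Λ` is weakly `d`-representation-finite: it is a finite-dimensional `k`-algebra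
having a `d`-cluster-tilting module. -/
def IsWeaklyRepFinite (k Λ : Type u) [Field k] [Ring Λ] [Algebra k Λ] (d : ℕ) : Prop :=
  Module.Finite k Λ ∧ ∃ M : ModuleCat.{u} Λ, IsClusterTilting d M

end ClusterTilting

/-! ### The category `A^{(d)}`, its orbit categories, and their quotients -/

/-- The poset `ℤ^d` with the product order. -/
abbrev Vtx (d : ℕ) : Type := Fin d → ℤ

/-- Translation by `m * p * (1, …, 1)`, that is, the action of `φ_d ^ (- m * p)` on vertices. -/
def shift {d : ℕ} (p : ℕ) (m : ℤ) (x : Vtx d) : Vtx d := fun i => x i + m * p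

section Shift

variable {d : ℕ} (p : ℕ)

lemma shift_zero (x : Vtx d) : shift p 0 x = x := by
  funext i; simp [shift]

lemma shift_shift (a b : ℤ) (x : Vtx d) : shift p a (shift p b x) = shift p (a + b) x := by
  funext i; simp only [shift]; ring

lemma shift_le_shift (m : ℤ) {x y : Vtx d} : shift p m x ≤ shift p m y ↔ x ≤ y := by
  simp [shift, Pi.le_def]

lemma shift_inj (m : ℤ) {x y : Vtx d} : shift p m x = shift p m y ↔ x = y := by
  simp [shift, funext_iff]

end Shift

variable (k : Type u) [Field k]

/-- The algebra (without unit, but with enough idempotents) of the orbit category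
`A^{(d)} / φ_d ^ p`, i.e. the direct sum of all its spaces of morphisms. A morphism between two
orbits is a `φ_d ^ p`-invariant family of morphisms of `A^{(d)}`, and a finite sum of such
morphisms is a `φ_d ^ p`-invariant function on the pairs `x ≤ y` of elements of `ℤ^d` whose
support is a finite union of orbits of pairs. The basis vector `f_{yx}` is the function supported
at `(x, y)`, so left modules are contravariant representations.
For `p = 0` this is the algebra of the incidence category `A^{(d)}` itself. -/
def orbitAlg (d p : ℕ) : NonUnitalSubalgebra k (IncidenceAlgebra k (Vtx d)) where
  carrier := {a | (∀ m x y, a (shift p m x) (shift p m y) = a x y) ∧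
    ∃ F : Finset (Vtx d), ∀ x y, a x y ≠ 0 → ∃ m, shift p m x ∈ F ∧ shift p m y ∈ F}
  zero_mem' := ⟨fun _ _ _ => rfl, ∅, fun _ _ h => (h rfl).elim⟩
  add_mem' := by
    classical
    rintro a b ⟨ha, F, hF⟩ ⟨hb, G, hG⟩
    refine ⟨fun m x y => by simp [IncidenceAlgebra.add_apply, ha, hb], F ∪ G, fun x y h => ?_⟩
    by_cases h' : a x y = 0
    · obtain ⟨m, h1, h2⟩ := hG x y (by
        intro h0; exact h (by simp [IncidenceAlgebra.add_apply, h', h0]))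
      exact ⟨m, Finset.mem_union_right _ h1, Finset.mem_union_right _ h2⟩
    · obtain ⟨m, h1, h2⟩ := hF x y h'
      exact ⟨m, Finset.mem_union_left _ h1, Finset.mem_union_left _ h2⟩
  smul_mem' := by
    rintro c a ⟨ha, F, hF⟩
    refine ⟨fun m x y => by simp [IncidenceAlgebra.constSMul_apply, ha], F, fun x y h => ?_⟩
    exact hF x y (fun h0 => h (by simp [IncidenceAlgebra.constSMul_apply, h0]))
  mul_mem' := by
    classical
    rintro a b ⟨ha, F, hF⟩ ⟨hb, G, hG⟩
    constructor
    · intro m x y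
      rw [IncidenceAlgebra.mul_apply, IncidenceAlgebra.mul_apply]
      refine Finset.sum_nbij' (shift p (-m)) (shift p m) ?_ ?_ ?_ ?_ ?_
      · intro z hz
        rw [Finset.mem_Icc] at hz ⊢
        rw [← shift_le_shift p m, ← shift_le_shift p m (x := shift p (-m) z)]
        simpa [shift_shift, shift_zero] using hz
      · intro z hz
        rw [Finset.mem_Icc] at hz ⊢
        simpa [shift_le_shift] using hz
      · intro z _; simp [shift_shift, shift_zero]
      · intro z _; simp [shift_shift, shift_zero]
      · intro z _
        rw [← ha m x, ← hb m _ y]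
        simp [shift_shift, shift_zero]
    · refine ⟨F ∪ ((G ×ˢ F) ×ˢ G).image (fun t => t.1.1 + (t.1.2 - t.2)), fun x y h => ?_⟩
      rw [IncidenceAlgebra.mul_apply] at h
      obtain ⟨z, -, hz⟩ := Finset.exists_ne_zero_of_sum_ne_zero h
      obtain ⟨m, h1, h2⟩ := hF x z (left_ne_zero_of_mul hz)
      obtain ⟨m', h3, h4⟩ := hG z y (right_ne_zero_of_mul hz)
      refine ⟨m, Finset.mem_union_left _ h1, Finset.mem_union_right _ ?_⟩
      refine Finset.mem_image.2 ⟨((shift p m' y, shift p m z), shift p m' z), ?_, ?_⟩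
      · simp [h2, h3, h4]
      · funext i; simp [shift]

open Classical in
/-- The image in `A^{(d)} / φ_d ^ p` of the basis vector `f_{vu} : u ⟶ v`, `u ≤ v`, of `A^{(d)}`
(and `0` if `u ≤ v` fails). -/
def arrow {d : ℕ} (p : ℕ) (u v : Vtx d) : orbitAlg k d p :=
  ⟨⟨fun x y => if u ≤ v ∧ ∃ m, x = shift p m u ∧ y = shift p m v then 1 else 0, by
      intro x y h
      refine if_neg ?_
      rintro ⟨huv, m, rfl, rfl⟩
      exact h ((shift_le_shift p m).2 huv)⟩, by
    constructor
    · intro m x y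
      have key : (∃ m', shift p m x = shift p m' u ∧ shift p m y = shift p m' v) ↔
          ∃ m', x = shift p m' u ∧ y = shift p m' v := by
        constructor
        · rintro ⟨m', h1, h2⟩
          refine ⟨m' - m, ?_, ?_⟩
          · rw [← shift_inj p m, h1, shift_shift]; congr 1; ring
          · rw [← shift_inj p m, h2, shift_shift]; congr 1; ring
        · rintro ⟨m', rfl, rfl⟩
          exact ⟨m + m', shift_shift _ _ _ _, shift_shift _ _ _ _⟩
      simp only [IncidenceAlgebra.coe_mk, key]
    · refine ⟨{u, v}, fun x y h => ?_⟩
      simp only [IncidenceAlgebra.coe_mk, ne_eq, ite_eq_right_iff, not_forall] at h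
      obtain ⟨⟨-, m, rfl, rfl⟩, -⟩ := h
      exact ⟨-m, by simp [shift_shift, shift_zero], by simp [shift_shift, shift_zero]⟩⟩

/-- A set of vertices and a set of morphisms `f_{vu}`, both stable under `φ_d ^ p`; the vertices
fall into finitely many orbits. -/
structure QuotientData (d p : ℕ) where
  /-- the vertices that are kept -/
  verts : Set (Vtx d)
  /-- pairs `(u, v)` such that `f_{vu}` is killed -/
  rels : Set (Vtx d × Vtx d)
  verts_shift : ∀ m x, x ∈ verts → shift p m x ∈ verts
  rels_shift : ∀ m u v, (u, v) ∈ rels → (shift p m u, shift p m v) ∈ rels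
  verts_finite : ∃ F : Finset (Vtx d), ∀ x ∈ verts, ∃ m, shift p m x ∈ F

variable {d p : ℕ} (D : QuotientData d p)

/-- The two-sided ideal of `A^{(d)} / φ_d ^ p` generated by the idempotents of the vertices
that are not kept and by the morphisms that are killed. -/
def relIdeal : TwoSidedIdeal (orbitAlg k d p) :=
  TwoSidedIdeal.span
    ({a | ∃ z, z ∉ D.verts ∧ a = arrow k p z z} ∪ {a | ∃ u v, (u, v) ∈ D.rels ∧ a = arrow k p u v})

/-- The quotient of `A^{(d)} / φ_d ^ p` by the ideal `relIdeal`. -/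
def QuotAlg : Type u := (relIdeal k D).ringCon.Quotient

open Classical in
/-- The sum of the idempotents of the vertices in `T`. -/
def idem (T : Set (Vtx d)) (hT : ∀ m x, x ∈ T → shift p m x ∈ T)
    (hF : ∃ F : Finset (Vtx d), ∀ x ∈ T, ∃ m, shift p m x ∈ F) : orbitAlg k d p :=
  ⟨⟨fun x y => if x = y ∧ x ∈ T then 1 else 0, fun x y h => if_neg fun h' => h h'.1.le⟩, by
    constructor
    · intro m x y
      have : shift p m x ∈ T ↔ x ∈ T :=
        ⟨fun h => by simpa [shift_shift, shift_zero] using hT (-m) _ h, hT m x⟩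
      simp only [IncidenceAlgebra.coe_mk, shift_inj, this]
    · obtain ⟨F, hF⟩ := hF
      refine ⟨F, fun x y h => ?_⟩
      simp only [IncidenceAlgebra.coe_mk, ne_eq, ite_eq_right_iff, not_forall] at h
      obtain ⟨⟨rfl, hx⟩, -⟩ := h
      obtain ⟨m, hm⟩ := hF x hx
      exact ⟨m, hm, hm⟩⟩

/-- The sum of the idempotents of the vertices that are kept. -/
def unitElt : orbitAlg k d p := idem k D.verts D.verts_shift D.verts_finite

section Unit

lemma orbit_ext {a b : orbitAlg k d p} (h : ∀ x y, a.1 x y = b.1 x y) : a = b :=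
  Subtype.ext (IncidenceAlgebra.ext fun x y _ => h x y)

open Classical in
lemma idem_apply (T : Set (Vtx d)) (hT hF) (x y : Vtx d) :
    (idem (p := p) k T hT hF).1 x y = if x = y ∧ x ∈ T then 1 else 0 := rfl

open Classical in
lemma arrow_apply (u v x y : Vtx d) :
    (arrow k p u v).1 x y =
      if u ≤ v ∧ ∃ m, x = shift p m u ∧ y = shift p m v then 1 else 0 := rfl

open Classical in
lemma idem_mul_apply (T : Set (Vtx d)) (hT hF) (a : orbitAlg k d p) (x y : Vtx d) :
    (idem k T hT hF * a).1 x y = if x ∈ T then a.1 x y else 0 := by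
  change ((idem k T hT hF).1 * a.1) x y = _
  rw [IncidenceAlgebra.mul_apply]
  by_cases h : x ≤ y
  · rw [Finset.sum_eq_single x]
    · simp [idem_apply]
    · intro z _ hz; simp [idem_apply, hz.symm]
    · intro hx; exact (hx (by simp [h])).elim
  · rw [IncidenceAlgebra.apply_eq_zero_of_not_le h, Finset.Icc_eq_empty h]; simp

open Classical in
lemma mul_idem_apply (T : Set (Vtx d)) (hT hF) (a : orbitAlg k d p) (x y : Vtx d) :
    (a * idem k T hT hF).1 x y = if y ∈ T then a.1 x y else 0 := by
  change (a.1 * (idem k T hT hF).1) x y = _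
  rw [IncidenceAlgebra.mul_apply]
  by_cases h : x ≤ y
  · rw [Finset.sum_eq_single y]
    · simp [idem_apply]
    · intro z _ hz; simp [idem_apply, hz]
    · intro hx; exact (hx (by simp [h])).elim
  · rw [IncidenceAlgebra.apply_eq_zero_of_not_le h, Finset.Icc_eq_empty h]; simp

lemma orbit_smul_mul (c : k) (a b : orbitAlg k d p) : (c • a) * b = c • (a * b) := by
  refine orbit_ext k fun x y => ?_
  change ((c • a.1) * b.1) x y = (c • (a.1 * b.1)) x y
  simp only [IncidenceAlgebra.constSMul_apply, IncidenceAlgebra.mul_apply, smul_eq_mul,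
    Finset.mul_sum, mul_assoc]

lemma orbit_mul_smul (c : k) (a b : orbitAlg k d p) : a * (c • b) = c • (a * b) := by
  refine orbit_ext k fun x y => ?_
  change (a.1 * (c • b.1)) x y = (c • (a.1 * b.1)) x y
  simp only [IncidenceAlgebra.constSMul_apply, IncidenceAlgebra.mul_apply, smul_eq_mul,
    Finset.mul_sum, mul_left_comm]

/-- The vertices that are not kept and whose orbit meets `F`. -/
def offVerts (F : Finset (Vtx d)) : Set (Vtx d) := {x | x ∉ D.verts ∧ ∃ m, shift p m x ∈ F}

lemma offVerts_shift (F : Finset (Vtx d)) (m : ℤ) (x : Vtx d) (hx : x ∈ offVerts D F) :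
    shift p m x ∈ offVerts D F := by
  obtain ⟨h, m', hm'⟩ := hx
  refine ⟨fun h' => h ?_, m' - m, ?_⟩
  · simpa [shift_shift, shift_zero] using D.verts_shift (-m) _ h'
  · rw [shift_shift]; simpa using hm'

lemma offVerts_finite (F : Finset (Vtx d)) :
    ∃ G : Finset (Vtx d), ∀ x ∈ offVerts D F, ∃ m, shift p m x ∈ G := ⟨F, fun _ h => h.2⟩

lemma idem_off_mem (F : Finset (Vtx d)) :
    idem k (offVerts D F) (offVerts_shift D F) (offVerts_finite D F) ∈ relIdeal k D := by
  classical
  induction F using Finset.induction_on with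
  | empty =>
    convert (relIdeal k D).zero_mem
    refine orbit_ext k fun x y => ?_
    rw [idem_apply, if_neg]
    · rfl
    · rintro ⟨-, -, m, hm⟩; simp at hm
  | insert z F hz ih =>
    by_cases h : z ∈ D.verts ∨ z ∈ offVerts D F
    · convert ih using 1
      refine orbit_ext k fun x y => ?_
      rw [idem_apply, idem_apply]
      have : x ∈ offVerts D (insert z F) ↔ x ∈ offVerts D F := by
        constructor
        · rintro ⟨hx, m, hm⟩
          rcases Finset.mem_insert.1 hm with hm | hm
          · rcases h with h | h
            · rw [← hm] at h
              exact (hx (by simpa [shift_shift, shift_zero] using D.verts_shift (-m) _ h)).elim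
            · rw [← hm] at h
              simpa [shift_shift, shift_zero] using offVerts_shift D F (-m) _ h
          · exact ⟨hx, m, hm⟩
        · rintro ⟨hx, m, hm⟩
          exact ⟨hx, m, Finset.mem_insert_of_mem hm⟩
      simp only [this]
    · push Not at h
      have harrow : arrow k p z z ∈ relIdeal k D :=
        TwoSidedIdeal.subset_span (Or.inl ⟨z, h.1, rfl⟩)
      convert (relIdeal k D).add_mem ih harrow using 1
      refine orbit_ext k fun x y => ?_
      change _ = (idem k (offVerts D F) _ _).1 x y + (arrow k p z z).1 x y
      rw [idem_apply, idem_apply, arrow_apply]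
      by_cases hxy : x = y
      · subst hxy
        by_cases h1 : ∃ m, x = shift p m z
        · obtain ⟨m, rfl⟩ := h1
          have e1 : shift p m z ∈ offVerts D (insert z F) := by
            refine offVerts_shift D _ m z ⟨h.1, 0, ?_⟩
            simp [shift_zero]
          have e2 : shift p m z ∉ offVerts D F := fun h' => h.2 (by
            simpa [shift_shift, shift_zero] using offVerts_shift D F (-m) _ h')
          rw [if_pos ⟨rfl, e1⟩, if_neg (fun h' => e2 h'.2), if_pos ⟨le_rfl, m, rfl, rfl⟩, zero_add]
        · have e : x ∈ offVerts D (insert z F) ↔ x ∈ offVerts D F := by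
            constructor
            · rintro ⟨hx, m, hm⟩
              rcases Finset.mem_insert.1 hm with hm | hm
              · exact (h1 ⟨-m, by rw [← hm]; simp [shift_shift, shift_zero]⟩).elim
              · exact ⟨hx, m, hm⟩
            · rintro ⟨hx, m, hm⟩
              exact ⟨hx, m, Finset.mem_insert_of_mem hm⟩
          have e' : ¬ (z ≤ z ∧ ∃ m, x = shift p m z ∧ x = shift p m z) :=
            fun h' => h1 ⟨h'.2.choose, h'.2.choose_spec.1⟩
          rw [if_neg e', add_zero]
          simp only [e]
      · rw [if_neg (fun h' => hxy h'.1), if_neg (fun h' => hxy h'.1), if_neg, add_zero]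
        rintro ⟨-, m, rfl, rfl⟩
        exact hxy rfl

lemma unit_mul_sub_mem (a : orbitAlg k d p) : unitElt k D * a - a ∈ relIdeal k D := by
  classical
  obtain ⟨F, hF⟩ := a.2.2
  have h := (relIdeal k D).neg_mem ((relIdeal k D).mul_mem_right _ a (idem_off_mem k D F))
  convert h using 1
  refine orbit_ext k fun x y => ?_
  change (unitElt k D * a).1 x y - a.1 x y = -((idem k _ _ _ * a).1 x y)
  rw [unitElt, idem_mul_apply, idem_mul_apply]
  by_cases hx : x ∈ D.verts
  · have : x ∉ offVerts D F := fun h' => h'.1 hx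
    simp [hx, this]
  · by_cases ha : a.1 x y = 0
    · simp [ha]
    · obtain ⟨m, h1, -⟩ := hF x y ha
      have : x ∈ offVerts D F := ⟨hx, m, h1⟩
      simp [hx, this]

lemma mul_unit_sub_mem (a : orbitAlg k d p) : a * unitElt k D - a ∈ relIdeal k D := by
  classical
  obtain ⟨F, hF⟩ := a.2.2
  have h := (relIdeal k D).neg_mem ((relIdeal k D).mul_mem_left a _ (idem_off_mem k D F))
  convert h using 1
  refine orbit_ext k fun x y => ?_
  change (a * unitElt k D).1 x y - a.1 x y = -((a * idem k _ _ _).1 x y)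
  rw [unitElt, mul_idem_apply, mul_idem_apply]
  by_cases hx : y ∈ D.verts
  · have : y ∉ offVerts D F := fun h' => h'.1 hx
    simp [hx, this]
  · by_cases ha : a.1 x y = 0
    · simp [ha]
    · obtain ⟨m, -, h1⟩ := hF x y ha
      have : y ∈ offVerts D F := ⟨hx, m, h1⟩
      simp [hx, this]

end Unit

/-- The class of an element in the quotient. -/
def QuotAlg.mk (a : orbitAlg k d p) : QuotAlg k D := (a : (relIdeal k D).ringCon.Quotient)

instance : AddCommGroup (QuotAlg k D) :=
  inferInstanceAs (AddCommGroup (relIdeal k D).ringCon.Quotient)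

instance : Mul (QuotAlg k D) :=
  inferInstanceAs (Mul (relIdeal k D).ringCon.Quotient)

lemma QuotAlg.mk_surjective : Function.Surjective (QuotAlg.mk k D) := Quotient.mk''_surjective

lemma QuotAlg.mk_eq {a b : orbitAlg k d p} :
    QuotAlg.mk k D a = QuotAlg.mk k D b ↔ a - b ∈ relIdeal k D := by
  rw [← TwoSidedIdeal.rel_iff]
  exact RingCon.eq _

lemma QuotAlg.mk_mul (a b : orbitAlg k d p) :
    QuotAlg.mk k D (a * b) = QuotAlg.mk k D a * QuotAlg.mk k D b := rfl

lemma QuotAlg.mk_add (a b : orbitAlg k d p) :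
    QuotAlg.mk k D (a + b) = QuotAlg.mk k D a + QuotAlg.mk k D b := rfl

/-- The quotient is unital, since only finitely many orbits of vertices are kept. -/
instance : Ring (QuotAlg k D) where
  one := QuotAlg.mk k D (unitElt k D)
  one_mul x := by
    obtain ⟨a, rfl⟩ := QuotAlg.mk_surjective k D x
    exact (QuotAlg.mk_eq k D).2 (unit_mul_sub_mem k D a)
  mul_one x := by
    obtain ⟨a, rfl⟩ := QuotAlg.mk_surjective k D x
    exact (QuotAlg.mk_eq k D).2 (mul_unit_sub_mem k D a)
  mul_assoc x y z := by
    obtain ⟨a, rfl⟩ := QuotAlg.mk_surjective k D x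
    obtain ⟨b, rfl⟩ := QuotAlg.mk_surjective k D y
    obtain ⟨c, rfl⟩ := QuotAlg.mk_surjective k D z
    simp only [← QuotAlg.mk_mul, mul_assoc]
  left_distrib x y z := by
    obtain ⟨a, rfl⟩ := QuotAlg.mk_surjective k D x
    obtain ⟨b, rfl⟩ := QuotAlg.mk_surjective k D y
    obtain ⟨c, rfl⟩ := QuotAlg.mk_surjective k D z
    simp only [← QuotAlg.mk_mul, ← QuotAlg.mk_add, mul_add]
  right_distrib x y z := by
    obtain ⟨a, rfl⟩ := QuotAlg.mk_surjective k D x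
    obtain ⟨b, rfl⟩ := QuotAlg.mk_surjective k D y
    obtain ⟨c, rfl⟩ := QuotAlg.mk_surjective k D z
    simp only [← QuotAlg.mk_mul, ← QuotAlg.mk_add, add_mul]
  zero_mul x := by
    obtain ⟨a, rfl⟩ := QuotAlg.mk_surjective k D x
    change QuotAlg.mk k D 0 * QuotAlg.mk k D a = QuotAlg.mk k D 0
    rw [← QuotAlg.mk_mul, zero_mul]
  mul_zero x := by
    obtain ⟨a, rfl⟩ := QuotAlg.mk_surjective k D x
    change QuotAlg.mk k D a * QuotAlg.mk k D 0 = QuotAlg.mk k D 0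
    rw [← QuotAlg.mk_mul, mul_zero]
  zsmul := (inferInstance : AddCommGroup (QuotAlg k D)).zsmul
  zsmul_zero' := (inferInstance : AddCommGroup (QuotAlg k D)).zsmul_zero'
  zsmul_succ' := (inferInstance : AddCommGroup (QuotAlg k D)).zsmul_succ'
  zsmul_neg' := (inferInstance : AddCommGroup (QuotAlg k D)).zsmul_neg'
  neg_add_cancel := neg_add_cancel
  sub_eq_add_neg := sub_eq_add_neg

lemma QuotAlg.one_def : (1 : QuotAlg k D) = QuotAlg.mk k D (unitElt k D) := rfl

/-- The `k`-algebra structure of the quotient: `c` acts as the class of `c` times the unit. -/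
instance : Algebra k (QuotAlg k D) :=
  RingHom.toAlgebra'
    { toFun := fun c => QuotAlg.mk k D (c • unitElt k D)
      map_one' := by rw [one_smul]; rfl
      map_mul' := fun a b => by
        have h : QuotAlg.mk k D (a • unitElt k D) * QuotAlg.mk k D (b • unitElt k D) =
            QuotAlg.mk k D (unitElt k D * ((a * b) • unitElt k D)) := by
          rw [← QuotAlg.mk_mul, orbit_smul_mul, orbit_mul_smul, orbit_mul_smul, smul_smul]
        rw [h, QuotAlg.mk_mul, ← QuotAlg.one_def, one_mul]
      map_zero' := by rw [zero_smul]; rfl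
      map_add' := fun a b => by rw [add_smul]; rfl }
    (fun c x => by
      obtain ⟨a, rfl⟩ := QuotAlg.mk_surjective k D x
      change QuotAlg.mk k D (c • unitElt k D) * QuotAlg.mk k D a =
        QuotAlg.mk k D a * QuotAlg.mk k D (c • unitElt k D)
      have h1 : QuotAlg.mk k D (c • unitElt k D) * QuotAlg.mk k D a =
          QuotAlg.mk k D (unitElt k D * (c • a)) := by
        rw [← QuotAlg.mk_mul, orbit_smul_mul, orbit_mul_smul]
      have h2 : QuotAlg.mk k D a * QuotAlg.mk k D (c • unitElt k D) =
          QuotAlg.mk k D ((c • a) * unitElt k D) := by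
        rw [← QuotAlg.mk_mul, orbit_smul_mul, orbit_mul_smul]
      rw [h1, h2, QuotAlg.mk_mul, QuotAlg.mk_mul, ← QuotAlg.one_def, one_mul, mul_one])

/-! ### Interval modules -/

/-- The interval `[lo, hi]` of `ℤ^d` consists of vertices that are kept and contains no relation. -/
def IsAdmissible (lo hi : Vtx d) : Prop :=
  (∀ z, lo ≤ z → z ≤ hi → z ∈ D.verts) ∧
    ∀ u v, (u, v) ∈ D.rels → lo ≤ u → u ≤ v → v ≤ hi → False

variable {D} {lo hi : Vtx d}

/-- The entries of an element of `A^{(d)} / φ_d ^ p` at the pairs of vertices in `[lo, hi]`. -/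
def restrictMat (lo hi : Vtx d) (a : orbitAlg k d p) :
    Matrix (Finset.Icc lo hi) (Finset.Icc lo hi) k :=
  Matrix.of fun x y => a.1 x.1 y.1

lemma restrictMat_add (a b : orbitAlg k d p) :
    restrictMat k lo hi (a + b) = restrictMat k lo hi a + restrictMat k lo hi b := rfl

lemma restrictMat_mul (a b : orbitAlg k d p) :
    restrictMat k lo hi (a * b) = restrictMat k lo hi a * restrictMat k lo hi b := by
  ext x y
  rw [Matrix.mul_apply]
  change (a.1 * b.1) x.1 y.1 = ∑ z : Finset.Icc lo hi, a.1 x.1 z.1 * b.1 z.1 y.1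
  rw [IncidenceAlgebra.mul_apply, Finset.sum_coe_sort (Finset.Icc lo hi)
    (fun z => a.1 x.1 z * b.1 z y.1)]
  have hx := Finset.mem_Icc.1 x.2
  have hy := Finset.mem_Icc.1 y.2
  refine Finset.sum_subset (Finset.Icc_subset_Icc hx.1 hy.2) fun z _ hz => ?_
  by_cases h : x.1 ≤ z
  · rw [IncidenceAlgebra.apply_eq_zero_of_not_le (fun h' => hz (Finset.mem_Icc.2 ⟨h, h'⟩)) b.1,
      mul_zero]
  · rw [IncidenceAlgebra.apply_eq_zero_of_not_le h, zero_mul]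

lemma restrictMat_eq_zero (h : IsAdmissible D lo hi) {a : orbitAlg k d p}
    (ha : a ∈ relIdeal k D) : restrictMat k lo hi a = 0 := by
  classical
  let J : TwoSidedIdeal (orbitAlg k d p) := TwoSidedIdeal.mk' {a | restrictMat k lo hi a = 0}
    rfl
    (fun {a b} ha hb => by
      have ha : restrictMat k lo hi a = 0 := ha
      have hb : restrictMat k lo hi b = 0 := hb
      change restrictMat k lo hi (a + b) = 0
      rw [restrictMat_add, ha, hb, add_zero])
    (fun {a} ha => by
      have ha : restrictMat k lo hi a = 0 := ha
      change -restrictMat k lo hi a = 0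
      rw [ha, neg_zero])
    (fun {a b} hb => by
      have hb : restrictMat k lo hi b = 0 := hb
      change restrictMat k lo hi (a * b) = 0
      rw [restrictMat_mul, hb, mul_zero])
    (fun {a b} ha => by
      have ha : restrictMat k lo hi a = 0 := ha
      change restrictMat k lo hi (a * b) = 0
      rw [restrictMat_mul, ha, zero_mul])
  have hle : relIdeal k D ≤ J := by
    refine TwoSidedIdeal.span_le.2 ?_
    rintro a (⟨z, hz, rfl⟩ | ⟨u, v, huv, rfl⟩)
    · refine (TwoSidedIdeal.mem_mk' _ _ _ _ _ _ _).2 ?_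
      ext x y
      change (arrow k p z z).1 x.1 y.1 = 0
      rw [arrow_apply, if_neg]
      rintro ⟨-, m, hx, -⟩
      have hxI := Finset.mem_Icc.1 x.2
      have := D.verts_shift (-m) _ (h.1 _ hxI.1 hxI.2)
      rw [hx, shift_shift] at this
      exact hz (by simpa [shift_zero] using this)
    · refine (TwoSidedIdeal.mem_mk' _ _ _ _ _ _ _).2 ?_
      ext x y
      change (arrow k p u v).1 x.1 y.1 = 0
      rw [arrow_apply, if_neg]
      rintro ⟨hle, m, hx, hy⟩
      refine h.2 _ _ (D.rels_shift m u v huv) ?_ ((shift_le_shift p m).2 hle) ?_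
      · rw [← hx]; exact (Finset.mem_Icc.1 x.2).1
      · rw [← hy]; exact (Finset.mem_Icc.1 y.2).2
  have haJ : a ∈ J := hle ha
  have := (TwoSidedIdeal.mem_mk' {a | restrictMat k lo hi a = 0} _ _ _ _ _ a).1 haJ
  exact this

lemma restrictMat_unitElt (h : IsAdmissible D lo hi) : restrictMat k lo hi (unitElt k D) = 1 := by
  classical
  ext x y
  change (idem (p := p) k D.verts D.verts_shift D.verts_finite).1 x.1 y.1 = _
  have hx := h.1 x.1 (Finset.mem_Icc.1 x.2).1 (Finset.mem_Icc.1 x.2).2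
  rw [idem_apply, Matrix.one_apply]
  by_cases hxy : x = y
  · rw [if_pos hxy, if_pos ⟨congrArg _ hxy, hx⟩]
  · rw [if_neg hxy, if_neg fun h' => hxy (Subtype.ext h'.1)]

/-- The matrix representation of the quotient algebra on an admissible interval. -/
def intervalRep (h : IsAdmissible D lo hi) :
    QuotAlg k D →+* Matrix (Finset.Icc lo hi) (Finset.Icc lo hi) k where
  toFun := fun x => Quotient.liftOn' x (restrictMat k lo hi) (fun a b hab => by
    have := restrictMat_eq_zero k h (((relIdeal k D).rel_iff a b).1 hab)
    have e : restrictMat k lo hi a - restrictMat k lo hi b = 0 := this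
    exact sub_eq_zero.1 e)
  map_one' := restrictMat_unitElt k h
  map_zero' := rfl
  map_mul' x y := by
    obtain ⟨a, rfl⟩ := QuotAlg.mk_surjective k D x
    obtain ⟨b, rfl⟩ := QuotAlg.mk_surjective k D y
    exact restrictMat_mul k a b
  map_add' x y := by
    obtain ⟨a, rfl⟩ := QuotAlg.mk_surjective k D x
    obtain ⟨b, rfl⟩ := QuotAlg.mk_surjective k D y
    rfl

/-- The interval module on `[lo, hi]` (if `p > 0`, its image under the push-down functor): it has
a basis indexed by the vertices in `[lo, hi]`, and for `x ≤ y` in `[lo, hi]` the morphism `f_{yx}`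
sends the basis vector at `y` to the one at `x`, all other basis elements acting by zero. -/
def IntervalModule (_h : IsAdmissible D lo hi) : Type u := Finset.Icc lo hi → k

instance (h : IsAdmissible D lo hi) : AddCommGroup (IntervalModule k h) :=
  inferInstanceAs (AddCommGroup (Finset.Icc lo hi → k))

instance (h : IsAdmissible D lo hi) : Module (QuotAlg k D) (IntervalModule k h) :=
  Module.compHom (Finset.Icc lo hi → k)
    ((Matrix.toLinAlgEquiv' : Matrix (Finset.Icc lo hi) (Finset.Icc lo hi) k ≃ₐ[k]
      Module.End k (Finset.Icc lo hi → k)).toRingEquiv.toRingHom.comp (intervalRep k h))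

/-- The class of `a` acts on the interval module by the matrix of entries of `a`. -/
lemma intervalModule_smul (h : IsAdmissible D lo hi) (a : orbitAlg k d p)
    (v : IntervalModule k h) :
    QuotAlg.mk k D a • v = (restrictMat k lo hi a).mulVec v := rfl

/-! ### Kupisch series and ordered sequences -/

/-- The last index of a non-empty sequence. -/
abbrev lastIdx (e : ℕ) [NeZero e] : Fin e := Fin.rev 0

/-- The set `os^{(e)}` of non-increasing sequences `μ_1 ≥ ⋯ ≥ μ_e` of integers. -/
def os (e : ℕ) : Set (Vtx e) := {μ | Antitone μ}

/-- The set `os^{(e)}_n`: sequences in `os^{(e)}` with `n - 1 ≥ μ_1` and `μ_e ≥ 0`. -/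
def osN (e n : ℕ) [NeZero e] : Set (Vtx e) :=
  {μ | μ ∈ os e ∧ μ 0 ≤ (n : ℤ) - 1 ∧ 0 ≤ μ (lastIdx e)}

/-- A Kupisch series `(ℓ_0, …, ℓ_{n-1})` of type `𝔸_n`: positive integers with `ℓ_0 = 1` and
`ℓ_i ≤ ℓ_{i-1} + 1`. Entries `ℓ_i = 1` with `i > 0`, for which the algebra is not connected, are
allowed. -/
structure KupischA (n : ℕ) [NeZero n] where
  len : Fin n → ℕ
  pos : ∀ i, 1 ≤ len i
  first : len 0 = 1
  step : ∀ i j : Fin n, (j : ℕ) = i + 1 → len j ≤ len i + 1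

/-- A Kupisch series `(ℓ_0, …, ℓ_{n-1})` of type `𝔸̃_{n-1}`: positive integers, indexed modulo
`n`, with `ℓ_i ≤ ℓ_{i-1} + 1` for all `i`. -/
structure KupischTilde (n : ℕ) [NeZero n] where
  len : ZMod n → ℕ
  pos : ∀ i, 1 ≤ len i
  step : ∀ i, len i ≤ len (i - 1) + 1

/-- The set `os^{(e)}_ℓ` for `ℓ` of type `𝔸_n`. -/
def KupischA.os {n : ℕ} [NeZero n] (ℓ : KupischA n) (e : ℕ) [NeZero e] : Set (Vtx e) :=
  {μ | μ ∈ osN e n ∧ ∃ i : Fin n, μ 0 = (i : ℕ) ∧ μ 0 - μ (lastIdx e) + 1 ≤ ℓ.len i}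

/-- The set `os^{(e)}_{ℓ̃}` for `ℓ` of type `𝔸̃_{n-1}`, with `ℓ̃` the periodic extension of `ℓ`. -/
def KupischTilde.os {n : ℕ} [NeZero n] (ℓ : KupischTilde n) (e : ℕ) [NeZero e] : Set (Vtx e) :=
  {μ | μ ∈ HigherNakayama.os e ∧ μ 0 - μ (lastIdx e) + 1 ≤ ℓ.len (μ 0 : ZMod n)}

/-- The lower end `(λ_2, …, λ_{d+1})` of the interval given by `λ`. -/
def lower (lam : Vtx (d + 1)) : Vtx d := fun i => lam i.succ

/-- The upper end `(λ_1, …, λ_d)` of the interval given by `λ`. -/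
def upper (lam : Vtx (d + 1)) : Vtx d := fun i => lam i.castSucc

/-- All elements of `ℤ^d` in the interval `[lower λ, upper λ]` lie in `os^{(d)}`. -/
lemma mem_os_of_mem_interval {lam : Vtx (d + 1)} {z : Vtx d} (h1 : lower lam ≤ z)
    (h2 : z ≤ upper lam) (hlam : lam ∈ os (d + 1)) : z ∈ os d := by
  intro i j hij
  rcases hij.eq_or_lt with rfl | hlt
  · exact le_rfl
  · have a := h2 j
    have b := h1 i
    have c : lam j.castSucc ≤ lam i.succ := hlam (by
      rw [Fin.le_def]; simpa using hlt)
    exact a.trans (c.trans b)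

lemma le_zero_of_os {e : ℕ} [NeZero e] {μ : Vtx e} (h : μ ∈ os e) (i : Fin e) : μ i ≤ μ 0 :=
  h (Fin.zero_le i)

lemma last_le_of_os {e : ℕ} [NeZero e] {μ : Vtx e} (h : μ ∈ os e) (i : Fin e) :
    μ (lastIdx e) ≤ μ i :=
  h (by rw [Fin.le_def, Fin.val_rev]; simp; omega)

variable {n : ℕ} [NeZero n] [NeZero d]

lemma lower_last (lam : Vtx (d + 1)) : lower lam (lastIdx d) = lam (lastIdx (d + 1)) := by
  unfold lower
  congr 1
  ext
  have := NeZero.pos d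
  simp [Fin.val_rev]
  omega

lemma upper_zero (lam : Vtx (d + 1)) : upper lam 0 = lam 0 := rfl

/-! ### Higher Nakayama algebras of type `𝔸` -/

lemma KupischA.mono (ℓ : KupischA n) {i j : Fin n} (h : i ≤ j) :
    (i : ℤ) - ℓ.len i ≤ (j : ℤ) - ℓ.len j := by
  obtain ⟨i, hi⟩ := i
  obtain ⟨j, hj⟩ := j
  replace h : i ≤ j := h
  induction j, h using Nat.le_induction with
  | base => exact le_rfl
  | succ m hm ih =>
    have h1 := ih (by omega)
    have h2 := ℓ.step ⟨m, by omega⟩ ⟨m + 1, hj⟩ rfl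
    push_cast at *
    omega

/-- For `d ≥ 2` only the idempotents of the vertices outside `os^{(d)}_ℓ` are killed. For `d = 1`
all vertices `0, …, n - 1` are kept, and the paths `i - ℓ_i ⇝ i` with `ℓ_{i-1} ≥ ℓ_i` are
killed. -/
def KupischA.data (ℓ : KupischA n) (d : ℕ) [NeZero d] : QuotientData d 0 where
  verts := ℓ.os d
  rels := {q | d = 1 ∧ ∃ j i : Fin n, (i : ℕ) = j + 1 ∧ ℓ.len i ≤ ℓ.len j ∧
    q = (fun _ => (i : ℤ) - ℓ.len i, fun _ => (i : ℤ))}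
  verts_shift m x hx := by
    have : shift 0 m x = x := by funext i; simp [shift]
    rwa [this]
  rels_shift m u v h := by
    have (x : Vtx d) : shift 0 m x = x := by funext i; simp [shift]
    rwa [this, this]
  verts_finite := by
    refine ⟨Finset.Icc (fun _ => 0) (fun _ => (n : ℤ)), fun x hx => ⟨0, ?_⟩⟩
    rw [shift_zero, Finset.mem_Icc]
    obtain ⟨⟨h1, h2, h3⟩, -⟩ := hx
    refine ⟨fun i => h3.trans (last_le_of_os h1 i), fun i => (le_zero_of_os h1 i).trans ?_⟩
    linarith

/-- The higher Nakayama algebra `A^{(d)}_ℓ` of type `𝔸_n`. -/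
abbrev NakayamaA (ℓ : KupischA n) (d : ℕ) [NeZero d] : Type u := QuotAlg k (ℓ.data d)

lemma KupischA.isAdmissible (ℓ : KupischA n) {lam : Vtx (d + 1)} (h : lam ∈ ℓ.os (d + 1)) :
    IsAdmissible (ℓ.data d) (lower lam) (upper lam) := by
  obtain ⟨⟨h1, h2, h3⟩, i, hi, hlen⟩ := h
  constructor
  · intro z hz1 hz2
    have hz := mem_os_of_mem_interval hz1 hz2 h1
    have a0 : z 0 ≤ lam 0 := hz2 0
    have al : lam (lastIdx (d + 1)) ≤ z (lastIdx d) := by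
      rw [← lower_last lam]; exact hz1 _
    have hzz := le_zero_of_os hz (lastIdx d)
    refine ⟨⟨hz, by omega, by omega⟩, ⟨(z 0).toNat, by omega⟩, ?_, ?_⟩
    · change z 0 = ((z 0).toNat : ℤ)
      omega
    · have hm := ℓ.mono (i := ⟨(z 0).toNat, by omega⟩) (j := i) (by rw [Fin.le_def]; simp; omega)
      have : (((⟨(z 0).toNat, by omega⟩ : Fin n) : ℕ) : ℤ) = z 0 := by simp; omega
      rw [this] at hm
      omega
  · rintro u v ⟨hd, j', j, -, -, huv⟩ hu - hv
    rw [Prod.mk.injEq] at huv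
    obtain ⟨rfl, rfl⟩ := huv
    have a := hu (lastIdx d)
    rw [lower_last] at a
    have b := hv 0
    rw [upper_zero] at b
    have hm := ℓ.mono (i := j) (j := i) (by rw [Fin.le_def]; simp only at b; omega)
    simp only at a b
    omega

/-- The interval module `M_λ` over `A^{(d)}_ℓ`, for `λ` in `os^{(d+1)}_ℓ`. -/
def intervalA (ℓ : KupischA n) (d : ℕ) [NeZero d] (lam : ℓ.os (d + 1)) :
    ModuleCat.{u} (NakayamaA k ℓ d) :=
  ModuleCat.of _ (IntervalModule k (ℓ.isAdmissible lam.2))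

/-! ### Higher Nakayama algebras of type `𝔸̃` -/

lemma KupischTilde.mono (ℓ : KupischTilde n) {i j : ℤ} (h : i ≤ j) :
    i - ℓ.len (i : ZMod n) ≤ j - ℓ.len (j : ZMod n) := by
  induction j, h using Int.leInduction with
  | base => exact le_rfl
  | succ m hm ih =>
    have h2 := ℓ.step ((m + 1 : ℤ) : ZMod n)
    have e : ((m + 1 : ℤ) : ZMod n) - 1 = (m : ZMod n) := by push_cast; ring
    rw [e] at h2
    omega

/-- For `d ≥ 2` only the idempotents of the vertices outside `os^{(d)}_{ℓ̃}` are killed. For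
`d = 1` all vertices are kept, and the paths `i - ℓ̃_i ⇝ i` with `ℓ̃_{i-1} ≥ ℓ̃_i` are killed. -/
def KupischTilde.data (ℓ : KupischTilde n) (d : ℕ) [NeZero d] : QuotientData d n where
  verts := ℓ.os d
  rels := {q | d = 1 ∧ ∃ i : ℤ, ℓ.len (i : ZMod n) ≤ ℓ.len ((i - 1 : ℤ) : ZMod n) ∧
    q = (fun _ => i - ℓ.len (i : ZMod n), fun _ => i)}
  verts_shift m x hx := by
    obtain ⟨h1, h2⟩ := hx
    refine ⟨fun i j hij => ?_, ?_⟩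
    · have := h1 hij
      simpa [shift] using this
    · have e : ((shift n m x 0 : ℤ) : ZMod n) = ((x 0 : ℤ) : ZMod n) := by simp [shift]
      rw [e]
      simp only [shift]
      linarith
  rels_shift m u v h := by
    obtain ⟨hd, i, hi, huv⟩ := h
    rw [Prod.mk.injEq] at huv
    obtain ⟨rfl, rfl⟩ := huv
    refine ⟨hd, i + m * n, ?_, ?_⟩
    · simpa using hi
    · rw [Prod.mk.injEq]
      constructor
      · funext j
        simp only [shift]
        have : ((i + m * n : ℤ) : ZMod n) = (i : ZMod n) := by simp
        rw [this]
        ring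
      · rfl
  verts_finite := by
    refine ⟨Finset.Icc (fun _ => -(∑ i, ℓ.len i : ℕ)) (fun _ => (n : ℤ)), fun x hx =>
      ⟨-(x 0 / n), ?_⟩⟩
    obtain ⟨h1, h2⟩ := hx
    have hn : (0 : ℤ) < n := by exact_mod_cast NeZero.pos n
    have hB : ℓ.len (x 0 : ZMod n) ≤ ∑ i, ℓ.len i :=
      Finset.single_le_sum (f := ℓ.len) (fun _ _ => Nat.zero_le _) (Finset.mem_univ _)
    have hmod := Int.emod_add_mul_ediv (x 0) n
    have hlt := Int.emod_lt_of_pos (x 0) hn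
    have hge := Int.emod_nonneg (x 0) hn.ne'
    rw [Finset.mem_Icc]
    constructor
    · intro i
      have := last_le_of_os h1 i
      have hB' : (ℓ.len (x 0 : ZMod n) : ℤ) ≤ ((∑ i, ℓ.len i : ℕ) : ℤ) := by exact_mod_cast hB
      simp only [shift]
      nlinarith
    · intro i
      have := le_zero_of_os h1 i
      simp only [shift]
      nlinarith

/-- The higher Nakayama algebra `Ã^{(d)}_ℓ` of type `𝔸̃_{n-1}`. -/
abbrev NakayamaTilde (ℓ : KupischTilde n) (d : ℕ) [NeZero d] : Type u := QuotAlg k (ℓ.data d)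

lemma KupischTilde.isAdmissible (ℓ : KupischTilde n) {lam : Vtx (d + 1)}
    (h : lam ∈ ℓ.os (d + 1)) : IsAdmissible (ℓ.data d) (lower lam) (upper lam) := by
  obtain ⟨h1, hlen⟩ := h
  constructor
  · intro z hz1 hz2
    have hz := mem_os_of_mem_interval hz1 hz2 h1
    have a0 : z 0 ≤ lam 0 := hz2 0
    have al : lam (lastIdx (d + 1)) ≤ z (lastIdx d) := by
      rw [← lower_last lam]; exact hz1 _
    have hm := ℓ.mono a0
    exact ⟨hz, by omega⟩
  · rintro u v ⟨hd, j, -, huv⟩ hu - hv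
    rw [Prod.mk.injEq] at huv
    obtain ⟨rfl, rfl⟩ := huv
    have a := hu (lastIdx d)
    rw [lower_last] at a
    have b := hv 0
    rw [upper_zero] at b
    have hm := ℓ.mono b
    simp only at a b hm
    omega

/-- The image of the interval module `M_λ`, for `λ` in `os^{(d+1)}_{ℓ̃}`, as a module over
`Ã^{(d)}_ℓ`. -/
def intervalTilde (ℓ : KupischTilde n) (d : ℕ) [NeZero d] (lam : ℓ.os (d + 1)) :
    ModuleCat.{u} (NakayamaTilde k ℓ d) :=
  ModuleCat.of _ (IntervalModule k (ℓ.isAdmissible lam.2))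

/-- The indecomposable direct summands of `M` are, up to isomorphism, exactly the modules of the
family `N`. -/
def SummandsAre {Λ : Type u} [Ring Λ] {ι : Type} (M : ModuleCat.{u} Λ)
    (N : ι → ModuleCat.{u} Λ) : Prop :=
  (∀ j, Indecomposable (N j)) ∧
    ∀ X : ModuleCat.{u} Λ, Indecomposable X → (IsSummand X M ↔ ∃ j, Nonempty (X ≅ N j))

end HigherNakayama

end

/-!
Both types are treated at once through the monotone function `L j = j - ℓ_j + 1`. Let `M` be the
direct sum of one interval module from each translation orbit. The first `d` syzygies of `M_λ` are
again interval modules or zero, cut from projective interval modules; comparing intervals along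
this resolution gives `Ext^i(M, M) = 0` for `0 < i < d`.

A simple module over `Γ = End(M)^op` is the quotient of some `Hom(M, M_λ)` by the maps that factor
through `M_μ`, where `μ` is `λ` with one entry lowered. Adding one entry at a time, each step raises
the projective dimension by at most one, so `Γ` has global dimension at most `d + 1`. As `M` is a
generator and a cogenerator, Auslander's correspondence turns this bound into the
`d`-cluster-tilting property.

Finally, an idempotent endomorphism of `M_λ` is determined by its coefficient at the generator, so
`M_λ` is indecomposable, and by Fitting's lemma every indecomposable summand of `M` is some `M_λ`.
-/

open CategoryTheory

noncomputable section

namespace HigherNakayama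

universe u

open Abelian Limits

section Homological

variable {C : Type*} [Category* C]

lemma projective_of_sum_comp_eq_id [Preadditive C] {ι : Type*} [Fintype ι] {Y : C} {N : ι → C}
    {p : ∀ i, Y ⟶ N i} {q : ∀ i, N i ⟶ Y} (h : ∑ i, p i ≫ q i = 𝟙 Y)
    (hN : ∀ i, Projective (N i)) : Projective Y where
  factors {E X} f e _ := ⟨∑ i, p i ≫ Projective.factorThru (q i ≫ f) e, by
    simp only [Preadditive.sum_comp, Category.assoc, Projective.factorThru_comp]
    simp only [← Category.assoc, ← Preadditive.sum_comp, h, Category.id_comp]⟩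

variable [Abelian C]

lemma exact_iff_of_comp_mono {X Y Z W : C} {f : X ⟶ Y} {g : Y ⟶ Z} {g' : Y ⟶ W} (i : Z ⟶ W)
    [Mono i] (fac : g ≫ i = g') (w : f ≫ g = 0) (w' : f ≫ g' = 0) :
    (ShortComplex.mk f g w).Exact ↔ (ShortComplex.mk f g' w').Exact := by
  let α : ShortComplex.mk f g w ⟶ ShortComplex.mk f g' w' :=
    { τ₁ := 𝟙 X, τ₂ := 𝟙 Y, τ₃ := i }
  have : Epi α.τ₁ := inferInstanceAs (Epi (𝟙 X))
  have : IsIso α.τ₂ := inferInstanceAs (IsIso (𝟙 Y))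
  have : Mono α.τ₃ := ‹Mono i›
  exact ShortComplex.exact_iff_of_epi_of_isIso_of_mono α

lemma shortExact_kernel {X Y : C} (f : X ⟶ Y) [Epi f] :
    (ShortComplex.mk (kernel.ι f) f (kernel.condition f)).ShortExact where
  exact := ShortComplex.exact_kernel f
  epi_g := ‹Epi f›

lemma shortExact_cokernel {X Y : C} (f : X ⟶ Y) [Mono f] :
    (ShortComplex.mk f (cokernel.π f) (cokernel.condition f)).ShortExact where
  exact := ShortComplex.exact_cokernel f
  mono_f := ‹Mono f›

lemma hasProjectiveDimensionLT_of_projective {X : C} (_ : Projective X) {n : ℕ} (hn : 1 ≤ n) :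
    HasProjectiveDimensionLT X n :=
  hasProjectiveDimensionLT_of_ge X 1 n hn

lemma hasProjectiveDimensionLT_of_copresentation {S : ShortComplex C} (hS : S.Exact) [Mono S.f]
    {n : ℕ} (h₂ : HasProjectiveDimensionLT S.X₂ n) (h₃ : HasProjectiveDimensionLT S.X₃ (n + 1))
    (h : HasProjectiveDimensionLT (cokernel S.g) (n + 2)) : HasProjectiveDimensionLT S.X₁ n := by
  have w : S.f ≫ Abelian.factorThruImage S.g = 0 := by
    rw [← cancel_mono (Abelian.image.ι S.g), Category.assoc, Abelian.image.fac, zero_comp, S.zero]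
  have hX₁ : (ShortComplex.mk S.f (Abelian.factorThruImage S.g) w).ShortExact :=
    { exact := (exact_iff_of_comp_mono _ (Abelian.image.fac S.g) w S.zero).2 hS
      mono_f := ‹Mono S.f›
      epi_g := inferInstance }
  exact hX₁.hasProjectiveDimensionLT_X₁ n h₂
    ((shortExact_kernel (cokernel.π S.g)).hasProjectiveDimensionLT_X₁ (n + 1) h₃ h)

section Ext

variable [HasExt C] {X Y : C}

lemma subsingleton_ext_right_of_sum_comp_eq_id {ι : Type*} [Fintype ι] {N : ι → C}
    {p : ∀ i, Y ⟶ N i} {q : ∀ i, N i ⟶ Y} (h : ∑ i, p i ≫ q i = 𝟙 Y) {n : ℕ}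
    (hN : ∀ i, Subsingleton (Ext X (N i) n)) : Subsingleton (Ext X Y n) := by
  refine subsingleton_of_forall_eq 0 fun e => ?_
  rw [← e.comp_mk₀_id, ← h, Ext.mk₀_sum, Ext.comp_sum]
  refine Finset.sum_eq_zero fun i _ => ?_
  rw [← Ext.mk₀_comp_mk₀, ← Ext.comp_assoc_of_third_deg_zero,
    (hN i).elim (e.comp (Ext.mk₀ (p i)) (add_zero n)) 0, Ext.zero_comp]

lemma subsingleton_ext_left_of_sum_comp_eq_id {ι : Type*} [Fintype ι] {N : ι → C}
    {p : ∀ i, X ⟶ N i} {q : ∀ i, N i ⟶ X} (h : ∑ i, p i ≫ q i = 𝟙 X) {n : ℕ}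
    (hN : ∀ i, Subsingleton (Ext (N i) Y n)) : Subsingleton (Ext X Y n) := by
  refine subsingleton_of_forall_eq 0 fun e => ?_
  rw [← e.mk₀_id_comp, ← h, Ext.mk₀_sum, Ext.sum_comp]
  refine Finset.sum_eq_zero fun i _ => ?_
  rw [← Ext.mk₀_comp_mk₀, Ext.comp_assoc_of_second_deg_zero,
    (hN i).elim ((Ext.mk₀ (q i)).comp e (zero_add n)) 0, Ext.comp_zero]

variable {S : ShortComplex C} (hS : S.ShortExact) {n : ℕ}
include hS

lemma subsingleton_ext_X₃ (h₂ : Subsingleton (Ext X S.X₂ n))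
    (h₁ : Subsingleton (Ext X S.X₁ (n + 1))) : Subsingleton (Ext X S.X₃ n) := by
  refine subsingleton_of_forall_eq 0 fun x => ?_
  obtain ⟨y, rfl⟩ := Ext.covariant_sequence_exact₃ X hS x rfl (h₁.elim _ _)
  rw [h₂.elim y 0, Ext.zero_comp]

lemma subsingleton_ext_succ_of_projective (hP : Projective S.X₂)
    (h : Subsingleton (Ext S.X₁ Y n)) : Subsingleton (Ext S.X₃ Y (n + 1)) := by
  refine subsingleton_of_forall_eq 0 fun x => ?_
  obtain ⟨y, rfl⟩ := Ext.contravariant_sequence_exact₃ hS Y x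
    (Ext.eq_zero_of_hasProjectiveDimensionLT _ 1 (by omega)) (add_comm 1 n)
  rw [h.elim y 0, Ext.comp_zero]

lemma exists_comp_eq_of_subsingleton_ext_one (h : Subsingleton (Ext X S.X₁ 1)) (f : X ⟶ S.X₃) :
    ∃ f' : X ⟶ S.X₂, f' ≫ S.g = f := by
  obtain ⟨x, hx⟩ := Ext.covariant_sequence_exact₃ X hS (Ext.mk₀ f) (zero_add 1) (h.elim _ _)
  obtain ⟨f', rfl⟩ := Ext.homEquiv₀.symm.surjective x
  refine ⟨f', Ext.homEquiv₀.symm.injective ?_⟩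
  simpa [Ext.homEquiv₀] using hx

lemma subsingleton_ext_one_of_extends (hP : Projective S.X₂)
    (h : ∀ φ : S.X₁ ⟶ Y, ∃ ψ : S.X₂ ⟶ Y, S.f ≫ ψ = φ) : Subsingleton (Ext S.X₃ Y 1) := by
  refine subsingleton_of_forall_eq 0 fun x => ?_
  obtain ⟨y, rfl⟩ := Ext.contravariant_sequence_exact₃ hS Y x
    (Ext.eq_zero_of_hasProjectiveDimensionLT _ 1 le_rfl) (add_zero 1)
  obtain ⟨φ, rfl⟩ := Ext.homEquiv₀.symm.surjective y
  obtain ⟨ψ, rfl⟩ := h φ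
  change hS.extClass.comp (Ext.mk₀ (S.f ≫ ψ)) _ = 0
  rw [← Ext.mk₀_comp_mk₀, hS.extClass_comp_assoc]

end Ext

end Homological

section InAdd

variable {Λ : Type u} [Ring Λ] {M X Y : ModuleCat.{u} Λ} {ι : Type}

lemma finite_of_sum_comp_eq_id [Fintype ι] {N : ι → ModuleCat.{u} Λ} {p : ∀ i, Y ⟶ N i}
    {q : ∀ i, N i ⟶ Y} (h : ∑ i, p i ≫ q i = 𝟙 Y) (hN : ∀ i, Module.Finite Λ (N i)) :
    Module.Finite Λ Y := by
  classical
  refine Module.Finite.of_surjective (LinearMap.lsum Λ (fun i => N i) ℕ fun i => (q i).hom)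
    fun y => ⟨fun i => (p i).hom y, ?_⟩
  simpa [LinearMap.lsum_apply, ModuleCat.hom_sum] using congrArg (fun f => f.hom y) h

/-- The product of a family of modules, as an object of `ModuleCat`. -/
abbrev piObj (N : ι → ModuleCat.{u} Λ) : ModuleCat.{u} Λ := ModuleCat.of Λ (∀ i, N i)

/-- The projection of a product of modules onto a factor, as a morphism of `ModuleCat`. -/
abbrev piProj (N : ι → ModuleCat.{u} Λ) (i : ι) : piObj N ⟶ N i :=
  ModuleCat.ofHom (LinearMap.proj i)

open Classical in
/-- The inclusion of a factor into a product of modules, as a morphism of `ModuleCat`. -/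
abbrev piSingle (N : ι → ModuleCat.{u} Λ) (i : ι) : N i ⟶ piObj N :=
  ModuleCat.ofHom (LinearMap.single Λ (fun i => N i) i)

lemma sum_piProj_comp_piSingle [Fintype ι] (N : ι → ModuleCat.{u} Λ) :
    ∑ i, piProj N i ≫ piSingle N i = 𝟙 (piObj N) := by
  classical
  refine ModuleCat.hom_ext (LinearMap.ext fun x => ?_)
  simp only [ModuleCat.hom_sum, LinearMap.sum_apply, ModuleCat.hom_comp, ModuleCat.hom_ofHom,
    LinearMap.comp_apply, LinearMap.proj_apply, ModuleCat.hom_id, LinearMap.id_apply,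
    LinearMap.coe_single]
  convert Finset.univ_sum_single x

lemma piSingle_comp_piProj_self (N : ι → ModuleCat.{u} Λ) (i : ι) :
    piSingle N i ≫ piProj N i = 𝟙 (N i) := by
  classical
  exact ModuleCat.hom_ext (LinearMap.ext fun x => Pi.single_eq_same (M := fun i => N i) i x)

lemma inAdd_of_sum_comp_eq_id [Fintype ι] {p : ι → (Y ⟶ M)} {q : ι → (M ⟶ Y)}
    (h : ∑ i, p i ≫ q i = 𝟙 Y) : InAdd M Y := by
  -- an extra zero summand, as `InAdd` asks for a positive number of copies of `M`
  let p' : Option ι → (Y ⟶ M) := fun i => i.elim 0 p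
  let q' : Option ι → (M ⟶ Y) := fun i => i.elim 0 q
  let e := Fintype.equivFin (Option ι)
  refine ⟨Fintype.card (Option ι), Fintype.card_pos,
    ⟨⟨ModuleCat.ofHom (LinearMap.pi fun j => (p' (e.symm j)).hom),
      ∑ j, piProj (fun _ => M) j ≫ q' (e.symm j), ?_⟩⟩⟩
  calc _ = ∑ j, p' (e.symm j) ≫ q' (e.symm j) := Preadditive.comp_sum ..
    _ = ∑ i, p' i ≫ q' i := e.symm.sum_comp fun i => p' i ≫ q' i
    _ = 𝟙 Y := by rw [Fintype.sum_option, ← h]; simp [p', q']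

namespace InAdd

lemma exists_sum_comp_eq_id (h : InAdd M Y) :
    ∃ (r : ℕ) (p : Fin r → (Y ⟶ M)) (q : Fin r → (M ⟶ Y)), ∑ i, p i ≫ q i = 𝟙 Y := by
  obtain ⟨r, -, ⟨R⟩⟩ := h
  refine ⟨r, fun i => R.i ≫ piProj (fun _ => M) i, fun i => piSingle (fun _ => M) i ≫ R.r, ?_⟩
  calc _ = R.i ≫ (∑ i, piProj (fun _ => M) i ≫ piSingle (fun _ => M) i) ≫ R.r := by
        simp only [Preadditive.sum_comp, Preadditive.comp_sum, Category.assoc]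
    _ = 𝟙 Y := by rw [sum_piProj_comp_piSingle, Category.id_comp, R.retract]

lemma of_sum_comp_eq_id [Fintype ι] {N : ι → ModuleCat.{u} Λ} {p : ∀ i, Y ⟶ N i}
    {q : ∀ i, N i ⟶ Y} (h : ∑ i, p i ≫ q i = 𝟙 Y) (hN : ∀ i, InAdd M (N i)) : InAdd M Y := by
  choose r a b hab using fun i => (hN i).exists_sum_comp_eq_id
  refine inAdd_of_sum_comp_eq_id (ι := Σ i, Fin (r i)) (p := fun x => p x.1 ≫ a x.1 x.2)
    (q := fun x => b x.1 x.2 ≫ q x.1) ?_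
  calc _ = ∑ i, p i ≫ (∑ j, a i j ≫ b i j) ≫ q i := by
        simp only [Fintype.sum_sigma, Preadditive.sum_comp, Preadditive.comp_sum, Category.assoc]
    _ = 𝟙 Y := by simp only [hab, Category.id_comp, h]

lemma refl (M : ModuleCat.{u} Λ) : InAdd M M :=
  inAdd_of_sum_comp_eq_id (ι := Unit) (p := fun _ => 𝟙 M) (q := fun _ => 𝟙 M) (by simp)

lemma of_retract (h : InAdd M Y) (R : Retract X Y) : InAdd M X :=
  of_sum_comp_eq_id (ι := Unit) (p := fun _ => R.i) (q := fun _ => R.r) (by simp) fun _ => h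

lemma pi [Finite ι] {N : ι → ModuleCat.{u} Λ} (hN : ∀ i, InAdd M (N i)) :
    InAdd M (piObj N) :=
  have := Fintype.ofFinite ι
  of_sum_comp_eq_id (sum_piProj_comp_piSingle N) hN

lemma finite (h : InAdd M Y) [Module.Finite Λ M] : Module.Finite Λ Y :=
  have ⟨_, _, _, hpq⟩ := h.exists_sum_comp_eq_id
  finite_of_sum_comp_eq_id hpq fun _ => ‹_›

lemma subsingleton_ext_right (h : InAdd M Y) {n : ℕ} (hM : Subsingleton (Ext X M n)) :
    Subsingleton (Ext X Y n) :=
  have ⟨_, _, _, hpq⟩ := h.exists_sum_comp_eq_id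
  subsingleton_ext_right_of_sum_comp_eq_id hpq fun _ => hM

lemma subsingleton_ext_left (h : InAdd M Y) {n : ℕ} (hM : Subsingleton (Ext M X n)) :
    Subsingleton (Ext Y X n) :=
  have ⟨_, _, _, hpq⟩ := h.exists_sum_comp_eq_id
  subsingleton_ext_left_of_sum_comp_eq_id hpq fun _ => hM

end InAdd

end InAdd

section HomFunctor

variable {Λ : Type u} [Ring Λ] {M X Y : ModuleCat.{u} Λ}

/-- The functor `Hom(M, -)` with values in the modules over `(End M)ᵐᵒᵖ`; the scalar `op f` acts
on a morphism `g : M ⟶ X` as `f ≫ g`. -/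
abbrev homFunctor (M : ModuleCat.{u} Λ) : ModuleCat.{u} Λ ⥤ ModuleCat.{u} (End M)ᵐᵒᵖ :=
  preadditiveCoyonedaObj M

lemma epi_map_homFunctor_iff (g : X ⟶ Y) :
    Epi ((homFunctor M).map g) ↔ ∀ f : M ⟶ Y, ∃ f' : M ⟶ X, f' ≫ g = f :=
  ModuleCat.epi_iff_surjective _

lemma mono_map_homFunctor (f : X ⟶ Y) [Mono f] : Mono ((homFunctor M).map f) :=
  (ModuleCat.mono_iff_injective _).2 fun (_ _ : M ⟶ X) h => (cancel_mono f).1 h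

lemma exact_map_homFunctor {S : ShortComplex (ModuleCat.{u} Λ)} (hS : S.Exact) [Mono S.f] :
    (S.map (homFunctor M)).Exact :=
  (ShortComplex.moduleCat_exact_iff _).2 fun (g : M ⟶ S.X₂) (hg : g ≫ S.g = 0) =>
    ⟨hS.lift g hg, hS.lift_f g hg⟩

lemma shortExact_map_homFunctor {S : ShortComplex (ModuleCat.{u} Λ)} (hS : S.ShortExact)
    (h : Epi ((homFunctor M).map S.g)) : (S.map (homFunctor M)).ShortExact :=
  have := hS.mono_f
  { exact := exact_map_homFunctor hS.exact
    mono_f := mono_map_homFunctor S.f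
    epi_g := h }

lemma sum_map_homFunctor_comp_map {ι : Type*} [Fintype ι] {p : ι → (Y ⟶ M)} {q : ι → (M ⟶ Y)}
    (hpq : ∑ i, p i ≫ q i = 𝟙 Y) :
    ∑ i, (homFunctor M).map (p i) ≫ (homFunctor M).map (q i) = 𝟙 ((homFunctor M).obj Y) := by
  simp only [← Functor.map_comp, ← Functor.map_sum, hpq, CategoryTheory.Functor.map_id]

lemma InAdd.projective_homFunctor (h : InAdd M Y) : Projective ((homFunctor M).obj Y) := by
  obtain ⟨r, p, q, hpq⟩ := h.exists_sum_comp_eq_id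
  have : Module.Projective (End M)ᵐᵒᵖ ((homFunctor M).obj M) :=
    Module.Projective.of_equiv (Preadditive.homSelfLinearEquivEndMulOpposite M).symm
  exact projective_of_sum_comp_eq_id (sum_map_homFunctor_comp_map hpq)
    fun _ => (IsProjective.iff_projective _).1 this

lemma InAdd.finite_homFunctor (h : InAdd M Y) :
    Module.Finite (End M)ᵐᵒᵖ ((homFunctor M).obj Y) := by
  obtain ⟨r, p, q, hpq⟩ := h.exists_sum_comp_eq_id
  have : Module.Finite (End M)ᵐᵒᵖ ((homFunctor M).obj M) :=
    Module.Finite.equiv (Preadditive.homSelfLinearEquivEndMulOpposite M).symm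
  exact finite_of_sum_comp_eq_id (sum_map_homFunctor_comp_map hpq) fun _ => this

lemma exists_approximation (h : Module.Finite (End M)ᵐᵒᵖ ((homFunctor M).obj X)) :
    ∃ (r : ℕ) (π : ModuleCat.of Λ (Fin r → M) ⟶ X), Epi ((homFunctor M).map π) := by
  obtain ⟨r, c, hc⟩ := Module.Finite.exists_fin (R := (End M)ᵐᵒᵖ) (M := (homFunctor M).obj X)
  refine ⟨r, ∑ j, piProj (fun _ => M) j ≫ c j, (epi_map_homFunctor_iff _).2 fun f => ?_⟩
  let x : (homFunctor M).obj X := f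
  have hx : x ∈ Submodule.span (End M)ᵐᵒᵖ (Set.range c) := hc ▸ Submodule.mem_top
  obtain ⟨a, ha⟩ := (Submodule.mem_span_range_iff_exists_fun _).1 hx
  exact ⟨ModuleCat.ofHom (LinearMap.pi fun j => (show M ⟶ M from (a j).unop).hom),
    (Preadditive.comp_sum ..).trans ha⟩

lemma epi_of_epi_map_homFunctor (hsep : IsSeparator M) {f : X ⟶ Y}
    (hf : Epi ((homFunctor M).map f)) : Epi f :=
  have := (isSeparator_iff_faithful_preadditiveCoyonedaObj M).1 hsep
  (homFunctor M).epi_of_epi_map hf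

lemma inAdd_of_projective_homFunctor (hsep : IsSeparator M)
    (hfin : Module.Finite (End M)ᵐᵒᵖ ((homFunctor M).obj X))
    (hproj : Projective ((homFunctor M).obj X)) : InAdd M X := by
  have := IsGrothendieckAbelian.GabrielPopescu.full M hsep
  have := (isSeparator_iff_faithful_preadditiveCoyonedaObj M).1 hsep
  obtain ⟨r, π, hπ⟩ := exists_approximation hfin
  obtain ⟨σ, hσ⟩ := (homFunctor M).map_surjective
    (Projective.factorThru (𝟙 ((homFunctor M).obj X)) ((homFunctor M).map π))
  have retract : σ ≫ π = 𝟙 X := (homFunctor M).map_injective <| by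
    rw [Functor.map_comp, hσ, Projective.factorThru_comp, CategoryTheory.Functor.map_id]
  exact (InAdd.pi fun _ => InAdd.refl M).of_retract ⟨σ, π, retract⟩

end HomFunctor

section Criterion

variable {Λ : Type u} [Ring Λ] {M : ModuleCat.{u} Λ}

lemma finite_cokernel {X Y : ModuleCat.{u} Λ} (f : X ⟶ Y) [Module.Finite Λ Y] :
    Module.Finite Λ (cokernel f : ModuleCat.{u} Λ) :=
  Module.Finite.of_surjective (cokernel.π f).hom
    ((ModuleCat.epi_iff_surjective _).1 inferInstance)

lemma finite_of_mono [IsNoetherianRing Λ] {X Y : ModuleCat.{u} Λ} (f : X ⟶ Y) [Mono f]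
    (_ : Module.Finite Λ Y) : Module.Finite Λ X :=
  Module.Finite.of_injective f.hom ((ModuleCat.mono_iff_injective f).1 ‹_›)

/-- Every finitely generated module is a submodule of a module in `add M`. -/
def Cogenerates (M : ModuleCat.{u} Λ) : Prop :=
  ∀ X : ModuleCat.{u} Λ, Module.Finite Λ X → ∃ (I : ModuleCat.{u} Λ) (f : X ⟶ I),
    InAdd M I ∧ Mono f

section Cogenerates

variable (hcog : Cogenerates M)
include hcog

lemma finite_homFunctor [IsNoetherianRing (End M)ᵐᵒᵖ] {X : ModuleCat.{u} Λ}
    (hX : Module.Finite Λ X) : Module.Finite (End M)ᵐᵒᵖ ((homFunctor M).obj X) := by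
  obtain ⟨I, f, hI, _⟩ := hcog X hX
  have := mono_map_homFunctor (M := M) f
  exact finite_of_mono ((homFunctor M).map f) hI.finite_homFunctor

lemma inAdd_of_hasProjectiveDimensionLT_one [IsNoetherianRing (End M)ᵐᵒᵖ] (hsep : IsSeparator M)
    {X : ModuleCat.{u} Λ} (hX : Module.Finite Λ X)
    (h : HasProjectiveDimensionLT ((homFunctor M).obj X) 1) : InAdd M X :=
  inAdd_of_projective_homFunctor hsep (finite_homFunctor hcog hX)
    (projective_iff_hasProjectiveDimensionLT_one.2 h)

variable [Module.Finite Λ M] {d : ℕ}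

section EndGlobalDimension

variable (hpd : ∀ N : ModuleCat.{u} (End M)ᵐᵒᵖ, Module.Finite (End M)ᵐᵒᵖ N →
  HasProjectiveDimensionLT N (d + 2))
include hpd

lemma hasProjectiveDimensionLT_homFunctor (hd : 0 < d) {X : ModuleCat.{u} Λ}
    (hX : Module.Finite Λ X) : HasProjectiveDimensionLT ((homFunctor M).obj X) d := by
  obtain ⟨I, f, hI, _⟩ := hcog X hX
  have := hI.finite
  obtain ⟨J, g, hJ, _⟩ := hcog (cokernel f) (finite_cokernel f)
  let S := ShortComplex.mk f (cokernel.π f ≫ g) (by rw [cokernel.condition_assoc, zero_comp])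
  have hS : S.Exact := (exact_iff_of_comp_mono g rfl _ S.zero).1 (shortExact_cokernel f).exact
  have : Mono (S.map (homFunctor M)).f := mono_map_homFunctor f
  have : Module.Finite (End M)ᵐᵒᵖ (S.map (homFunctor M)).X₃ := hJ.finite_homFunctor
  exact hasProjectiveDimensionLT_of_copresentation (exact_map_homFunctor hS)
    (hasProjectiveDimensionLT_of_projective hI.projective_homFunctor hd)
    (hasProjectiveDimensionLT_of_projective hJ.projective_homFunctor (by omega))
    (hpd _ (finite_cokernel _))

lemma hasProjectiveDimensionLT_homFunctor_of_subsingleton_ext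
    (hrig : ∀ i, 1 ≤ i → i < d → Subsingleton (Ext M M i)) {t : ℕ} (ht : t < d)
    {Y : ModuleCat.{u} Λ} (hY : Module.Finite Λ Y)
    (hext : ∀ i, 1 ≤ i → i ≤ t → Subsingleton (Ext M Y i)) :
    HasProjectiveDimensionLT ((homFunctor M).obj Y) (d - t) := by
  induction t generalizing Y with
  | zero => exact hasProjectiveDimensionLT_homFunctor hcog hpd ht hY
  | succ t ih =>
    obtain ⟨I, f, hI, _⟩ := hcog Y hY
    have := hI.finite
    have hS := shortExact_cokernel f
    have hC : HasProjectiveDimensionLT ((homFunctor M).obj (cokernel f)) (d - (t + 1) + 1) := by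
      rw [show d - (t + 1) + 1 = d - t by omega]
      exact ih (by omega) (finite_cokernel f) fun i h₁ h₂ => subsingleton_ext_X₃ hS
        (hI.subsingleton_ext_right (hrig i h₁ (by omega))) (hext (i + 1) (by omega) (by omega))
    have hFS := shortExact_map_homFunctor (M := M) hS ((epi_map_homFunctor_iff _).2
      (exists_comp_eq_of_subsingleton_ext_one hS (hext 1 le_rfl (by omega))))
    exact hFS.hasProjectiveDimensionLT_X₁ _
      (hasProjectiveDimensionLT_of_projective hI.projective_homFunctor (by omega)) hC

end EndGlobalDimension

variable [IsNoetherianRing (End M)ᵐᵒᵖ] [IsNoetherianRing Λ] (hsep : IsSeparator M)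
include hsep

lemma exists_shortExact_approximation {X : ModuleCat.{u} Λ} (hX : Module.Finite Λ X) :
    ∃ S : ShortComplex (ModuleCat.{u} Λ), S.ShortExact ∧ S.X₃ = X ∧ InAdd M S.X₂ ∧
      Module.Finite Λ S.X₁ ∧ Epi ((homFunctor M).map S.g) := by
  obtain ⟨r, π, hπ⟩ := exists_approximation (finite_homFunctor hcog hX)
  have := epi_of_epi_map_homFunctor hsep hπ
  have hMr : InAdd M (ModuleCat.of Λ (Fin r → M)) := .pi fun _ => .refl M
  exact ⟨_, shortExact_kernel π, rfl, hMr, finite_of_mono (kernel.ι π) hMr.finite, hπ⟩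

lemma subsingleton_ext_of_hasProjectiveDimensionLT_homFunctor {X : ModuleCat.{u} Λ} {n s : ℕ}
    (hX : ∀ i, s ≤ i → i ≤ s + n → Subsingleton (Ext X M i)) {K : ModuleCat.{u} Λ}
    (hK : Module.Finite Λ K) (hpd : HasProjectiveDimensionLT ((homFunctor M).obj K) (n + 1)) :
    Subsingleton (Ext X K s) := by
  induction n generalizing s K with
  | zero =>
    exact (inAdd_of_hasProjectiveDimensionLT_one hcog hsep hK hpd).subsingleton_ext_right
      (hX s le_rfl le_rfl)
  | succ n ih =>
    obtain ⟨S, hS, rfl, h₂, h₁, hepi⟩ := exists_shortExact_approximation hcog hsep hK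
    have hpd₁ := (shortExact_map_homFunctor hS hepi).hasProjectiveDimensionLT_X₁ (n + 1)
      (hasProjectiveDimensionLT_of_projective h₂.projective_homFunctor (by omega)) hpd
    exact subsingleton_ext_X₃ hS (h₂.subsingleton_ext_right (hX s le_rfl (by omega)))
      (ih (fun i _ _ => hX i (by omega) (by omega)) h₁ hpd₁)

lemma inAdd_of_subsingleton_ext {X : ModuleCat.{u} Λ} (hX : Module.Finite Λ X)
    (hpd : HasProjectiveDimensionLT ((homFunctor M).obj X) d) (hd : 0 < d)
    (hext : ∀ i, 1 ≤ i → i < d → Subsingleton (Ext X M i)) : InAdd M X := by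
  obtain rfl | ⟨e, rfl⟩ : d = 1 ∨ ∃ e, d = e + 2 :=
    (Nat.lt_or_ge 1 d).symm.imp (by omega) Nat.exists_eq_add_of_le'
  · exact inAdd_of_hasProjectiveDimensionLT_one hcog hsep hX hpd
  · obtain ⟨S, hS, rfl, h₂, h₁, hepi⟩ := exists_shortExact_approximation hcog hsep hX
    have hpd₁ := (shortExact_map_homFunctor hS hepi).hasProjectiveDimensionLT_X₁ (e + 1)
      (hasProjectiveDimensionLT_of_projective h₂.projective_homFunctor (by omega)) hpd
    obtain ⟨σ, hσ⟩ := exists_comp_eq_of_subsingleton_ext_one hS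
      (subsingleton_ext_of_hasProjectiveDimensionLT_homFunctor hcog hsep
        (fun i _ _ => hext i (by omega) (by omega)) h₁ hpd₁) (𝟙 S.X₃)
    exact h₂.of_retract ⟨σ, S.g, hσ⟩

end Cogenerates

theorem isClusterTilting_of_projectiveDimension [Module.Finite Λ M] [IsNoetherianRing (End M)ᵐᵒᵖ]
    [IsNoetherianRing Λ] {d : ℕ} (hd : 0 < d) (hsep : IsSeparator M) (hcog : Cogenerates M)
    (hrig : ∀ i, 1 ≤ i → i < d → Subsingleton (Ext M M i))
    (hpd : ∀ N : ModuleCat.{u} (End M)ᵐᵒᵖ, Module.Finite (End M)ᵐᵒᵖ N →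
      HasProjectiveDimensionLT N (d + 2)) : IsClusterTilting d M := by
  refine ⟨inferInstance,
    fun X hX => ⟨fun h i h₁ h₂ => h.subsingleton_ext_left (hrig i h₁ h₂), fun h => ?_⟩,
    fun Y hY => ⟨fun h i h₁ h₂ => h.subsingleton_ext_right (hrig i h₁ h₂), fun h => ?_⟩⟩
  · exact inAdd_of_subsingleton_ext hcog hsep hX
      (hasProjectiveDimensionLT_homFunctor hcog hpd hd hX) hd h
  · have hpdY := hasProjectiveDimensionLT_homFunctor_of_subsingleton_ext hcog hpd hrig
      (Nat.sub_one_lt_of_lt hd) hY fun i h₁ _ => h i h₁ (by omega)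
    rw [Nat.sub_sub_self hd] at hpdY
    exact inAdd_of_hasProjectiveDimensionLT_one hcog hsep hY hpdY

end Criterion

section Arrows

variable {d p : ℕ}

/-- The vertices `x` and `u` are the same object of the orbit category `A^{(d)} / φ_d ^ p`. -/
def SameOrbit (p : ℕ) (x u : Vtx d) : Prop := ∃ m, x = shift p m u

lemma SameOrbit.refl (x : Vtx d) : SameOrbit p x x := ⟨0, (shift_zero p x).symm⟩

lemma SameOrbit.symm {x u : Vtx d} (h : SameOrbit p x u) : SameOrbit p u x := by
  obtain ⟨m, rfl⟩ := h
  exact ⟨-m, by simp [shift_shift, shift_zero]⟩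

lemma SameOrbit.trans {x u v : Vtx d} (h : SameOrbit p x u) (h' : SameOrbit p u v) :
    SameOrbit p x v := by
  obtain ⟨m, rfl⟩ := h
  obtain ⟨m', rfl⟩ := h'
  exact ⟨m + m', shift_shift _ _ _ _⟩

lemma shift_eq_add (m : ℤ) (u v : Vtx d) : shift p m v = shift p m u + (v - u) := by
  funext i; simp only [shift, Pi.add_apply, Pi.sub_apply]; ring

lemma SameOrbit.add {x u : Vtx d} (h : SameOrbit p x u) (v : Vtx d) :
    SameOrbit p (x + v) (u + v) := by
  obtain ⟨m, rfl⟩ := h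
  exact ⟨m, by funext i; simp only [shift, Pi.add_apply]; ring⟩

lemma SameOrbit.add_iff {x u : Vtx d} (v : Vtx d) :
    SameOrbit p (x + v) (u + v) ↔ SameOrbit p x u :=
  ⟨fun h => by simpa using h.add (-v), fun h => h.add v⟩

variable (k : Type u) [Field k]

open Classical in
lemma arrow_apply_add (u v x y : Vtx d) :
    (arrow k p u v).1 x y = if u ≤ v ∧ SameOrbit p x u ∧ y = x + (v - u) then 1 else 0 := by
  rw [arrow_apply]
  congr 1
  refine propext (and_congr_right fun _ => ⟨?_, ?_⟩)
  · rintro ⟨m, rfl, rfl⟩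
    exact ⟨⟨m, rfl⟩, shift_eq_add _ _ _⟩
  · rintro ⟨⟨m, rfl⟩, rfl⟩
    exact ⟨m, rfl, (shift_eq_add _ _ _).symm⟩

open Classical in
lemma arrow_mul_apply {u v : Vtx d} (huv : u ≤ v) (a : orbitAlg k d p) (x y : Vtx d) :
    (arrow k p u v * a).1 x y = if SameOrbit p x u then a.1 (x + (v - u)) y else 0 := by
  change ((arrow k p u v).1 * a.1) x y = _
  rw [IncidenceAlgebra.mul_apply]
  simp only [arrow_apply_add]
  have hle : x ≤ x + (v - u) := by simpa using huv
  by_cases hx : SameOrbit p x u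
  · by_cases hy : x + (v - u) ≤ y
    · rw [Finset.sum_eq_single (x + (v - u))]
      · simp [huv, hx]
      · intro z _ hz; simp [hz]
      · intro h; exact (h (Finset.mem_Icc.2 ⟨hle, hy⟩)).elim
    · rw [IncidenceAlgebra.apply_eq_zero_of_not_le hy, ite_self]
      refine Finset.sum_eq_zero fun z hz => ?_
      rw [if_neg, zero_mul]
      rintro ⟨-, -, rfl⟩
      exact hy (Finset.mem_Icc.1 hz).2
  · simp [hx]

lemma arrow_mul_arrow {u v w : Vtx d} (huv : u ≤ v) (hvw : v ≤ w) :
    arrow k p u v * arrow k p v w = arrow k p u w := by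
  classical
  refine orbit_ext k fun x y => ?_
  rw [arrow_mul_apply k huv, arrow_apply_add, arrow_apply_add]
  have e : SameOrbit p (x + (v - u)) v ↔ SameOrbit p x u := by
    rw [← SameOrbit.add_iff (v - u) (x := x)]; simp
  have e' : x + (v - u) + (w - v) = x + (w - u) := by abel
  simp only [e, e', hvw, huv.trans hvw, true_and]
  by_cases hx : SameOrbit p x u <;> simp [hx]

lemma arrow_mul_arrow_eq_zero {u v w z : Vtx d} (huv : u ≤ v) (h : ¬ SameOrbit p v w) :
    arrow k p u v * arrow k p w z = 0 := by
  classical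
  refine orbit_ext k fun x y => ?_
  rw [arrow_mul_apply k huv, arrow_apply_add]
  by_cases hx : SameOrbit p x u
  · rw [if_pos hx, if_neg]
    · rfl
    rintro ⟨-, hw, -⟩
    have : SameOrbit p (x + (v - u)) v := by simpa using hx.add (v - u)
    exact h (this.symm.trans hw)
  · rw [if_neg hx]; rfl

lemma arrow_shift (m : ℤ) (u v : Vtx d) :
    arrow k p (shift p m u) (shift p m v) = arrow k p u v := by
  classical
  refine orbit_ext k fun x y => ?_
  rw [arrow_apply_add, arrow_apply_add, shift_le_shift]
  have e : SameOrbit p x (shift p m u) ↔ SameOrbit p x u :=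
    ⟨fun h => h.trans ⟨m, rfl⟩, fun h => h.trans (SameOrbit.symm ⟨m, rfl⟩)⟩
  have e' : shift p m v - shift p m u = v - u := by rw [shift_eq_add m u v]; abel
  rw [e, e']

lemma arrow_eq_of_sameOrbit {v w : Vtx d} (h : SameOrbit p v w) (u : Vtx d) :
    arrow k p u v = arrow k p (w - (v - u)) w := by
  obtain ⟨m, rfl⟩ := h
  rw [← arrow_shift k m _ w]
  congr 1
  funext i
  simp only [shift, Pi.sub_apply]
  ring

lemma sub_smul_arrow_apply_ne_zero {a : orbitAlg k d p} {u v x y : Vtx d}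
    (h : (a - a.1 u v • arrow k p u v).1 x y ≠ 0) :
    a.1 x y ≠ 0 ∧ ¬ ∃ m, x = shift p m u ∧ y = shift p m v := by
  change a.1 x y - a.1 u v * (arrow k p u v).1 x y ≠ 0 at h
  rw [arrow_apply] at h
  by_cases hxy : ∃ m, x = shift p m u ∧ y = shift p m v
  · by_cases huv : u ≤ v
    · rw [if_pos ⟨huv, hxy⟩] at h
      obtain ⟨m, rfl, rfl⟩ := hxy
      simp [a.2.1] at h
    · obtain ⟨m, rfl, rfl⟩ := hxy
      simp [a.2.1, IncidenceAlgebra.apply_eq_zero_of_not_le huv] at h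
  · rw [if_neg fun h' => hxy h'.2, mul_zero, sub_zero] at h
    exact ⟨h, hxy⟩

lemma mem_span_arrow_of_support_subset {T : Finset (Vtx d × Vtx d)} {a : orbitAlg k d p}
    (ha : ∀ x y, a.1 x y ≠ 0 → ∃ m, (shift p m x, shift p m y) ∈ T) :
    a ∈ Submodule.span k (Set.range fun t : Vtx d × Vtx d => arrow k p t.1 t.2) := by
  classical
  induction T using Finset.induction_on generalizing a with
  | empty =>
    have : a = 0 := orbit_ext k fun x y => by simpa using ha x y
    exact this ▸ Submodule.zero_mem _
  | insert t T _ ih =>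
    have e : a - a.1 t.1 t.2 • arrow k p t.1 t.2 + a.1 t.1 t.2 • arrow k p t.1 t.2 = a :=
      orbit_ext k fun x y => sub_add_cancel (a.1 x y) _
    rw [← e]
    refine Submodule.add_mem _ (ih fun x y hxy => ?_)
      (Submodule.smul_mem _ _ (Submodule.subset_span ⟨t, rfl⟩))
    obtain ⟨hne, horbit⟩ := sub_smul_arrow_apply_ne_zero k hxy
    obtain ⟨m, hm⟩ := ha x y hne
    refine ⟨m, (Finset.mem_insert.1 hm).resolve_left fun ht => horbit ⟨-m, ?_⟩⟩
    simp [← ht, shift_shift, shift_zero]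

lemma span_arrow_eq_top :
    Submodule.span k (Set.range fun t : Vtx d × Vtx d => arrow k p t.1 t.2) = ⊤ := by
  refine eq_top_iff.2 fun a _ => ?_
  obtain ⟨F, hF⟩ := a.2.2
  refine mem_span_arrow_of_support_subset k (T := F ×ˢ F) fun x y h => ?_
  obtain ⟨m, hx, hy⟩ := hF x y h
  exact ⟨m, Finset.mk_mem_product hx hy⟩

lemma arrow_eq_zero {u v : Vtx d} (huv : ¬ u ≤ v) : arrow k p u v = 0 := by
  classical
  refine orbit_ext k fun x y => ?_
  rw [arrow_apply, if_neg fun h => huv h.1]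
  rfl

variable (D : QuotientData d p)

/-- The class of the morphism `f_{vu}` in the quotient algebra; its source is the left index `u`. -/
def quotArrow (u v : Vtx d) : QuotAlg k D := QuotAlg.mk k D (arrow k p u v)

variable {k D}

lemma quotArrow_mul_quotArrow {u v w : Vtx d} (huv : u ≤ v) (hvw : v ≤ w) :
    quotArrow k D u v * quotArrow k D v w = quotArrow k D u w := by
  rw [quotArrow, quotArrow, ← QuotAlg.mk_mul, arrow_mul_arrow k huv hvw, quotArrow]

lemma quotArrow_mul_quotArrow_eq_zero {u v w z : Vtx d} (huv : u ≤ v) (h : ¬ SameOrbit p v w) :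
    quotArrow k D u v * quotArrow k D w z = 0 := by
  rw [quotArrow, quotArrow, ← QuotAlg.mk_mul, arrow_mul_arrow_eq_zero k huv h]; rfl

lemma quotArrow_shift (m : ℤ) (u v : Vtx d) :
    quotArrow k D (shift p m u) (shift p m v) = quotArrow k D u v := by
  rw [quotArrow, arrow_shift, quotArrow]

lemma quotArrow_mul_quotArrow_of_sameOrbit {u v w z : Vtx d} (huv : u ≤ v) (hwz : w ≤ z)
    (h : SameOrbit p v w) :
    quotArrow k D u v * quotArrow k D w z = quotArrow k D (w - (v - u)) z := by
  rw [quotArrow, arrow_eq_of_sameOrbit k h u]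
  exact quotArrow_mul_quotArrow (by simpa using huv) hwz

lemma quotArrow_eq_zero_of_mem_relIdeal {u v : Vtx d} (h : arrow k p u v ∈ relIdeal k D) :
    quotArrow k D u v = 0 := by
  refine (QuotAlg.mk_eq k D).2 ?_
  convert h using 1
  exact orbit_ext k fun x y => sub_zero ((arrow k p u v).1 x y)

lemma quotArrow_eq_zero_of_notMem_left {u v : Vtx d} (huv : u ≤ v) (hu : u ∉ D.verts) :
    quotArrow k D u v = 0 := by
  rw [← quotArrow_mul_quotArrow le_rfl huv,
    quotArrow_eq_zero_of_mem_relIdeal (TwoSidedIdeal.subset_span (Or.inl ⟨u, hu, rfl⟩)), zero_mul]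

lemma quotArrow_eq_zero_of_notMem_right {u v : Vtx d} (huv : u ≤ v) (hv : v ∉ D.verts) :
    quotArrow k D u v = 0 := by
  rw [← quotArrow_mul_quotArrow huv le_rfl, quotArrow_eq_zero_of_notMem_left le_rfl hv, mul_zero]

lemma quotArrow_eq_zero_of_between {u v z : Vtx d} (huz : u ≤ z) (hzv : z ≤ v) (hz : z ∉ D.verts) :
    quotArrow k D u v = 0 := by
  rw [← quotArrow_mul_quotArrow huz hzv, quotArrow_eq_zero_of_notMem_right huz hz, zero_mul]

lemma quotArrow_eq_zero_of_rels {u v : Vtx d} (h : (u, v) ∈ D.rels) :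
    quotArrow k D u v = 0 :=
  quotArrow_eq_zero_of_mem_relIdeal (TwoSidedIdeal.subset_span (Or.inr ⟨u, v, h, rfl⟩))

lemma algebraMap_mul_mk (c : k) (a : orbitAlg k d p) :
    algebraMap k (QuotAlg k D) c * QuotAlg.mk k D a = QuotAlg.mk k D (c • a) := by
  change QuotAlg.mk k D (c • unitElt k D) * QuotAlg.mk k D a = _
  rw [← QuotAlg.mk_mul, orbit_smul_mul, ← orbit_mul_smul, QuotAlg.mk_mul, ← QuotAlg.one_def,
    one_mul]

lemma quotAlg_induction {P : QuotAlg k D → Prop} (zero : P 0)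
    (add : ∀ a b, P a → P b → P (a + b))
    (arrow : ∀ (c : k) (u v : Vtx d), u ≤ v → P (algebraMap k _ c * quotArrow k D u v))
    (a : QuotAlg k D) : P a := by
  obtain ⟨a, rfl⟩ := QuotAlg.mk_surjective k D a
  induction (span_arrow_eq_top k).ge (Submodule.mem_top (x := a)) using
    Submodule.closure_induction with
  | zero => exact zero
  | add a b _ _ ha hb => exact add _ _ ha hb
  | smul_mem c a ha =>
    obtain ⟨⟨u, v⟩, rfl⟩ := ha
    by_cases huv : u ≤ v
    · have := arrow c u v huv
      rwa [quotArrow, algebraMap_mul_mk] at this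
    · change P (QuotAlg.mk k D (c • HigherNakayama.arrow k p u v))
      rw [arrow_eq_zero k huv, smul_zero]
      exact zero

/-- The linear map given by an additive map that commutes with the scalars of `k` and with the
arrows, which together generate the quotient algebra. -/
def linearMapOfArrows {X Y : Type*} [AddCommGroup X] [AddCommGroup Y] [Module (QuotAlg k D) X]
    [Module (QuotAlg k D) Y] (f : X →+ Y)
    (hk : ∀ (c : k) x, f (algebraMap k (QuotAlg k D) c • x) = algebraMap k (QuotAlg k D) c • f x)
    (ha : ∀ (u v : Vtx d) (_ : u ≤ v) x, f (quotArrow k D u v • x) = quotArrow k D u v • f x) :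
    X →ₗ[QuotAlg k D] Y where
  toFun := f
  map_add' := f.map_add
  map_smul' a x := by
    rw [RingHom.id_apply]
    induction a using quotAlg_induction generalizing x with
    | zero => simp
    | add a b iha ihb => rw [add_smul, map_add, iha, ihb, add_smul]
    | arrow c u v huv => rw [mul_smul, hk, ha u v huv, mul_smul]

lemma eq_zero_of_forall_quotArrow_self_smul_eq_zero {X : Type*} [AddCommGroup X]
    [Module (QuotAlg k D) X] {x : X} (h : ∀ u ∈ D.verts, quotArrow k D u u • x = 0) : x = 0 := by
  rw [← one_smul (QuotAlg k D) x]
  generalize (1 : QuotAlg k D) = a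
  induction a using quotAlg_induction with
  | zero => rw [zero_smul]
  | add a b iha ihb => rw [add_smul, iha, ihb, add_zero]
  | arrow c u v huv =>
    by_cases hv : v ∈ D.verts
    · rw [← quotArrow_mul_quotArrow huv le_rfl, mul_smul, mul_smul, h v hv, smul_zero, smul_zero]
    · rw [quotArrow_eq_zero_of_notMem_right huv hv, mul_zero, zero_smul]

end Arrows

section Intervals

variable {k : Type u} [Field k] {d p : ℕ} {D : QuotientData d p} {lo hi lo' hi' : Vtx d}

section Coefficients

open Classical in
/-- The coefficient of an element of an interval module at a vertex, with value `0` at the vertices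
outside the interval. -/
def coeff {h : IsAdmissible D lo hi} (w : IntervalModule k h) (x : Vtx d) : k :=
  if hx : x ∈ Finset.Icc lo hi then w ⟨x, hx⟩ else 0

/-- The element of an interval module whose coefficients are given by a function on all vertices,
the values outside the interval being ignored. -/
def ofCoeff (h : IsAdmissible D lo hi) (f : Vtx d → k) : IntervalModule k h := fun x => f x.1

open Classical in
/-- The element `b_z` of the canonical basis; it is `0` if `z` is not in the interval. -/
def basisVec (h : IsAdmissible D lo hi) (z : Vtx d) : IntervalModule k h :=
  ofCoeff h fun x => if x = z then 1 else 0

instance (h : IsAdmissible D lo hi) : Module k (IntervalModule k h) :=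
  inferInstanceAs (Module k (Finset.Icc lo hi → k))

instance (h : IsAdmissible D lo hi) : Module.Finite k (IntervalModule k h) :=
  inferInstanceAs (Module.Finite k (Finset.Icc lo hi → k))

variable {h : IsAdmissible D lo hi} {h' : IsAdmissible D lo' hi'}

lemma coeff_of_notMem (w : IntervalModule k h) {x : Vtx d} (hx : ¬ (lo ≤ x ∧ x ≤ hi)) :
    coeff w x = 0 := dif_neg (by rwa [Finset.mem_Icc])

lemma mem_of_coeff_ne_zero {w : IntervalModule k h} {x : Vtx d} (hx : coeff w x ≠ 0) :
    lo ≤ x ∧ x ≤ hi := by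
  by_contra h'; exact hx (coeff_of_notMem w h')

lemma coeff_coe (w : IntervalModule k h) (x : Finset.Icc lo hi) : coeff w x.1 = w x :=
  dif_pos x.2

lemma interval_ext {w w' : IntervalModule k h}
    (hw : ∀ x, lo ≤ x → x ≤ hi → coeff w x = coeff w' x) : w = w' := by
  funext x
  rw [← coeff_coe w x, ← coeff_coe w' x]
  exact hw _ (Finset.mem_Icc.1 x.2).1 (Finset.mem_Icc.1 x.2).2

open Classical in
lemma coeff_ofCoeff (f : Vtx d → k) (x : Vtx d) :
    coeff (ofCoeff h f) x = if lo ≤ x ∧ x ≤ hi then f x else 0 := by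
  by_cases hx : lo ≤ x ∧ x ≤ hi
  · rw [if_pos hx]; exact dif_pos (Finset.mem_Icc.2 hx)
  · rw [if_neg hx]; exact coeff_of_notMem _ hx

lemma coeff_add (w w' : IntervalModule k h) (x : Vtx d) :
    coeff (w + w') x = coeff w x + coeff w' x := by
  by_cases hx : x ∈ Finset.Icc lo hi
  · simp only [coeff, dif_pos hx]; rfl
  · simp [coeff, dif_neg hx]

lemma coeff_zero (x : Vtx d) : coeff (0 : IntervalModule k h) x = 0 := by
  by_cases hx : x ∈ Finset.Icc lo hi
  · simp only [coeff, dif_pos hx]; rfl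
  · simp [coeff, dif_neg hx]

lemma coeff_sum {ι : Type*} (s : Finset ι) (w : ι → IntervalModule k h) (x : Vtx d) :
    coeff (∑ i ∈ s, w i) x = ∑ i ∈ s, coeff (w i) x :=
  map_sum (AddMonoidHom.mk' (fun w : IntervalModule k h => coeff w x)
    (fun a b => coeff_add a b x)) w s

lemma coeff_smul (c : k) (w : IntervalModule k h) (x : Vtx d) :
    coeff (c • w) x = c * coeff w x := by
  by_cases hx : x ∈ Finset.Icc lo hi
  · simp only [coeff, dif_pos hx]; rfl
  · simp [coeff, dif_neg hx]

lemma coeff_mk_smul (a : orbitAlg k d p) (w : IntervalModule k h) {x : Vtx d}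
    (hx : lo ≤ x ∧ x ≤ hi) :
    coeff (QuotAlg.mk k D a • w) x = ∑ y ∈ Finset.Icc lo hi, a.1 x y * coeff w y := by
  have hx' := Finset.mem_Icc.2 hx
  have e : coeff (QuotAlg.mk k D a • w) x = (QuotAlg.mk k D a • w) ⟨x, hx'⟩ := dif_pos hx'
  rw [e, intervalModule_smul, ← Finset.sum_coe_sort]
  refine Finset.sum_congr rfl fun y _ => ?_
  rw [coeff_coe]
  rfl

lemma coeff_algebraMap_smul (c : k) (w : IntervalModule k h) (x : Vtx d) :
    coeff (algebraMap k (QuotAlg k D) c • w) x = c * coeff w x := by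
  classical
  by_cases hx : lo ≤ x ∧ x ≤ hi
  · change coeff (QuotAlg.mk k D (c • unitElt k D) • w) x = _
    rw [coeff_mk_smul _ _ hx, Finset.sum_eq_single x]
    · change c * (idem (p := p) k D.verts D.verts_shift D.verts_finite).1 x x * _ = _
      rw [idem_apply, if_pos ⟨rfl, h.1 x hx.1 hx.2⟩, mul_one]
    · intro y _ hy
      change c * (idem (p := p) k D.verts D.verts_shift D.verts_finite).1 x y * _ = _
      rw [idem_apply, if_neg (fun h' => hy h'.1.symm), mul_zero, zero_mul]
    · intro hx'; exact (hx' (Finset.mem_Icc.2 hx)).elim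
  · rw [coeff_of_notMem _ hx, coeff_of_notMem _ hx, mul_zero]

instance : IsScalarTower k (QuotAlg k D) (IntervalModule k h) :=
  IsScalarTower.of_algebraMap_smul fun c w => interval_ext fun x _ _ => by
    rw [coeff_algebraMap_smul, coeff_smul]

instance : Module.Finite (QuotAlg k D) (IntervalModule k h) :=
  Module.Finite.of_restrictScalars_finite k _ _

open Classical in
lemma coeff_quotArrow_smul {u v : Vtx d} (huv : u ≤ v) (w : IntervalModule k h) (x : Vtx d) :
    coeff (quotArrow k D u v • w) x =
      if SameOrbit p x u ∧ lo ≤ x ∧ x ≤ hi then coeff w (x + (v - u)) else 0 := by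
  by_cases hx : lo ≤ x ∧ x ≤ hi
  · rw [quotArrow, coeff_mk_smul _ _ hx]
    simp only [arrow_apply_add, huv, true_and, hx, and_true]
    by_cases hu : SameOrbit p x u
    · simp only [hu, true_and, if_true, ite_mul, one_mul, zero_mul]
      rw [Finset.sum_ite_eq']
      by_cases hm : x + (v - u) ∈ Finset.Icc lo hi
      · rw [if_pos hm]
      · rw [if_neg hm, coeff_of_notMem]; rwa [Finset.mem_Icc] at hm
    · simp [hu]
  · rw [coeff_of_notMem _ hx, if_neg (fun h' => hx h'.2)]

open Classical in
lemma coeff_basisVec (z x : Vtx d) :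
    coeff (basisVec h z : IntervalModule k h) x = if (lo ≤ x ∧ x ≤ hi) ∧ x = z then 1 else 0 := by
  rw [basisVec, coeff_ofCoeff, ite_and (lo ≤ x ∧ x ≤ hi)]

lemma coeff_basisVec_self {z : Vtx d} (hz : lo ≤ z ∧ z ≤ hi) :
    coeff (basisVec h z : IntervalModule k h) z = 1 := by
  classical
  rw [coeff_basisVec, if_pos ⟨hz, rfl⟩]

lemma basisVec_eq_zero {z : Vtx d} (hz : ¬ lo ≤ z) : (basisVec h z : IntervalModule k h) = 0 := by
  classical
  refine interval_ext fun x hlx _ => ?_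
  rw [coeff_basisVec, coeff_zero, if_neg]
  rintro ⟨-, rfl⟩
  exact hz hlx

lemma eq_sum_basisVec (w : IntervalModule k h) :
    w = ∑ y ∈ Finset.Icc lo hi, algebraMap k (QuotAlg k D) (coeff w y) • basisVec h y := by
  classical
  refine interval_ext fun x hlx hxh => ?_
  simp only [coeff_sum, coeff_algebraMap_smul, coeff_basisVec, hlx, hxh, and_self, true_and,
    mul_ite, mul_one, mul_zero]
  rw [Finset.sum_ite_eq, if_pos (Finset.mem_Icc.2 ⟨hlx, hxh⟩)]

open Classical in
lemma quotArrow_smul_basisVec {u v z : Vtx d} (huv : u ≤ v) (hz : z ≤ hi) :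
    quotArrow k D u v • (basisVec h z : IntervalModule k h) =
      if SameOrbit p v z then basisVec h (z - (v - u)) else 0 := by
  refine interval_ext fun x hlx hxh => ?_
  rw [coeff_quotArrow_smul huv, coeff_basisVec, apply_ite (coeff · x), coeff_basisVec, coeff_zero]
  by_cases hxz : x + (v - u) = z
  · subst hxz
    have horbit : SameOrbit p v (x + (v - u)) ↔ SameOrbit p x u := by
      rw [← SameOrbit.add_iff (v - u) (x := x), add_sub_cancel]
      exact ⟨.symm, .symm⟩
    have hle : lo ≤ x + (v - u) := hlx.trans (by simpa using huv)
    simp [hlx, hxh, hle, hz, horbit]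
  · have : x ≠ z - (v - u) := fun h => hxz (eq_sub_iff_add_eq.1 h)
    simp [hxz, this]

lemma quotArrow_smul_basisVec_top {y : Vtx d} (hy : y ≤ hi) :
    quotArrow k D y hi • (basisVec h hi : IntervalModule k h) = basisVec h y := by
  classical
  rw [quotArrow_smul_basisVec hy le_rfl, if_pos (.refl hi), sub_sub_cancel]

lemma interval_hom_ext {X : Type*} [AddCommGroup X] [Module (QuotAlg k D) X]
    {f g : IntervalModule k h →ₗ[QuotAlg k D] X} (hfg : f (basisVec h hi) = g (basisVec h hi)) :
    f = g := by
  refine LinearMap.ext fun w => ?_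
  rw [eq_sum_basisVec w, map_sum, map_sum]
  refine Finset.sum_congr rfl fun y hy => ?_
  rw [map_smul, map_smul, ← quotArrow_smul_basisVec_top (Finset.mem_Icc.1 hy).2, map_smul,
    map_smul, hfg]

end Coefficients

variable {h : IsAdmissible D lo hi} {h' : IsAdmissible D lo' hi'}

section Transfer

lemma shift_add (m : ℤ) (x y : Vtx d) : shift p m (x + y) = shift p m x + y := by
  rw [shift_eq_add m x, add_sub_cancel_left]

lemma shift_neg_le_iff {m : ℤ} {x y : Vtx d} : shift p (-m) x ≤ y ↔ x ≤ shift p m y := by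
  rw [← shift_le_shift p m, shift_shift, add_neg_cancel, shift_zero]

lemma le_shift_neg_iff {m : ℤ} {x y : Vtx d} : x ≤ shift p (-m) y ↔ shift p m x ≤ y := by
  rw [← shift_le_shift p m, shift_shift, add_neg_cancel, shift_zero]

lemma shift_neg_eq_iff {m : ℤ} {x y : Vtx d} : shift p (-m) x = y ↔ x = shift p m y := by
  rw [← shift_inj p m, shift_shift, add_neg_cancel, shift_zero]

/-- The homomorphism of interval modules that moves the coefficients by `shift p m` and multiplies
them by `c`; in terms of the bases it sends `b_y` to `c • b_{shift p m y}`. -/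
def transfer (h : IsAdmissible D lo hi) (h' : IsAdmissible D lo' hi') (c : k) (m : ℤ)
    (hlo : shift p m lo ≤ lo') (hhi : shift p m hi ≤ hi') :
    IntervalModule k h →ₗ[QuotAlg k D] IntervalModule k h' :=
  linearMapOfArrows
    (AddMonoidHom.mk' (fun w => ofCoeff h' fun x => c * coeff w (shift p (-m) x)) fun a b => by
      classical
      refine interval_ext fun x hlx hxh => ?_
      simp only [coeff_add, coeff_ofCoeff, hlx, hxh, and_self, if_true, mul_add])
    (fun a w => by
      classical
      refine interval_ext fun x hlx hxh => ?_
      simp only [AddMonoidHom.mk'_apply, coeff_ofCoeff, coeff_algebraMap_smul, hlx, hxh, and_self,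
        if_true, mul_left_comm])
    (fun u v huv w => by
      classical
      refine interval_ext fun x hlx hxh => ?_
      have horbit : SameOrbit p (shift p (-m) x) u ↔ SameOrbit p x u :=
        ⟨fun h => .trans (.symm ⟨-m, rfl⟩) h, fun h => .trans ⟨-m, rfl⟩ h⟩
      have hle : x ≤ x + (v - u) := by simpa using huv
      simp only [AddMonoidHom.mk'_apply, coeff_ofCoeff, coeff_quotArrow_smul huv, hlx, hxh,
        and_self, and_true, if_true, horbit, ← shift_add]
      by_cases hw : coeff w (shift p (-m) (x + (v - u))) = 0
      · simp [hw]
      · obtain ⟨-, hwhi⟩ := mem_of_coeff_ne_zero hw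
        have hlox : lo ≤ shift p (-m) x := le_shift_neg_iff.2 (hlo.trans hlx)
        have hxhi : shift p (-m) x ≤ hi := ((shift_le_shift p _).2 hle).trans hwhi
        have hhi' : x + (v - u) ≤ hi' := (shift_neg_le_iff.1 hwhi).trans hhi
        simp [hlox, hxhi, hlx.trans hle, hhi'])

open Classical in
lemma coeff_transfer (c : k) (m : ℤ) (hlo : shift p m lo ≤ lo') (hhi : shift p m hi ≤ hi')
    (w : IntervalModule k h) (x : Vtx d) :
    coeff (transfer h h' c m hlo hhi w) x =
      if lo' ≤ x ∧ x ≤ hi' then c * coeff w (shift p (-m) x) else 0 :=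
  coeff_ofCoeff (h := h') (fun x => c * coeff w (shift p (-m) x)) x

lemma transfer_basisVec_top (c : k) (m : ℤ) (hlo : shift p m lo ≤ lo')
    (hhi : shift p m hi ≤ hi') :
    transfer h h' c m hlo hhi (basisVec h hi) =
      algebraMap k (QuotAlg k D) c • basisVec h' (shift p m hi) := by
  classical
  refine interval_ext fun x hlx hxh => ?_
  simp only [coeff_transfer, coeff_algebraMap_smul, coeff_basisVec, shift_neg_eq_iff]
  by_cases hx : x = shift p m hi
  · subst hx
    have : lo ≤ hi := (shift_le_shift p m).1 (hlo.trans hlx)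
    simp [hlx, hxh, shift_shift, shift_zero, this]
  · simp [hx]

lemma sameOrbit_of_coeff_hom_ne_zero (g : IntervalModule k h →ₗ[QuotAlg k D] IntervalModule k h')
    {z : Vtx d} (hz : coeff (g (basisVec h hi)) z ≠ 0) : SameOrbit p z hi := by
  classical
  by_contra hc
  rw [← quotArrow_smul_basisVec_top le_rfl, map_smul, coeff_quotArrow_smul le_rfl] at hz
  simp [hc] at hz

lemma shift_lower_le_of_coeff_hom_ne_zero
    (g : IntervalModule k h →ₗ[QuotAlg k D] IntervalModule k h') {m : ℤ}
    (hz : coeff (g (basisVec h hi)) (shift p m hi) ≠ 0) : shift p m lo ≤ lo' := by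
  classical
  by_contra hlo
  -- the arrow from the translate of `lo'` to `hi` kills `b_hi`, but it moves the coefficient of
  -- `g b_hi` at `shift p m hi` to the one at `lo'`
  obtain ⟨hlz, hzh⟩ := mem_of_coeff_ne_zero hz
  have hy : shift p (-m) lo' ≤ hi := shift_neg_le_iff.2 hlz
  have hsmul : quotArrow k D (shift p (-m) lo') hi • g (basisVec h hi) = 0 := by
    rw [← map_smul, quotArrow_smul_basisVec_top hy,
      basisVec_eq_zero (by rwa [le_shift_neg_iff]), map_zero]
  have hcoeff := congrArg (coeff · lo') hsmul
  have horbit : SameOrbit p lo' (shift p (-m) lo') := .symm ⟨-m, rfl⟩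
  simp only [coeff_quotArrow_smul hy, coeff_zero, horbit, hlz.trans hzh, le_rfl, and_self,
    if_true] at hcoeff
  rw [shift_eq_add m (shift p (-m) lo'), shift_shift, add_neg_cancel, shift_zero] at hz
  exact hz hcoeff

lemma hom_mem_closure_transfer (g : IntervalModule k h →ₗ[QuotAlg k D] IntervalModule k h') :
    g ∈ AddSubmonoid.closure {f | ∃ (c : k) (m : ℤ) (hlo : shift p m lo ≤ lo')
      (hhi : shift p m hi ≤ hi'), coeff (g (basisVec h hi)) (shift p m hi) ≠ 0 ∧
        f = transfer h h' c m hlo hhi} := by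
  classical
  let T := (Finset.Icc lo' hi').filter fun z => coeff (g (basisVec h hi)) z ≠ 0
  have hT (z) (hz : z ∈ T) : ∃ m, ∃ (_ : shift p m lo ≤ lo') (_ : shift p m hi ≤ hi'),
      z = shift p m hi := by
    obtain ⟨hzI, hz⟩ := Finset.mem_filter.1 hz
    obtain ⟨m, rfl⟩ := sameOrbit_of_coeff_hom_ne_zero g hz
    exact ⟨m, shift_lower_le_of_coeff_hom_ne_zero g hz, (Finset.mem_Icc.1 hzI).2, rfl⟩
  choose m hlo hhi hm using hT
  have hg : g = ∑ z ∈ T.attach,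
      transfer h h' (coeff (g (basisVec h hi)) z) (m z z.2) (hlo z z.2) (hhi z z.2) := by
    refine interval_hom_ext ?_
    simp only [LinearMap.sum_apply, transfer_basisVec_top, ← hm]
    rw [Finset.sum_attach T fun z =>
      algebraMap k (QuotAlg k D) (coeff (g (basisVec h hi)) z) • basisVec h' z,
      Finset.sum_filter_of_ne]
    · exact eq_sum_basisVec _
    · rintro z - hz hz₀
      exact hz (by rw [hz₀, map_zero, zero_smul])
  conv_rhs => rw [hg]
  refine sum_mem fun z _ => AddSubmonoid.subset_closure ?_
  refine ⟨_, m z z.2, hlo z z.2, hhi z z.2, ?_, rfl⟩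
  rw [← hm]
  exact (Finset.mem_filter.1 z.2).2

end Transfer

section UniversalProperties

variable {X : Type*} [AddCommGroup X] [Module (QuotAlg k D) X]

section Top

variable (k h) (v : X) (hv : ∀ y, y ≤ hi → ¬ lo ≤ y → quotArrow k D y hi • v = 0)

/-- The additive map underlying `intervalHom`. -/
def intervalAddHom : IntervalModule k h →+ X :=
  AddMonoidHom.mk' (fun w => ∑ y ∈ Finset.Icc lo hi,
    algebraMap k (QuotAlg k D) (coeff w y) • quotArrow k D y hi • v) fun a b => by
      simp only [coeff_add, map_add, add_smul, Finset.sum_add_distrib]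

lemma intervalAddHom_algebraMap_smul (c : k) (w : IntervalModule k h) :
    intervalAddHom k h v (algebraMap k (QuotAlg k D) c • w) =
      algebraMap k (QuotAlg k D) c • intervalAddHom k h v w := by
  simp only [intervalAddHom, AddMonoidHom.mk'_apply, coeff_algebraMap_smul, Finset.smul_sum,
    map_mul, mul_smul]

variable {k v}
include hv

lemma intervalAddHom_basisVec {z : Vtx d} (hz : z ≤ hi) :
    intervalAddHom k h v (basisVec h z) = quotArrow k D z hi • v := by
  classical
  by_cases hlz : lo ≤ z
  · change ∑ y ∈ Finset.Icc lo hi, algebraMap k (QuotAlg k D) (coeff (basisVec h z) y) • _ = _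
    rw [Finset.sum_eq_single_of_mem z (Finset.mem_Icc.2 ⟨hlz, hz⟩) fun y _ hy => ?_,
      coeff_basisVec_self ⟨hlz, hz⟩, map_one, one_smul]
    rw [coeff_basisVec, if_neg fun h => hy h.2, map_zero, zero_smul]
  · rw [basisVec_eq_zero hlz, map_zero, hv z hz hlz]

lemma intervalAddHom_quotArrow_smul {u u' : Vtx d} (hu : u ≤ u') (w : IntervalModule k h) :
    intervalAddHom k h v (quotArrow k D u u' • w) =
      quotArrow k D u u' • intervalAddHom k h v w := by
  classical
  rw [eq_sum_basisVec w, Finset.smul_sum, map_sum, map_sum, Finset.smul_sum]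
  refine Finset.sum_congr rfl fun z hz => ?_
  obtain ⟨-, hz⟩ := Finset.mem_Icc.1 hz
  rw [← mul_smul, ← Algebra.commutes, mul_smul, intervalAddHom_algebraMap_smul,
    intervalAddHom_algebraMap_smul, intervalAddHom_basisVec h hv hz,
    ← mul_smul (quotArrow k D u u'), ← Algebra.commutes, mul_smul, ← mul_smul (quotArrow k D u u'),
    quotArrow_smul_basisVec hu hz]
  split_ifs with horbit
  · rw [quotArrow_mul_quotArrow_of_sameOrbit hu hz horbit,
      intervalAddHom_basisVec h hv ((sub_le_self z (sub_nonneg.2 hu)).trans hz)]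
  · rw [quotArrow_mul_quotArrow_eq_zero hu horbit, map_zero, zero_smul]

variable (v)

/-- The homomorphism from an interval module that sends the top basis vector to a given element
killed by the arrows that leave the interval. -/
def intervalHom : IntervalModule k h →ₗ[QuotAlg k D] X :=
  linearMapOfArrows (intervalAddHom k h v) (intervalAddHom_algebraMap_smul k h v)
    fun _ _ => intervalAddHom_quotArrow_smul h hv

lemma intervalHom_basisVec_top :
    intervalHom h v hv (basisVec h hi) = quotArrow k D hi hi • v :=
  intervalAddHom_basisVec h hv le_rfl

end Top

section Bottom

variable (φ : X →+ k) (hφ : ∀ (c : k) x, φ (algebraMap k (QuotAlg k D) c • x) = c * φ x)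
  (hv : ∀ y, lo ≤ y → ¬ y ≤ hi → quotArrow k D lo y = 0)

/-- The homomorphism to an interval module determined by a linear form, which becomes the
coefficient at the bottom vertex. -/
def intervalCohom (h : IsAdmissible D lo hi) : X →ₗ[QuotAlg k D] IntervalModule k h :=
  linearMapOfArrows
    (AddMonoidHom.mk' (fun x => ofCoeff h fun y => φ (quotArrow k D lo y • x)) fun a b => by
      classical
      refine interval_ext fun y hly hyh => ?_
      simp only [coeff_add, coeff_ofCoeff, smul_add, map_add, hly, hyh, and_self, if_true])
    (fun c x => by
      classical
      refine interval_ext fun y hly hyh => ?_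
      simp only [AddMonoidHom.mk'_apply, coeff_ofCoeff, coeff_algebraMap_smul, hly, hyh, and_self,
        if_true]
      rw [← mul_smul, ← Algebra.commutes, mul_smul, hφ])
    (fun u v huv x => by
      classical
      refine interval_ext fun y hly hyh => ?_
      simp only [AddMonoidHom.mk'_apply, coeff_ofCoeff, coeff_quotArrow_smul huv, hly, hyh,
        and_self, and_true, if_true]
      rw [← mul_smul]
      by_cases hu : SameOrbit p y u
      · obtain ⟨m, rfl⟩ := hu
        have hle : shift p m u ≤ shift p m v := (shift_le_shift p m).2 huv
        rw [if_pos ⟨m, rfl⟩, ← shift_eq_add, ← quotArrow_shift m u v,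
          quotArrow_mul_quotArrow hly hle]
        by_cases hc : shift p m v ≤ hi
        · rw [if_pos ⟨hly.trans hle, hc⟩]
        · rw [if_neg fun h => hc h.2, hv _ (hly.trans hle) hc, zero_smul, map_zero]
      · rw [if_neg hu, quotArrow_mul_quotArrow_eq_zero hly hu, zero_smul, map_zero])

lemma coeff_intervalCohom (x : X) {y : Vtx d} (hy : lo ≤ y ∧ y ≤ hi) :
    coeff (intervalCohom φ hφ hv h x) y = φ (quotArrow k D lo y • x) := by
  classical
  exact (coeff_ofCoeff (h := h) (fun y => φ (quotArrow k D lo y • x)) y).trans (if_pos hy)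

end Bottom

end UniversalProperties

end Intervals

section Rigid

variable {k : Type u} [Field k] {d p : ℕ} {D : QuotientData d p}
  {lo hi lo' hi' lo'' hi'' : Vtx d}

section CanonicalMaps

variable {h : IsAdmissible D lo hi} {h' : IsAdmissible D lo' hi'} {h'' : IsAdmissible D lo'' hi''}

lemma shift_add_le {m m' : ℤ} {x y z : Vtx d} (hxy : shift p m x ≤ y) (hyz : shift p m' y ≤ z) :
    shift p (m' + m) x ≤ z := by
  rw [← shift_shift]
  exact ((shift_le_shift p m').2 hxy).trans hyz

lemma transfer_comp_transfer (c c' : k) (m m' : ℤ) (hlo : shift p m lo ≤ lo')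
    (hhi : shift p m hi ≤ hi') (hlo' : shift p m' lo' ≤ lo'') (hhi' : shift p m' hi' ≤ hi'') :
    (transfer h' h'' c' m' hlo' hhi').comp (transfer h h' c m hlo hhi) =
      transfer h h'' (c' * c) (m' + m) (shift_add_le hlo hlo') (shift_add_le hhi hhi') := by
  classical
  refine LinearMap.ext fun w => interval_ext fun x hlx hxh => ?_
  simp only [LinearMap.comp_apply, coeff_transfer, hlx, hxh, and_self, if_true, shift_shift,
    neg_add_rev]
  by_cases hw : coeff w (shift p (-m + -m') x) = 0
  · simp [hw]
  · have hmem : lo' ≤ shift p (-m') x ∧ shift p (-m') x ≤ hi' := by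
      refine ⟨le_shift_neg_iff.2 (hlo'.trans hlx), (shift_neg_le_iff.1 ?_).trans hhi⟩
      rw [shift_shift]
      exact (mem_of_coeff_ne_zero hw).2
    rw [if_pos hmem, mul_assoc]

lemma transfer_congr {c c' : k} {m m' : ℤ} (hc : c = c') (hm : m = m')
    (hlo : shift p m lo ≤ lo') (hhi : shift p m hi ≤ hi') :
    transfer h h' c m hlo hhi = transfer h h' c' m' (hm ▸ hlo) (hm ▸ hhi) := by
  subst hc hm; rfl

lemma transfer_one_zero (hlo : shift p 0 lo ≤ lo) (hhi : shift p 0 hi ≤ hi) :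
    transfer h h (1 : k) 0 hlo hhi = LinearMap.id := by
  classical
  refine LinearMap.ext fun w => interval_ext fun x hlx hxh => ?_
  rw [coeff_transfer, if_pos ⟨hlx, hxh⟩, one_mul, neg_zero, shift_zero, LinearMap.id_apply]

lemma shift_zero_le {x y : Vtx d} (h : x ≤ y) : shift p 0 x ≤ y := by rwa [shift_zero]

/-- The canonical map between interval modules, which sends `b_x` to `b_x`. -/
def canMap (h : IsAdmissible D lo hi) (h' : IsAdmissible D lo' hi') (hlo : lo ≤ lo')
    (hhi : hi ≤ hi') : IntervalModule k h →ₗ[QuotAlg k D] IntervalModule k h' :=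
  transfer h h' 1 0 (shift_zero_le hlo) (shift_zero_le hhi)

open Classical in
lemma coeff_canMap (hlo : lo ≤ lo') (hhi : hi ≤ hi') (w : IntervalModule k h) (x : Vtx d) :
    coeff (canMap h h' hlo hhi w) x = if lo' ≤ x ∧ x ≤ hi' then coeff w x else 0 := by
  rw [canMap, coeff_transfer, one_mul, neg_zero, shift_zero]

lemma transfer_comp_canMap (c : k) (m : ℤ) (hlo : lo ≤ lo') (hhi : hi ≤ hi')
    (hlo' : shift p m lo' ≤ lo'') (hhi' : shift p m hi' ≤ hi'') :
    (transfer h' h'' c m hlo' hhi').comp (canMap h h' hlo hhi) =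
      transfer h h'' c m (((shift_le_shift p m).2 hlo).trans hlo')
        (((shift_le_shift p m).2 hhi).trans hhi') := by
  rw [canMap, transfer_comp_transfer]
  exact transfer_congr (mul_one c) (add_zero m) _ _

lemma canMap_comp_transfer (c : k) (m : ℤ) (hlo : shift p m lo ≤ lo') (hhi : shift p m hi ≤ hi')
    (hlo' : lo' ≤ lo'') (hhi' : hi' ≤ hi'') :
    (canMap h' h'' hlo' hhi').comp (transfer h h' c m hlo hhi) =
      transfer h h'' c m (hlo.trans hlo') (hhi.trans hhi') := by
  rw [canMap, transfer_comp_transfer]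
  exact transfer_congr (one_mul c) (zero_add m) _ _

lemma canMap_comp_canMap (hlo : lo ≤ lo') (hhi : hi ≤ hi') (hlo' : lo' ≤ lo'')
    (hhi' : hi' ≤ hi'') :
    (canMap h' h'' hlo' hhi').comp (canMap h h' hlo hhi) =
      (canMap h h'' (hlo.trans hlo') (hhi.trans hhi') :
        _ →ₗ[QuotAlg k D] IntervalModule k h'') :=
  transfer_comp_canMap 1 0 hlo hhi _ _

end CanonicalMaps

section Cut

lemma IsAdmissible.mono (h : IsAdmissible D lo hi) (hlo : lo ≤ lo') (hhi : hi' ≤ hi) :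
    IsAdmissible D lo' hi' :=
  ⟨fun z hlz hzh => h.1 z (hlo.trans hlz) (hzh.trans hhi),
    fun u v huv hlu hle hvh => h.2 u v huv (hlo.trans hlu) hle (hvh.trans hhi)⟩

variable (k) in
/-- An interval module as an object of the category of modules. -/
abbrev intervalObj (h : IsAdmissible D lo hi) : ModuleCat.{u} (QuotAlg k D) :=
  ModuleCat.of (QuotAlg k D) (IntervalModule k h)

/-- Translation by a multiple of the period is an isomorphism of interval modules. -/
def shiftIso {m : ℤ} (h : IsAdmissible D lo hi) (h' : IsAdmissible D lo' hi')
    (hlo : shift p m lo = lo') (hhi : shift p m hi = hi') :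
    intervalObj k h ≅ intervalObj k h' where
  hom := ModuleCat.ofHom (transfer h h' 1 m hlo.le hhi.le)
  inv := ModuleCat.ofHom (transfer h' h 1 (-m) (shift_neg_le_iff.2 hlo.ge)
    (shift_neg_le_iff.2 hhi.ge))
  hom_inv_id := by
    rw [← ModuleCat.ofHom_comp, transfer_comp_transfer,
      transfer_congr (mul_one 1) (neg_add_cancel m), transfer_one_zero, ModuleCat.ofHom_id]
  inv_hom_id := by
    rw [← ModuleCat.ofHom_comp, transfer_comp_transfer,
      transfer_congr (mul_one 1) (add_neg_cancel m), transfer_one_zero, ModuleCat.ofHom_id]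

lemma intervalObj_congr (hlo : lo = lo') (hhi : hi = hi') (h : IsAdmissible D lo hi) :
    intervalObj k h = intervalObj k (h.mono hlo.le hhi.ge) := by
  subst hlo hhi; rfl

variable (h : IsAdmissible D lo hi) (h₁ : IsAdmissible D lo hi') (h₃ : IsAdmissible D lo' hi)
  (hlo : lo ≤ lo') (hhi : hi' ≤ hi) (hcut : ¬ lo' ≤ hi')

lemma canMap_comp_canMap_eq_zero (hcut : ¬ lo' ≤ hi') :
    (canMap h h₃ hlo le_rfl).comp (canMap h₁ h le_rfl hhi) =
      (0 : _ →ₗ[QuotAlg k D] IntervalModule k h₃) := by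
  classical
  refine LinearMap.ext fun w => interval_ext fun x hlx hxh => ?_
  rw [LinearMap.comp_apply, coeff_canMap, coeff_canMap, LinearMap.zero_apply, coeff_zero,
    if_pos ⟨hlx, hxh⟩, if_pos ⟨hlo.trans hlx, hxh⟩]
  exact coeff_of_notMem _ fun hx => hcut (hlx.trans hx.2)

lemma canMap_injective :
    Function.Injective (canMap h₁ h le_rfl hhi : _ →ₗ[QuotAlg k D] IntervalModule k h) := by
  classical
  refine fun w w' hw => interval_ext fun x hlx hxh => ?_
  simpa only [coeff_canMap, hlx, hxh.trans hhi, and_self, if_true] using congrArg (coeff · x) hw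

lemma canMap_surjective :
    Function.Surjective (canMap h h₃ hlo le_rfl : _ →ₗ[QuotAlg k D] IntervalModule k h₃) := by
  classical
  refine fun w => ⟨ofCoeff h (coeff w), interval_ext fun x hlx hxh => ?_⟩
  rw [coeff_canMap, coeff_ofCoeff, if_pos ⟨hlx, hxh⟩, if_pos ⟨hlo.trans hlx, hxh⟩]

lemma exists_canMap_eq_of_canMap_eq_zero
    (hcover : ∀ x, lo ≤ x → x ≤ hi → ¬ lo' ≤ x → x ≤ hi') {w : IntervalModule k h}
    (hw : canMap h h₃ hlo le_rfl w = 0) : ∃ w₁, canMap h₁ h le_rfl hhi w₁ = w := by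
  classical
  refine ⟨ofCoeff h₁ (coeff w), interval_ext fun x hlx hxh => ?_⟩
  rw [coeff_canMap, coeff_ofCoeff, if_pos ⟨hlx, hxh⟩]
  by_cases hx : lo' ≤ x
  · have hwx : coeff w x = 0 := by
      simpa only [coeff_canMap, coeff_zero, hx, hxh, and_self, if_true] using
        congrArg (coeff · x) hw
    rw [hwx, ite_self]
  · rw [if_pos ⟨hlx, hcover x hlx hxh hx⟩]

variable (k) in
/-- The complex of interval modules obtained by cutting the interval `[lo, hi]` into its lower part
`[lo, hi']` and its upper part `[lo', hi]`. -/
abbrev cutComplex : ShortComplex (ModuleCat.{u} (QuotAlg k D)) :=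
  .mk (X₁ := intervalObj k h₁) (X₂ := intervalObj k h) (X₃ := intervalObj k h₃)
    (ModuleCat.ofHom (canMap h₁ h le_rfl hhi)) (ModuleCat.ofHom (canMap h h₃ hlo le_rfl))
    (ModuleCat.hom_ext (canMap_comp_canMap_eq_zero h h₁ h₃ hlo hhi hcut))

lemma shortExact_cutComplex (hcover : ∀ x, lo ≤ x → x ≤ hi → ¬ lo' ≤ x → x ≤ hi') :
    (cutComplex k h h₁ h₃ hlo hhi hcut).ShortExact where
  exact := (ShortComplex.moduleCat_exact_iff _).2 fun _ hw =>
    exists_canMap_eq_of_canMap_eq_zero h h₁ h₃ hlo hhi hcover hw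
  mono_f := (ModuleCat.mono_iff_injective _).2 (canMap_injective h h₁ hhi)
  epi_g := (ModuleCat.epi_iff_surjective _).2 (canMap_surjective h h₃ hlo)

lemma projective_intervalObj
    (hzero : ∀ y, y ≤ hi → ¬ lo ≤ y → quotArrow k D y hi = 0) : Projective (intervalObj k h) := by
  refine ⟨fun {E X} f e he => ?_⟩
  obtain ⟨v, hv⟩ := (ModuleCat.epi_iff_surjective e).1 he (f.hom (basisVec h hi))
  have hv₀ : ∀ y, y ≤ hi → ¬ lo ≤ y → quotArrow k D y hi • v = 0 :=
    fun y hyh hly => by rw [hzero y hyh hly, zero_smul]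
  refine ⟨ModuleCat.ofHom (intervalHom h v hv₀), ModuleCat.hom_ext (interval_hom_ext ?_)⟩
  calc e.hom (intervalHom h v hv₀ (basisVec h hi))
      = quotArrow k D hi hi • e.hom v := by rw [intervalHom_basisVec_top, map_smul]
    _ = f.hom (basisVec h hi) := by
      rw [show e.hom v = _ from hv, ← map_smul, quotArrow_smul_basisVec_top le_rfl]

end Cut

section Syzygies

/-- The lower end of the `j`-th syzygy of the interval module of a sequence `a`. -/
def syzygyLower (a : ℕ → ℤ) (j : ℕ) : Vtx d := fun i =>
  if (i : ℕ) + j < d then a (i + 1) else a (i + 2) - 1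

/-- The upper end of the `j`-th syzygy of the interval module of a sequence `a`. -/
def syzygyUpper (a : ℕ → ℤ) (j : ℕ) : Vtx d := fun i =>
  if (i : ℕ) + j < d then a i else a (i + 1) - 1

variable {a : ℕ → ℤ}

lemma syzygyLower_succ_le (ha : Antitone a) (j : ℕ) :
    (syzygyLower a (j + 1) : Vtx d) ≤ syzygyLower a j := by
  intro i
  have := ha (show (i : ℕ) + 1 ≤ i + 2 by omega)
  simp only [syzygyLower]
  split_ifs <;> omega

lemma syzygyUpper_succ_le (ha : Antitone a) (j : ℕ) :
    (syzygyUpper a (j + 1) : Vtx d) ≤ syzygyUpper a j := by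
  intro i
  have := ha (show (i : ℕ) ≤ i + 1 by omega)
  simp only [syzygyUpper]
  split_ifs <;> omega

lemma syzygyLower_le_syzygyUpper (ha : Antitone a) (j : ℕ) :
    (syzygyLower a j : Vtx d) ≤ syzygyUpper a j := by
  intro i
  have := ha (show (i : ℕ) ≤ i + 1 by omega)
  have := ha (show (i : ℕ) + 1 ≤ i + 2 by omega)
  simp only [syzygyLower, syzygyUpper]
  split_ifs <;> omega

lemma syzygyUpper_succ_apply (a : ℕ → ℤ) (j : ℕ) {i i' : Fin d} (h : (i' : ℕ) = i + 1) :
    (syzygyUpper a j : Vtx d) i' = syzygyLower a (j + 1) i := by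
  simp only [syzygyUpper, syzygyLower, h, add_right_comm, add_assoc, Nat.reduceAdd]

lemma syzygyLower_apply_of_add_lt {i : Fin d} {j : ℕ} (h : (i : ℕ) + j < d) :
    syzygyLower a j i = a (i + 1) := if_pos h

lemma syzygyUpper_apply_of_le_add {i : Fin d} {j : ℕ} (h : d ≤ i + j) :
    syzygyUpper a j i = a (i + 1) - 1 := if_neg (by omega)

-- `syzygyLower a j` and `syzygyUpper a j` depend on `j` only through the coordinates `i` with
-- `i + j < d`, so that passing from `j` to `j + 1` changes the single coordinate `d - 1 - j`.
lemma syzygyLower_succ_apply_of_ne {i : Fin d} {j : ℕ} (h : (i : ℕ) + j + 1 ≠ d) :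
    syzygyLower a (j + 1) i = syzygyLower a j i := by
  simp only [syzygyLower]
  split_ifs <;> omega

lemma syzygyUpper_succ_apply_of_ne {i : Fin d} {j : ℕ} (h : (i : ℕ) + j + 1 ≠ d) :
    syzygyUpper a (j + 1) i = syzygyUpper a j i := by
  simp only [syzygyUpper]
  split_ifs <;> omega

lemma not_syzygyLower_le_syzygyUpper_succ {j : ℕ} (hj : j < d) :
    ¬ (syzygyLower a j : Vtx d) ≤ syzygyUpper a (j + 1) := by
  intro h
  have := h ⟨d - 1 - j, by omega⟩
  rw [syzygyLower_apply_of_add_lt (by simp only; omega),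
    syzygyUpper_apply_of_le_add (by simp only; omega)] at this
  exact absurd this (sub_one_lt _).not_ge

lemma le_syzygyUpper_succ {j : ℕ} {x : Vtx d} (hlx : syzygyLower a (j + 1) ≤ x)
    (hxu : x ≤ syzygyUpper a j) (hx : ¬ syzygyLower a j ≤ x) : x ≤ syzygyUpper a (j + 1) := by
  intro i
  by_cases hi : (i : ℕ) + j + 1 = d
  · rw [syzygyUpper_apply_of_le_add (by omega)]
    by_contra hlt
    refine hx fun i' => ?_
    by_cases hi' : (i' : ℕ) + j + 1 = d
    · obtain rfl : i' = i := by ext; omega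
      rw [syzygyLower_apply_of_add_lt (by omega)]
      exact Int.sub_one_lt_iff.1 (not_le.1 hlt)
    · rw [← syzygyLower_succ_apply_of_ne hi']; exact hlx i'
  · rw [syzygyUpper_succ_apply_of_ne hi]; exact hxu i

lemma shift_syzygyUpper_le_upper {mu : Vtx (d + 1)} {j : ℕ} {m : ℤ} (hj : j + 1 < d)
    (hlo : shift p m (syzygyLower a (j + 1)) ≤ lower mu)
    (hhi : shift p m (syzygyUpper a (j + 1)) ≤ upper mu) :
    shift p m (syzygyUpper a j) ≤ upper mu := by
  intro i
  by_cases hi : (i : ℕ) + j + 1 = d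
  · let i' : Fin d := ⟨i - 1, by omega⟩
    have hi' : (i : ℕ) = i' + 1 := by simp only [i']; omega
    have hcast : i.castSucc = i'.succ := Fin.ext hi'
    simpa only [shift, syzygyUpper_succ_apply a j hi', lower, upper, hcast] using hlo i'
  · simpa only [shift, syzygyUpper_succ_apply_of_ne hi] using hhi i

end Syzygies

/-- The non-increasing sequences whose last entry is bounded below by `L` of the first one. -/
def osL (L : ℤ → ℤ) (e : ℕ) [NeZero e] : Set (Vtx e) :=
  {μ | Antitone μ ∧ L (μ 0) ≤ μ (lastIdx e)}

/-- The common features of the higher Nakayama algebras of both types: `L j` is the least index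
of a composition factor of the indecomposable projective module of index `j`, that is
`j - ℓ_j + 1`, so that the sequences in `osL L e` are those of `os_ℓ^{(e)}`. -/
structure IsNakayama (k : Type u) [Field k] [NeZero d] (D : QuotientData d p) (L : ℤ → ℤ) :
    Prop where
  monotone : Monotone L
  periodic : ∀ m j : ℤ, L (j + m * p) = L j + m * p
  bounded : ∃ B : ℤ, ∀ j, j - B ≤ L j
  finite : ∃ F : Finset ℤ, ∀ j, L j ≤ j → ∃ m : ℤ, j + m * p ∈ F
  verts_eq : D.verts = osL L d
  isAdmissible : ∀ lam ∈ osL L (d + 1), IsAdmissible D (lower lam) (upper lam)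
  interlaced : ∀ u v : Vtx d, u ∈ D.verts → v ∈ D.verts → u ≤ v → quotArrow k D u v ≠ 0 →
    (∀ i j : Fin d, (j : ℕ) = i + 1 → v j ≤ u i) ∧ L (v 0) ≤ u (lastIdx d)

variable {L : ℤ → ℤ} {lam mu : Vtx (d + 1)}

lemma lastIdx_succ (e : ℕ) : lastIdx (e + 1) = Fin.last e := Fin.rev_zero e

lemma val_lastIdx (e : ℕ) [NeZero e] : ((lastIdx e : Fin e) : ℕ) + 1 = e := by
  rw [Fin.val_rev, Fin.val_zero]
  exact Nat.sub_add_cancel (NeZero.pos e)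

lemma eq_lastIdx [NeZero d] {i : Fin d} (hi : ¬ (i : ℕ) + 1 < d) : i = lastIdx d := by
  ext
  have := val_lastIdx d
  omega

lemma mem_osL_succ [NeZero d] : lam ∈ osL L (d + 1) ↔
    lower lam ≤ upper lam ∧ L (upper lam 0) ≤ lower lam (lastIdx d) := by
  rw [upper_zero, lower_last]
  exact and_congr Fin.antitone_iff_succ_le Iff.rfl

lemma lower_le_upper (hlam : lam ∈ osL L (d + 1)) : lower lam ≤ upper lam :=
  Fin.antitone_iff_succ_le.1 hlam.1

lemma upper_snoc (x : Vtx d) (c : ℤ) : upper (Fin.snoc (α := fun _ => ℤ) x c) = x := by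
  funext i
  rw [upper, Fin.snoc_castSucc]

lemma lower_snoc_apply_of_lt (x : Vtx d) (c : ℤ) {i : Fin d} (hi : (i : ℕ) + 1 < d) :
    lower (Fin.snoc (α := fun _ => ℤ) x c) i = x ⟨i + 1, hi⟩ := by
  rw [lower, show i.succ = (⟨i + 1, hi⟩ : Fin d).castSucc from rfl, Fin.snoc_castSucc]

lemma lower_snoc_lastIdx [NeZero d] (x : Vtx d) (c : ℤ) :
    lower (Fin.snoc (α := fun _ => ℤ) x c) (lastIdx d) = c := by
  rw [lower_last, lastIdx_succ, Fin.snoc_last]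

section ExtendedSequence

variable (L) in
/-- The entries of a sequence `λ`, followed by `L λ₀ + 1`. The syzygies of the interval module of
`λ` are the interval modules obtained from the extended sequence. -/
def extendedSeq (lam : Vtx (d + 1)) (i : ℕ) : ℤ :=
  if h : i < d + 1 then lam ⟨i, h⟩ else L (lam 0) + 1

lemma extendedSeq_of_lt {i : ℕ} (hi : i < d + 1) : extendedSeq L lam i = lam ⟨i, hi⟩ := dif_pos hi

lemma extendedSeq_of_le {i : ℕ} (hi : d + 1 ≤ i) : extendedSeq L lam i = L (lam 0) + 1 :=
  dif_neg (by omega)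

lemma extendedSeq_antitone (hlam : lam ∈ osL L (d + 1)) (hlast : L (lam 0) < lam (Fin.last d)) :
    Antitone (extendedSeq L lam) := by
  refine antitone_nat_of_succ_le fun i => ?_
  obtain hi | rfl | hi := lt_trichotomy i d
  · rw [extendedSeq_of_lt (by omega), extendedSeq_of_lt (by omega)]
    exact hlam.1 (Fin.mk_le_mk.2 i.le_succ)
  · rw [extendedSeq_of_le le_rfl, extendedSeq_of_lt i.lt_succ_self]
    exact hlast
  · rw [extendedSeq_of_le (by omega), extendedSeq_of_le hi]

lemma syzygyLower_zero (lam : Vtx (d + 1)) :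
    (syzygyLower (extendedSeq L lam) 0 : Vtx d) = lower lam := by
  funext i
  rw [syzygyLower_apply_of_add_lt (by omega), extendedSeq_of_lt (by omega)]
  rfl

lemma syzygyUpper_zero (lam : Vtx (d + 1)) :
    (syzygyUpper (extendedSeq L lam) 0 : Vtx d) = upper lam := by
  funext i
  rw [syzygyUpper, if_pos (by omega), extendedSeq_of_lt (by omega)]
  rfl

variable [NeZero d]

lemma syzygyUpper_apply_zero {j : ℕ} (hj : j < d) :
    (syzygyUpper (extendedSeq L lam) j : Vtx d) 0 = lam 0 := by
  rw [syzygyUpper, if_pos (by simpa using hj), extendedSeq_of_lt (by simp)]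
  rfl

lemma syzygyLower_succ_apply_lastIdx (j : ℕ) :
    (syzygyLower (extendedSeq L lam) (j + 1) : Vtx d) (lastIdx d) = L (lam 0) := by
  have := val_lastIdx d
  rw [syzygyLower, if_neg (by omega), extendedSeq_of_le (by omega), add_sub_cancel_right]

end ExtendedSequence

namespace IsNakayama

variable [NeZero d] (H : IsNakayama k D L)

include H in
lemma isAdmissible_of_interlaced (hlace : ∀ i j : Fin d, (j : ℕ) = i + 1 → hi j ≤ lo i)
    (hlast : L (hi 0) ≤ lo (lastIdx d)) (hlh : lo ≤ hi) : IsAdmissible D lo hi := by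
  have hlower : lower (Fin.snoc (α := fun _ => ℤ) hi (lo (lastIdx d))) ≤ lo := by
    intro i
    by_cases hi' : (i : ℕ) + 1 < d
    · rw [lower_snoc_apply_of_lt _ _ hi']
      exact hlace i _ rfl
    · obtain rfl := eq_lastIdx hi'
      rw [lower_snoc_lastIdx]
  refine (H.isAdmissible _ (mem_osL_succ.2 ⟨?_, ?_⟩)).mono hlower (upper_snoc _ _).ge
  · exact (hlower.trans hlh).trans_eq (upper_snoc _ _).symm
  · rwa [upper_snoc, lower_snoc_lastIdx]

include H in
lemma quotArrow_eq_zero_of_not_le (hlace : ∀ i j : Fin d, (j : ℕ) = i + 1 → lo i ≤ hi j)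
    (hlast : lo (lastIdx d) ≤ L (hi 0)) {y : Vtx d} (hyh : y ≤ hi) (hy : ¬ lo ≤ y) :
    quotArrow k D y hi = 0 := by
  by_contra h₀
  have hyv : y ∈ D.verts := by
    by_contra hyv; exact h₀ (quotArrow_eq_zero_of_notMem_left hyh hyv)
  have hhv : hi ∈ D.verts := by
    by_contra hhv; exact h₀ (quotArrow_eq_zero_of_notMem_right hyh hhv)
  obtain ⟨hlace', hlast'⟩ := H.interlaced y hi hyv hhv hyh h₀
  refine hy fun i => ?_
  by_cases hi' : (i : ℕ) + 1 < d
  · exact (hlace i ⟨i + 1, hi'⟩ rfl).trans (hlace' i _ rfl)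
  · rw [eq_lastIdx hi']; exact hlast.trans hlast'

/-- The interval module `M_λ`. -/
abbrev obj (lam : osL L (d + 1)) : ModuleCat.{u} (QuotAlg k D) :=
  intervalObj k (H.isAdmissible lam.1 lam.2)

section Resolution

variable (hlam : lam ∈ osL L (d + 1)) (hlast : L (lam 0) < lam (Fin.last d))

include H hlam hlast

lemma isAdmissible_cover {j : ℕ} (hj : j < d) :
    IsAdmissible D (syzygyLower (extendedSeq L lam) (j + 1))
      (syzygyUpper (extendedSeq L lam) j) := by
  have ha := extendedSeq_antitone hlam hlast
  refine H.isAdmissible_of_interlaced (fun i i' hii => (syzygyUpper_succ_apply _ j hii).le) ?_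
    ((syzygyLower_succ_le ha j).trans (syzygyLower_le_syzygyUpper ha j))
  rw [syzygyUpper_apply_zero hj, syzygyLower_succ_apply_lastIdx]

lemma isAdmissible_syzygy {j : ℕ} (hj : j ≤ d) :
    IsAdmissible D (syzygyLower (extendedSeq L lam) j) (syzygyUpper (extendedSeq L lam) j) := by
  have ha := extendedSeq_antitone hlam hlast
  cases j with
  | zero =>
    exact (H.isAdmissible_cover hlam hlast (NeZero.pos d)).mono (syzygyLower_succ_le ha 0) le_rfl
  | succ j => exact (H.isAdmissible_cover hlam hlast hj).mono le_rfl (syzygyUpper_succ_le ha j)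

lemma projective_cover {j : ℕ} (hj : j < d) :
    Projective (intervalObj k (H.isAdmissible_cover hlam hlast hj)) := by
  refine projective_intervalObj _ fun y hyh hly =>
    H.quotArrow_eq_zero_of_not_le (fun i i' hii => (syzygyUpper_succ_apply _ j hii).ge) ?_ hyh hly
  rw [syzygyUpper_apply_zero hj, syzygyLower_succ_apply_lastIdx]

/-- The complex that cuts the `j`-th syzygy of an interval module `M_λ` from a projective interval
module, with the next syzygy as kernel. -/
abbrev syzygyComplex {j : ℕ} (hj : j < d) : ShortComplex (ModuleCat.{u} (QuotAlg k D)) :=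
  cutComplex k (H.isAdmissible_cover hlam hlast hj)
    (H.isAdmissible_syzygy hlam hlast (Nat.succ_le_of_lt hj))
    (H.isAdmissible_syzygy hlam hlast hj.le)
    (syzygyLower_succ_le (extendedSeq_antitone hlam hlast) j)
    (syzygyUpper_succ_le (extendedSeq_antitone hlam hlast) j)
    (not_syzygyLower_le_syzygyUpper_succ hj)

lemma shortExact_syzygyComplex {j : ℕ} (hj : j < d) :
    (H.syzygyComplex hlam hlast hj).ShortExact :=
  shortExact_cutComplex _ _ _ _ _ _ fun _ hlx hxh hx => le_syzygyUpper_succ hlx hxh hx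

lemma exists_syzygyComplex_f_comp_eq {j : ℕ} (hj : j + 1 < d)
    {h : IsAdmissible D (lower mu) (upper mu)}
    (φ : (H.syzygyComplex hlam hlast (Nat.lt_of_succ_lt hj)).X₁ ⟶ intervalObj k h) :
    ∃ ψ, (H.syzygyComplex hlam hlast (Nat.lt_of_succ_lt hj)).f ≫ ψ = φ := by
  suffices hφ : ∃ ψ : _ →ₗ[QuotAlg k D] IntervalModule k h,
      ψ.comp (H.syzygyComplex hlam hlast (Nat.lt_of_succ_lt hj)).f.hom = φ.hom from
    hφ.imp' ModuleCat.ofHom fun _ hψ => ModuleCat.hom_ext hψ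
  refine AddSubmonoid.closure_induction (motive := fun φ _ => ∃ ψ : _ →ₗ[QuotAlg k D]
    IntervalModule k h, ψ.comp (H.syzygyComplex hlam hlast (Nat.lt_of_succ_lt hj)).f.hom = φ)
    ?_ ⟨0, LinearMap.zero_comp _⟩ ?_ (hom_mem_closure_transfer φ.hom)
  · rintro _ ⟨c, m, hlo, hhi, -, rfl⟩
    exact ⟨transfer _ _ c m hlo (shift_syzygyUpper_le_upper hj hlo hhi),
      transfer_comp_canMap c m le_rfl (syzygyUpper_succ_le (extendedSeq_antitone hlam hlast) j) _ _⟩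
  · rintro _ _ - - ⟨ψ, rfl⟩ ⟨ψ', rfl⟩
    exact ⟨ψ + ψ', LinearMap.add_comp _ _ _⟩

lemma subsingleton_ext_syzygy (h : IsAdmissible D (lower mu) (upper mu)) (i j : ℕ)
    (hij : i + 1 + j < d) :
    Subsingleton (Ext (intervalObj k (H.isAdmissible_syzygy hlam hlast (j := j) (by omega)))
      (intervalObj k h) (i + 1)) := by
  have hj : j < d := by omega
  have hS := H.shortExact_syzygyComplex hlam hlast hj
  have hP : Projective (H.syzygyComplex hlam hlast hj).X₂ := H.projective_cover hlam hlast hj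
  induction i generalizing j with
  | zero =>
    exact subsingleton_ext_one_of_extends hS hP
      (H.exists_syzygyComplex_f_comp_eq hlam hlast (by omega))
  | succ i ih =>
    have hj' : j + 1 < d := by omega
    exact subsingleton_ext_succ_of_projective hS hP (ih (j + 1) (by omega) hj'
      (H.shortExact_syzygyComplex hlam hlast hj') (H.projective_cover hlam hlast hj'))

end Resolution

theorem subsingleton_ext_obj (lam mu : osL L (d + 1)) {i : ℕ} (hi₁ : 1 ≤ i) (hi : i < d) :
    Subsingleton (Ext (H.obj lam) (H.obj mu) i) := by
  obtain ⟨lam, hlam⟩ := lam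
  obtain ⟨i, rfl⟩ := Nat.exists_eq_add_of_le' hi₁
  by_cases hlast : L (lam 0) < lam (Fin.last d)
  · have hzero := H.subsingleton_ext_syzygy hlam hlast (H.isAdmissible mu.1 mu.2) i 0 hi
    rwa [intervalObj_congr (syzygyLower_zero lam) (syzygyUpper_zero lam)] at hzero
  · have hP : Projective (H.obj ⟨lam, hlam⟩) := by
      refine projective_intervalObj _ fun y hyh hly =>
        H.quotArrow_eq_zero_of_not_le (fun i i' hii => ?_) ?_ hyh hly
      · exact (congrArg lam (Fin.ext hii.symm)).le
      · rw [lower_last, lastIdx_succ, upper_zero]; exact not_lt.1 hlast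
    exact HasProjectiveDimensionLT.subsingleton _ 1 (i + 1) (by omega) _

end IsNakayama

end Rigid

section Total

variable {k : Type u} [Field k] {d p : ℕ} [NeZero d] {D : QuotientData d p} {L : ℤ → ℤ}

variable (p L) in
/-- Two sequences are equivalent if they are translates of each other by a multiple of the
period. -/
def orbitSetoid (e : ℕ) [NeZero e] : Setoid (osL L e) where
  r μ ν := SameOrbit p μ.1 ν.1
  iseqv := ⟨fun _ => .refl _, .symm, .trans⟩

variable (p L) in
/-- The orbits of `osL L e` under translation by multiples of the period. -/
abbrev Orbits (e : ℕ) [NeZero e] : Type := Quotient (orbitSetoid p L e)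

namespace IsNakayama

variable (H : IsNakayama k D L)

section Finiteness

include H

lemma shift_mem_osL {e : ℕ} [NeZero e] {μ : Vtx e} (hμ : μ ∈ osL L e) (m : ℤ) :
    shift p m μ ∈ osL L e := by
  refine ⟨fun i j hij => add_le_add_left (hμ.1 hij) _, ?_⟩
  simpa only [shift, H.periodic] using add_le_add_left hμ.2 (m * p)

lemma exists_finset_shift_mem (e : ℕ) [NeZero e] :
    ∃ F : Finset (Vtx e), ∀ μ ∈ osL L e, ∃ m, shift p m μ ∈ F := by
  classical
  obtain ⟨B, hB⟩ := H.bounded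
  obtain ⟨F, hF⟩ := H.finite
  refine ⟨F.biUnion fun j => Finset.Icc (fun _ => j - B) (fun _ => j), fun μ hμ => ?_⟩
  obtain ⟨m, hm⟩ := hF (μ 0) (hμ.2.trans (last_le_of_os hμ.1 0))
  refine ⟨m, Finset.mem_biUnion.2 ⟨_, hm, Finset.mem_Icc.2 ⟨fun i => ?_, fun i => ?_⟩⟩⟩
  · calc μ 0 + m * p - B = μ 0 - B + m * p := by ring
      _ ≤ μ i + m * p := add_le_add_left (((hB _).trans hμ.2).trans (last_le_of_os hμ.1 i)) _
  · exact add_le_add_left (le_zero_of_os hμ.1 i) _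

lemma exists_forall_le_of_quotArrow_ne_zero (u : Vtx d) :
    ∃ w : Vtx d, ∀ v, u ≤ v → quotArrow k D u v ≠ 0 → v ≤ w := by
  obtain ⟨B, hB⟩ := H.bounded
  refine ⟨fun _ => u (lastIdx d) + B, fun v huv hv i => ?_⟩
  have hu : u ∈ D.verts := by
    by_contra hu; exact hv (quotArrow_eq_zero_of_notMem_left huv hu)
  have hv' : v ∈ D.verts := by
    by_contra hv'; exact hv (quotArrow_eq_zero_of_notMem_right huv hv')
  have hlast := (H.interlaced u v hu hv' huv hv).2
  rw [H.verts_eq] at hv'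
  exact (le_zero_of_os hv'.1 i).trans (sub_le_iff_le_add.1 ((hB (v 0)).trans hlast))

theorem finite_quotAlg : Module.Finite k (QuotAlg k D) := by
  classical
  obtain ⟨F, hF⟩ := H.exists_finset_shift_mem d
  choose w hw using H.exists_forall_le_of_quotArrow_ne_zero
  let T : Finset (QuotAlg k D) := F.biUnion fun u => (Finset.Icc u (w u)).image (quotArrow k D u)
  refine ⟨⟨T, eq_top_iff.2 fun a _ => ?_⟩⟩
  induction a using quotAlg_induction with
  | zero => exact Submodule.zero_mem _
  | add a b iha ihb => exact Submodule.add_mem _ (iha trivial) (ihb trivial)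
  | arrow c u v huv =>
    rw [← Algebra.smul_def]
    refine Submodule.smul_mem _ _ ?_
    by_cases h₀ : quotArrow k D u v = 0
    · rw [h₀]; exact Submodule.zero_mem _
    have hu : u ∈ D.verts := by
      by_contra hu; exact h₀ (quotArrow_eq_zero_of_notMem_left huv hu)
    obtain ⟨m, hm⟩ := hF u (H.verts_eq ▸ hu)
    have huv' := (shift_le_shift p m).2 huv
    rw [← quotArrow_shift m] at h₀ ⊢
    exact Submodule.subset_span (Finset.mem_coe.2 (Finset.mem_biUnion.2 ⟨_, hm,
      Finset.mem_image.2 ⟨_, Finset.mem_Icc.2 ⟨huv', hw _ _ huv' h₀⟩, rfl⟩⟩))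

lemma finite_orbits (e : ℕ) [NeZero e] : Finite (Orbits p L e) := by
  obtain ⟨F, hF⟩ := H.exists_finset_shift_mem e
  have : Finite {μ : osL L e // μ.1 ∈ F} :=
    .of_injective (fun μ => (⟨μ.1.1, μ.2⟩ : F)) fun _ _ hab =>
      Subtype.ext (Subtype.ext (congrArg (fun x : F => x.1) hab))
  refine .of_surjective
    (fun μ : {μ : osL L e // μ.1 ∈ F} => Quotient.mk (orbitSetoid p L e) μ.1) fun o => ?_
  induction o using Quotient.inductionOn with
  | _ μ =>
    obtain ⟨m, hm⟩ := hF μ.1 μ.2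
    exact ⟨⟨⟨_, H.shift_mem_osL μ.2 m⟩, hm⟩, Quotient.sound ⟨m, rfl⟩⟩

end Finiteness

/-- The direct sum of the interval modules, one from each orbit: the candidate for the
`d`-cluster-tilting module. -/
abbrev total : ModuleCat.{u} (QuotAlg k D) :=
  piObj fun o : Orbits p L (d + 1) => H.obj o.out

/-- The inclusion of an interval module into `total`. -/
abbrev incl (o : Orbits p L (d + 1)) : H.obj o.out ⟶ H.total :=
  piSingle (fun o : Orbits p L (d + 1) => H.obj o.out) o

/-- The projection of `total` onto an interval module. -/
abbrev proj (o : Orbits p L (d + 1)) : H.total ⟶ H.obj o.out :=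
  piProj (fun o : Orbits p L (d + 1) => H.obj o.out) o

lemma finite_total : Module.Finite (QuotAlg k D) H.total :=
  have := H.finite_orbits (d + 1)
  Module.Finite.pi

lemma nonempty_iso_of_sameOrbit {lam mu : osL L (d + 1)} (h : SameOrbit p lam.1 mu.1) :
    Nonempty (H.obj lam ≅ H.obj mu) := by
  obtain ⟨lam, hlam⟩ := lam
  obtain ⟨mu, hmu⟩ := mu
  obtain ⟨m, rfl : lam = shift p m mu⟩ := h
  exact ⟨(shiftIso (m := m) _ _ rfl rfl).symm⟩

lemma isSummand_obj (lam : osL L (d + 1)) : IsSummand (H.obj lam) H.total := by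
  let o : Orbits p L (d + 1) := Quotient.mk _ lam
  obtain ⟨e⟩ := H.nonempty_iso_of_sameOrbit (Quotient.exact (Quotient.out_eq o).symm)
  exact ⟨(Retract.ofIso e).trans ⟨H.incl o, H.proj o, piSingle_comp_piProj_self _ o⟩⟩

lemma inAdd_obj (lam : osL L (d + 1)) : InAdd H.total (H.obj lam) :=
  have ⟨R⟩ := H.isSummand_obj lam
  (InAdd.refl _).of_retract R

include H in
lemma exists_upper_eq {x : Vtx d} (hx : x ∈ D.verts) :
    ∃ lam : osL L (d + 1), upper lam.1 = x ∧
      ∀ y, y ≤ x → ¬ lower lam.1 ≤ y → quotArrow k D y x = 0 := by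
  rw [H.verts_eq] at hx
  have hlower : ∀ i j : Fin d, (j : ℕ) = i + 1 →
      lower (Fin.snoc (α := fun _ => ℤ) x (L (x 0))) i = x j := fun i j hij => by
    rw [lower_snoc_apply_of_lt _ _ (hij ▸ j.2)]
    exact congrArg x (Fin.ext hij.symm)
  have hlast := lower_snoc_lastIdx x (L (x 0))
  refine ⟨⟨Fin.snoc (α := fun _ => ℤ) x (L (x 0)), mem_osL_succ.2 ⟨fun i => ?_, ?_⟩⟩,
    upper_snoc _ _, fun y hyx hy => H.quotArrow_eq_zero_of_not_le
      (fun i j hij => (hlower i j hij).le) hlast.le hyx hy⟩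
  · rw [upper_snoc]
    by_cases hi : (i : ℕ) + 1 < d
    · exact (hlower i ⟨i + 1, hi⟩ rfl).trans_le (hx.1 (Fin.mk_le_mk.2 (Nat.le_succ i)))
    · obtain rfl := eq_lastIdx hi
      exact hlast.trans_le hx.2
  · rw [upper_snoc, hlast]

include H in
lemma exists_isGreatest_le (x : ℤ) (hx : ∃ j, L j ≤ x) : ∃ r, L r ≤ x ∧ ∀ j, L j ≤ x → j ≤ r := by
  obtain ⟨B, hB⟩ := H.bounded
  exact Int.exists_greatest_of_bdd ⟨x + B, fun j hj => sub_le_iff_le_add.1 ((hB j).trans hj)⟩ hx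

include H in
lemma exists_lower_eq {x : Vtx d} (hx : x ∈ D.verts) :
    ∃ lam : osL L (d + 1), lower lam.1 = x ∧
      ∀ y, x ≤ y → ¬ y ≤ upper lam.1 → quotArrow k D x y = 0 := by
  have hxL := H.verts_eq ▸ hx
  obtain ⟨r, hrx, hr⟩ := H.exists_isGreatest_le (x (lastIdx d)) ⟨x 0, hxL.2⟩
  have hlower : lower (Fin.cons (α := fun _ => ℤ) r x) = x := funext fun i => by
    rw [lower, Fin.cons_succ]
  have hzero : upper (Fin.cons (α := fun _ => ℤ) r x) 0 = r := by rw [upper_zero, Fin.cons_zero]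
  have hupper : ∀ i j : Fin d, (j : ℕ) = i + 1 →
      upper (Fin.cons (α := fun _ => ℤ) r x) j = x i := fun i j hij => by
    rw [upper, show j.castSucc = i.succ from Fin.ext hij, Fin.cons_succ]
  refine ⟨⟨Fin.cons (α := fun _ => ℤ) r x, mem_osL_succ.2 ⟨?_, ?_⟩⟩, hlower, fun y hxy hy => ?_⟩
  · rw [hlower]
    intro j
    obtain rfl | hj := eq_or_ne j 0
    · exact (hr _ hxL.2).trans_eq hzero.symm
    · have hpred : (j : ℕ) = (j : ℕ) - 1 + 1 := (Nat.succ_pred (Fin.val_ne_zero_iff.2 hj)).symm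
      exact (hxL.1 (Fin.mk_le_of_le_val (Nat.pred_le _))).trans_eq
        (hupper ⟨j - 1, by omega⟩ j hpred).symm
  · rwa [hlower, hzero]
  by_contra h₀
  have hyv : y ∈ D.verts := by
    by_contra hyv; exact h₀ (quotArrow_eq_zero_of_notMem_right hxy hyv)
  obtain ⟨hlace, hlast⟩ := H.interlaced x y hx hyv hxy h₀
  refine hy fun j => ?_
  obtain rfl | hj := eq_or_ne j 0
  · exact (hr _ hlast).trans_eq hzero.symm
  · have hpred : (j : ℕ) = (j : ℕ) - 1 + 1 := (Nat.succ_pred (Fin.val_ne_zero_iff.2 hj)).symm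
    exact (hlace ⟨j - 1, by omega⟩ j hpred).trans_eq (hupper ⟨j - 1, by omega⟩ j hpred).symm

theorem isSeparator_total : IsSeparator H.total := by
  rw [Preadditive.isSeparator_iff]
  intro X Y f hf
  refine ModuleCat.hom_ext (LinearMap.ext fun v =>
    eq_zero_of_forall_quotArrow_self_smul_eq_zero (k := k) (D := D) fun x hx => ?_)
  obtain ⟨lam, rfl, hzero⟩ := H.exists_upper_eq hx
  have hv : ∀ y, y ≤ upper lam.1 → ¬ lower lam.1 ≤ y → quotArrow k D y (upper lam.1) • v = 0 :=
    fun y hyx hy => by rw [hzero y hyx hy, zero_smul]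
  let φ : H.obj lam ⟶ X := ModuleCat.ofHom (intervalHom (H.isAdmissible lam.1 lam.2) v hv)
  obtain ⟨R⟩ := H.isSummand_obj lam
  have hφ : φ ≫ f = 0 := calc
    φ ≫ f = R.i ≫ (R.r ≫ φ) ≫ f := by simp only [Category.assoc, R.retract_assoc]
    _ = 0 := by rw [hf, comp_zero]
  calc quotArrow k D (upper lam.1) (upper lam.1) • f.hom v
      = (φ ≫ f).hom (basisVec (H.isAdmissible lam.1 lam.2) (upper lam.1)) := by
        exact (f.hom.map_smul _ v).symm.trans
          (congrArg f.hom (intervalHom_basisVec_top _ _ hv).symm)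
    _ = 0 := by rw [hφ]; rfl

lemma exists_linearMap_obj_coeff_eq {X : Type*} [AddCommGroup X] [Module (QuotAlg k D) X]
    (φ : X →+ k) (hφ : ∀ (c : k) v, φ (algebraMap k (QuotAlg k D) c • v) = c * φ v) {x : Vtx d}
    (hx : x ∈ D.verts) : ∃ (lam : osL L (d + 1)) (f : X →ₗ[QuotAlg k D] H.obj lam),
      ∀ v, coeff (show IntervalModule k (H.isAdmissible lam.1 lam.2) from f v) x =
        φ (quotArrow k D x x • v) := by
  obtain ⟨lam, rfl, hzero⟩ := H.exists_lower_eq hx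
  exact ⟨lam, intervalCohom φ hφ hzero _,
    fun v => coeff_intervalCohom _ _ _ v ⟨le_rfl, lower_le_upper lam.2⟩⟩

theorem cogenerates_total : Cogenerates H.total := by
  intro X _
  have := H.finite_quotAlg
  let : Module k X := Module.restrictScalars k (QuotAlg k D) X
  have : IsScalarTower k (QuotAlg k D) X := IsScalarTower.restrictScalars k (QuotAlg k D) X
  have : Module.Finite k X := Module.Finite.trans (QuotAlg k D) X
  let b := Module.finBasis k X
  obtain ⟨F, hF⟩ := H.exists_finset_shift_mem d
  let ι := {x : F // x.1 ∈ D.verts} × Fin (Module.finrank k X)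
  choose lam f hf using fun t : ι => H.exists_linearMap_obj_coeff_eq (b.coord t.2).toAddMonoidHom
    (fun c v => by
      change b.coord t.2 (algebraMap k (QuotAlg k D) c • v) = _
      rw [algebraMap_smul, map_smul, smul_eq_mul]; rfl) t.1.2
  refine ⟨ModuleCat.of _ (∀ t, H.obj (lam t)), ModuleCat.ofHom (LinearMap.pi f),
    InAdd.pi fun t => H.inAdd_obj (lam t), (ModuleCat.mono_iff_injective _).2
      ((injective_iff_map_eq_zero (LinearMap.pi f)).2 fun v hv =>
        eq_zero_of_forall_quotArrow_self_smul_eq_zero (k := k) (D := D) fun x hx => ?_)⟩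
  obtain ⟨m, hm⟩ := hF x (H.verts_eq ▸ hx)
  rw [← quotArrow_shift m]
  refine b.ext_elem fun i => ?_
  let t : ι := (⟨⟨_, hm⟩, D.verts_shift m x hx⟩, i)
  have hft : f t v = 0 := congrFun hv t
  calc b.repr (quotArrow k D (shift p m x) (shift p m x) • v) i
      = coeff (show IntervalModule k (H.isAdmissible _ (lam t).2) from f t v) (shift p m x) :=
        (hf t v).symm
    _ = b.repr 0 i := by rw [hft, map_zero]; exact coeff_zero _

end IsNakayama

end Total

section Quotient

variable {R : Type u} [Ring R] {A B : Type u} [AddCommGroup A] [AddCommGroup B] [Module R A]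
  [Module R B]

/-- The complex `A / f⁻¹(V) ⟶ B / V ⟶ B / (V + f(A))` given by a linear map `f : A → B` and a
submodule `V` of `B`. -/
abbrev quotientComplex (f : A →ₗ[R] B) (V : Submodule R B) : ShortComplex (ModuleCat.{u} R) :=
  ModuleCat.shortComplexOfCompEqZero ((V.comap f).mapQ V f le_rfl)
    (Submodule.factor (le_sup_left : V ≤ V ⊔ LinearMap.range f)) <|
      Submodule.linearMap_qext _ <| LinearMap.ext fun a =>
        (Submodule.Quotient.mk_eq_zero _).2 (Submodule.mem_sup_right ⟨a, rfl⟩)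

lemma shortExact_quotientComplex (f : A →ₗ[R] B) (V : Submodule R B) :
    (quotientComplex f V).ShortExact := by
  refine ModuleCat.shortComplex_shortExact _ (LinearMap.exact_iff.2 ?_)
    (LinearMap.ker_eq_bot.1 ?_) (Submodule.factor_surjective le_sup_left)
  · change LinearMap.ker (Submodule.factor (le_sup_left : V ≤ V ⊔ LinearMap.range f)) =
      LinearMap.range ((V.comap f).mapQ V f le_rfl)
    rw [Submodule.factor, Submodule.ker_mapQ, Submodule.range_mapQ, Submodule.comap_id,
      Submodule.map_sup, Submodule.mkQ_map_self, bot_sup_eq]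
  · exact (Submodule.ker_mapQ _ _ f le_rfl).trans (Submodule.mkQ_map_self _)

end Quotient

section LowerEntry

variable {d : ℕ}

/-- The sequence obtained from `ν` by lowering the entry of index `j` by one. -/
def lowerEntry (ν : Vtx (d + 1)) (j : Fin (d + 1)) : Vtx (d + 1) := Function.update ν j (ν j - 1)

lemma lowerEntry_le (ν : Vtx (d + 1)) (j : Fin (d + 1)) : lowerEntry ν j ≤ ν :=
  update_le_self_iff.2 (sub_one_lt _).le

lemma lowerEntry_self (ν : Vtx (d + 1)) (j : Fin (d + 1)) : lowerEntry ν j j = ν j - 1 :=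
  Function.update_self ..

lemma lowerEntry_of_ne (ν : Vtx (d + 1)) {i j : Fin (d + 1)} (h : i ≠ j) :
    lowerEntry ν j i = ν i :=
  Function.update_of_ne h ..

lemma le_lowerEntry {κ ν : Vtx (d + 1)} (hle : κ ≤ ν) {j : Fin (d + 1)} (hj : κ j ≠ ν j) :
    κ ≤ lowerEntry ν j :=
  le_update_iff.2 ⟨Int.le_sub_one_of_lt ((hle j).lt_of_ne hj), fun i _ => hle i⟩

lemma lower_mono {κ ν : Vtx (d + 1)} (h : κ ≤ ν) : lower κ ≤ lower ν := fun i => h i.succ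

lemma upper_mono {κ ν : Vtx (d + 1)} (h : κ ≤ ν) : upper κ ≤ upper ν := fun i => h i.castSucc

end LowerEntry

namespace IsNakayama

variable {k : Type u} [Field k] {d p : ℕ} [NeZero d] {D : QuotientData d p} {L : ℤ → ℤ}
  (H : IsNakayama k D L)

section CanonicalHom

variable {lam κ μ ν : osL L (d + 1)}

variable (κ ν) in
/-- The canonical map between the interval modules of comparable sequences. -/
def canHom (h : κ.1 ≤ ν.1) : H.obj κ ⟶ H.obj ν :=
  ModuleCat.ofHom (canMap (H.isAdmissible κ.1 κ.2) (H.isAdmissible ν.1 ν.2) (lower_mono h)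
    (upper_mono h))

lemma canHom_comp_canHom (h : κ.1 ≤ μ.1) (h' : μ.1 ≤ ν.1) :
    H.canHom κ μ h ≫ H.canHom μ ν h' = H.canHom κ ν (h.trans h') :=
  congrArg ModuleCat.ofHom (canMap_comp_canMap (lower_mono h) (upper_mono h) (lower_mono h')
    (upper_mono h'))

lemma canHom_self (ν : osL L (d + 1)) : H.canHom ν ν le_rfl = 𝟙 _ :=
  congrArg ModuleCat.ofHom (transfer_one_zero (shift_zero_le le_rfl) (shift_zero_le le_rfl))

/-- The coefficient of the image of the generator `b_x` of an interval module, `x = upper lam`, at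
the translate of `x` by `m` periods. A map between interval modules is determined by these
coefficients. -/
def topCoeff (m : ℤ) : (H.obj lam ⟶ H.obj ν) →+ k where
  toFun g := coeff (h := H.isAdmissible ν.1 ν.2)
    (g.hom (basisVec (H.isAdmissible lam.1 lam.2) (upper lam.1))) (shift p m (upper lam.1))
  map_zero' := coeff_zero _
  map_add' _ _ := coeff_add _ _ _

variable {g : H.obj lam ⟶ H.obj ν} {m : ℤ}

lemma lower_le_of_topCoeff_ne_zero (hg : H.topCoeff m g ≠ 0) :
    lower ν.1 ≤ shift p m (upper lam.1) :=
  (mem_of_coeff_ne_zero (h := H.isAdmissible ν.1 ν.2) hg).1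

lemma shift_le_of_topCoeff_ne_zero (hg : H.topCoeff m g ≠ 0) : shift p m lam.1 ≤ ν.1 := by
  intro i
  cases i using Fin.lastCases with
  | cast i => exact (mem_of_coeff_ne_zero (h := H.isAdmissible ν.1 ν.2) hg).2 i
  | last =>
    have hlower := shift_lower_le_of_coeff_hom_ne_zero (h := H.isAdmissible lam.1 lam.2)
      (h' := H.isAdmissible ν.1 ν.2) g.hom hg (lastIdx d)
    simpa only [shift, lower_last, lastIdx_succ] using hlower

open Classical in
lemma topCoeff_comp_canHom (g : H.obj lam ⟶ H.obj μ) (h : μ.1 ≤ ν.1) (m : ℤ) :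
    H.topCoeff m (g ≫ H.canHom μ ν h) =
      if lower ν.1 ≤ shift p m (upper lam.1) then H.topCoeff m g else 0 := by
  refine (coeff_canMap (h' := H.isAdmissible ν.1 ν.2) (lower_mono h) (upper_mono h) _ _).trans ?_
  change (if _ then H.topCoeff m g else 0) = _
  by_cases hg : H.topCoeff m g = 0
  · rw [hg, ite_self, ite_self]
  · exact if_congr (and_iff_left
      (upper_mono ((H.shift_le_of_topCoeff_ne_zero hg).trans h))) rfl rfl

end CanonicalHom

section Lowering

include H in
lemma lowerEntry_mem_osL {κ ν : Vtx (d + 1)} (hκ : κ ∈ osL L (d + 1)) (hν : ν ∈ osL L (d + 1))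
    (hlace : lower ν ≤ upper κ) {j : Fin (d + 1)} (hle : κ ≤ lowerEntry ν j)
    (heq : ∀ i < j, κ i = ν i) : lowerEntry ν j ∈ osL L (d + 1) := by
  have hle' := lowerEntry_le ν j
  refine ⟨Fin.antitone_iff_succ_le.2 fun i => ?_, ?_⟩
  · by_cases h : i.castSucc = j
    · exact ((hle' i.succ).trans (hlace i)).trans (hle i.castSucc)
    · rw [lowerEntry_of_ne ν h]
      exact (hle' i.succ).trans (hν.1 Fin.castSucc_lt_succ.le)
  · by_cases h : j = lastIdx (d + 1)
    · have h₀ : 0 < j := by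
        rw [h, lastIdx_succ]; exact Fin.pos_iff_ne_zero.2 (Fin.last_pos'.ne')
      rw [lowerEntry_of_ne ν h₀.ne, ← heq 0 h₀]
      exact hκ.2.trans (hle _)
    · rw [lowerEntry_of_ne ν (Ne.symm h)]
      exact (H.monotone (hle' 0)).trans hν.2

include H in
lemma exists_le_lowerEntry {κ ν : Vtx (d + 1)} (hκ : κ ∈ osL L (d + 1)) (hν : ν ∈ osL L (d + 1))
    (hle : κ ≤ ν) (hlace : lower ν ≤ upper κ) {i : Fin (d + 1)} (hi : κ i ≠ ν i) :
    ∃ j ≤ i, lowerEntry ν j ∈ osL L (d + 1) ∧ κ ≤ lowerEntry ν j := by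
  obtain ⟨j, hj, hmin⟩ := wellFounded_lt.has_min {j | κ j ≠ ν j} ⟨i, hi⟩
  have hκj := le_lowerEntry hle hj
  exact ⟨j, not_lt.1 (hmin i hi),
    H.lowerEntry_mem_osL hκ hν hlace hκj fun i hij => not_not.1 fun h => hmin i h hij, hκj⟩

/-- The maps from `H.total` to an interval module that factor through the interval modules of the
sequences obtained by lowering one of the first `t` entries. As `t` grows, this is a filtration of
the radical of the projective module `Hom(H.total, H.obj ν)`. -/
def lowering (ν : osL L (d + 1)) (t : ℕ) :
    Submodule (End H.total)ᵐᵒᵖ ((homFunctor H.total).obj (H.obj ν)) :=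
  ⨆ j : {j : Fin (d + 1) // (j : ℕ) < t ∧ lowerEntry ν.1 j ∈ osL L (d + 1)},
    LinearMap.range
      ((homFunctor H.total).map (H.canHom ⟨lowerEntry ν.1 j, j.2.2⟩ ν (lowerEntry_le _ _))).hom

variable {ν : osL L (d + 1)} {t : ℕ}

lemma lowering_le_iff {P : Submodule (End H.total)ᵐᵒᵖ ((homFunctor H.total).obj (H.obj ν))} :
    H.lowering ν t ≤ P ↔ ∀ (j : Fin (d + 1)) (_ : (j : ℕ) < t)
      (hj : lowerEntry ν.1 j ∈ osL L (d + 1)), LinearMap.range ((homFunctor H.total).map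
        (H.canHom ⟨lowerEntry ν.1 j, hj⟩ ν (lowerEntry_le _ _))).hom ≤ P :=
  iSup_le_iff.trans ⟨fun h j hjt hj => h ⟨j, hjt, hj⟩, fun h j => h j j.2.1 j.2.2⟩

variable {j : Fin (d + 1)} (hj : lowerEntry ν.1 j ∈ osL L (d + 1))

lemma range_le_lowering (hjt : (j : ℕ) < t) : LinearMap.range ((homFunctor H.total).map
      (H.canHom ⟨lowerEntry ν.1 j, hj⟩ ν (lowerEntry_le _ _))).hom ≤ H.lowering ν t :=
  H.lowering_le_iff.1 le_rfl j hjt hj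

lemma comp_canHom_mem_lowering (hjt : (j : ℕ) < t)
    (f : H.total ⟶ H.obj ⟨lowerEntry ν.1 j, hj⟩) :
    (f ≫ H.canHom _ ν (lowerEntry_le _ _) : H.total ⟶ H.obj ν) ∈ H.lowering ν t :=
  H.range_le_lowering hj hjt ⟨f, rfl⟩

lemma lowering_mono {s : ℕ} (hst : s ≤ t) : H.lowering ν s ≤ H.lowering ν t :=
  H.lowering_le_iff.2 fun _ hjs hj => H.range_le_lowering hj (hjs.trans_le hst)

variable (ν) in
lemma lowering_zero : H.lowering ν 0 = ⊥ :=
  eq_bot_iff.2 (H.lowering_le_iff.2 fun _ hj => absurd hj (Nat.not_lt_zero _))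

lemma lowering_succ_of_mem : H.lowering ν (j + 1) = H.lowering ν j ⊔
    LinearMap.range ((homFunctor H.total).map
      (H.canHom ⟨lowerEntry ν.1 j, hj⟩ ν (lowerEntry_le _ _))).hom := by
  refine le_antisymm (H.lowering_le_iff.2 fun i hi hi' => ?_)
    (sup_le (H.lowering_mono (Nat.le_succ _)) (H.range_le_lowering hj (Nat.lt_succ_self _)))
  obtain hij | hij := Nat.lt_succ_iff_lt_or_eq.1 hi
  · exact le_sup_of_le_left (H.range_le_lowering hi' hij)
  · obtain rfl := Fin.ext hij
    exact le_sup_right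

lemma lowering_succ_of_notMem (hj : lowerEntry ν.1 j ∉ osL L (d + 1)) :
    H.lowering ν (j + 1) = H.lowering ν j := by
  refine le_antisymm (H.lowering_le_iff.2 fun i hi hi' => ?_) (H.lowering_mono (Nat.le_succ _))
  obtain hij | hij := Nat.lt_succ_iff_lt_or_eq.1 hi
  · exact H.range_le_lowering hi' hij
  · exact absurd (Fin.ext hij ▸ hi') hj

end Lowering

section MemLowering

variable {lam ν : osL L (d + 1)} {t : ℕ}

lemma topCoeff_eq_zero_of_mem_lowering {f : H.total ⟶ H.obj ν} (hf : f ∈ H.lowering ν t)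
    (g : H.obj lam ⟶ H.total) {m : ℤ} (hm : ∀ j : Fin (d + 1), (j : ℕ) < t →
      shift p m lam.1 j = ν.1 j) : H.topCoeff m (g ≫ f) = 0 := by
  classical
  refine Submodule.iSup_induction _ (motive := fun f : H.total ⟶ H.obj ν =>
    H.topCoeff m (g ≫ f) = 0) hf ?_ ?_ fun a b ha hb => ?_
  · rintro ⟨j, hjt, hj⟩ _ ⟨f, rfl⟩
    change H.topCoeff m (g ≫ (show H.total ⟶ H.obj ⟨lowerEntry ν.1 j, hj⟩ from f) ≫
      H.canHom _ ν (lowerEntry_le _ _)) = 0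
    rw [← Category.assoc, topCoeff_comp_canHom, ite_eq_right_iff]
    by_contra! hc
    have hle := H.shift_le_of_topCoeff_ne_zero hc.2 j
    rw [hm j hjt] at hle
    exact (sub_one_lt (ν.1 j)).not_ge (hle.trans_eq (lowerEntry_self ν.1 j))
  · exact (congrArg (H.topCoeff m) comp_zero).trans (map_zero _)
  · change H.topCoeff m (g ≫ (a + b)) = 0
    rw [Preadditive.comp_add, map_add, ha, hb, add_zero]

lemma comp_mem_lowering (f : H.total ⟶ H.obj lam) {g : H.obj lam ⟶ H.obj ν}
    (hg : ∀ m : ℤ, (∀ j : Fin (d + 1), (j : ℕ) < t → shift p m lam.1 j = ν.1 j) →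
      H.topCoeff m g = 0) : (f ≫ g : H.total ⟶ H.obj ν) ∈ H.lowering ν t := by
  suffices hmem : ∀ φ ∈ AddSubmonoid.closure _,
      (f ≫ ModuleCat.ofHom φ : H.total ⟶ H.obj ν) ∈ H.lowering ν t from
    hmem _ (hom_mem_closure_transfer (h := H.isAdmissible lam.1 lam.2)
      (h' := H.isAdmissible ν.1 ν.2) g.hom)
  intro φ hφ
  induction hφ using AddSubmonoid.closure_induction with
  | zero => exact comp_zero (f := f) (Z := H.obj ν) ▸ Submodule.zero_mem _
  | add a b _ _ ha hb =>
    exact Preadditive.comp_add _ _ _ f (ModuleCat.ofHom a) (ModuleCat.ofHom b) ▸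
      Submodule.add_mem _ ha hb
  | mem φ hφ =>
    obtain ⟨c, m, hlo, hhi, hgm, rfl⟩ := hφ
    obtain ⟨i, hit, hi⟩ : ∃ i : Fin (d + 1), (i : ℕ) < t ∧ shift p m lam.1 i ≠ ν.1 i := by
      by_contra! hc
      exact hgm (hg m hc)
    obtain ⟨j, hji, hj, hle⟩ := H.exists_le_lowerEntry (H.shift_mem_osL lam.2 m) ν.2
      (H.shift_le_of_topCoeff_ne_zero hgm) (H.lower_le_of_topCoeff_ne_zero hgm) hi
    have hmem := H.comp_canHom_mem_lowering hj ((Fin.le_def.1 hji).trans_lt hit)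
      (f ≫ ModuleCat.ofHom (transfer (H.isAdmissible lam.1 lam.2) (H.isAdmissible _ hj) c m
        (lower_mono hle) (upper_mono hle)))
    rw [Category.assoc] at hmem
    have hcomp := canMap_comp_transfer (h := H.isAdmissible lam.1 lam.2)
      (h' := H.isAdmissible _ hj) (h'' := H.isAdmissible ν.1 ν.2) c m (lower_mono hle)
      (upper_mono hle) (lower_mono (lowerEntry_le ν.1 j)) (upper_mono (lowerEntry_le ν.1 j))
    exact (congrArg (fun φ => (f ≫ ModuleCat.ofHom φ : H.total ⟶ H.obj ν) ∈ H.lowering ν t)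
      hcomp).mp hmem

lemma mem_lowering_iff {f : H.total ⟶ H.obj ν} :
    f ∈ H.lowering ν t ↔ ∀ (o : Orbits p L (d + 1)) (m : ℤ),
      (∀ j : Fin (d + 1), (j : ℕ) < t → shift p m o.out.1 j = ν.1 j) →
        H.topCoeff m (H.incl o ≫ f) = 0 := by
  refine ⟨fun hf o m => H.topCoeff_eq_zero_of_mem_lowering hf _, fun hf => ?_⟩
  have := H.finite_orbits (d + 1)
  have := Fintype.ofFinite (Orbits p L (d + 1))
  have hsum : f = ∑ o, H.proj o ≫ H.incl o ≫ f := by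
    simp only [← Category.assoc]
    rw [← Preadditive.sum_comp, sum_piProj_comp_piSingle, Category.id_comp]
  rw [hsum]
  exact Submodule.sum_mem _ fun o _ => H.comp_mem_lowering _ (hf o)

lemma comap_lowering (j : Fin (d + 1)) (hj : lowerEntry ν.1 j ∈ osL L (d + 1)) :
    (H.lowering ν j).comap ((homFunctor H.total).map
      (H.canHom ⟨lowerEntry ν.1 j, hj⟩ ν (lowerEntry_le _ _))).hom =
        H.lowering ⟨lowerEntry ν.1 j, hj⟩ j := by
  classical
  ext (f : H.total ⟶ H.obj ⟨lowerEntry ν.1 j, hj⟩)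
  change (f ≫ H.canHom ⟨lowerEntry ν.1 j, hj⟩ ν (lowerEntry_le _ _) : H.total ⟶ H.obj ν) ∈
    H.lowering ν j ↔ _
  refine H.mem_lowering_iff.trans <| (forall₂_congr fun o m => ?_).trans H.mem_lowering_iff.symm
  have hagree : (∀ i : Fin (d + 1), (i : ℕ) < j → shift p m o.out.1 i = ν.1 i) ↔
      ∀ i : Fin (d + 1), (i : ℕ) < j → shift p m o.out.1 i = lowerEntry ν.1 j i :=
    forall₂_congr fun i hi => by rw [lowerEntry_of_ne ν.1 (Fin.lt_def.2 hi).ne]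
  rw [← hagree]
  refine forall_congr' fun hm => ?_
  rw [← Category.assoc, topCoeff_comp_canHom, ite_eq_right_iff]
  refine ⟨fun hf => by_contra fun hne => hne (hf fun i => ?_), fun hf _ => hf⟩
  obtain rfl | hi := eq_or_ne i.succ j
  · exact (ν.2.1 Fin.castSucc_lt_succ.le).trans_eq (hm i.castSucc Fin.castSucc_lt_succ).symm
  · exact (lowerEntry_of_ne ν.1 hi).ge.trans (H.lower_le_of_topCoeff_ne_zero hne i)

/-- Each step of the filtration raises the projective dimension by at most one, because the
quotients by consecutive steps fit into a short exact sequence with a third such quotient. -/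
lemma hasProjectiveDimensionLT_quotient_lowering (t : ℕ) (ht : t ≤ d + 1) (ν : osL L (d + 1)) :
    HasProjectiveDimensionLT (ModuleCat.of (End H.total)ᵐᵒᵖ
      ((homFunctor H.total).obj (H.obj ν) ⧸ H.lowering ν t)) (t + 1) := by
  induction t generalizing ν with
  | zero =>
    have := hasProjectiveDimensionLT_of_projective (H.inAdd_obj ν).projective_homFunctor le_rfl
    exact hasProjectiveDimensionLT_of_iso
      (Submodule.quotEquivOfEqBot _ (H.lowering_zero ν)).symm.toModuleIso 1
  | succ t ih =>
    let j : Fin (d + 1) := ⟨t, ht⟩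
    have := ih (Nat.le_of_succ_le ht) ν
    have hν := hasProjectiveDimensionLT_of_ge (ModuleCat.of (End H.total)ᵐᵒᵖ
      ((homFunctor H.total).obj (H.obj ν) ⧸ H.lowering ν t)) (t + 1) (t + 2) (Nat.le_succ _)
    by_cases hj : lowerEntry ν.1 j ∈ osL L (d + 1)
    · rw [H.lowering_succ_of_mem (j := j) hj]
      refine (shortExact_quotientComplex _ _).hasProjectiveDimensionLT_X₃ (t + 1) ?_ hν
      have := ih (Nat.le_of_succ_le ht) ⟨_, hj⟩
      rwa [← H.comap_lowering j hj] at this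
    · rwa [H.lowering_succ_of_notMem (j := j) hj]

end MemLowering

end IsNakayama

section FiniteLength

variable {R : Type u} [Ring R] {n : ℕ} {N : Type u} [AddCommGroup N] [Module R N]

lemma hasProjectiveDimensionLT_of_isFiniteLength
    (hs : ∀ (S : Type u) [AddCommGroup S] [Module R S] [IsSimpleModule R S],
      HasProjectiveDimensionLT (ModuleCat.of R S) n) (hN : IsFiniteLength R N) :
    HasProjectiveDimensionLT (ModuleCat.of R N) n := by
  induction hN with
  | @of_subsingleton M =>
    have := (ModuleCat.isZero_of_subsingleton (ModuleCat.of R M)).hasProjectiveDimensionLT_zero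
    exact hasProjectiveDimensionLT_of_ge _ 0 _ (Nat.zero_le _)
  | @of_simple_quotient M _ _ N _ _ ih =>
    have hN := LinearMap.shortExact_shortComplexKer N.mkQ_surjective
    refine hN.hasProjectiveDimensionLT_X₂ n ?_ (hs _)
    exact hasProjectiveDimensionLT_of_iso
      (LinearEquiv.ofEq _ _ N.ker_mkQ.symm).toModuleIso n

end FiniteLength

lemma sum_lowerEntry {d : ℕ} (ν : Vtx (d + 1)) (j : Fin (d + 1)) :
    ∑ i, lowerEntry ν j i = ∑ i, ν i - 1 := by
  rw [lowerEntry, Finset.sum_update_of_mem (Finset.mem_univ j),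
    Finset.sum_eq_add_sum_sdiff_singleton_of_mem (Finset.mem_univ j) ν]
  ring

namespace IsNakayama

variable {k : Type u} [Field k] {d p : ℕ} [NeZero d] {D : QuotientData d p} {L : ℤ → ℤ}
  (H : IsNakayama k D L)

section EvalMap

variable {S : Type u} [AddCommGroup S] [Module (End H.total)ᵐᵒᵖ S]

/-- The map `g ↦ (g ≫ H.incl o) • s` from the projective module given by an interval module to an
arbitrary module over the endomorphism ring of `H.total`. -/
def evalMap (o : Orbits p L (d + 1)) (s : S) :
    (homFunctor H.total).obj (H.obj o.out) →ₗ[(End H.total)ᵐᵒᵖ] S where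
  toFun (g : H.total ⟶ H.obj o.out) := MulOpposite.op (show End H.total from g ≫ H.incl o) • s
  map_add' (g g' : H.total ⟶ H.obj o.out) := by
    rw [← add_smul, ← MulOpposite.op_add]
    exact congrArg (fun a : End H.total => MulOpposite.op a • s)
      (Preadditive.add_comp _ _ _ g g' (H.incl o))
  map_smul' a (g : H.total ⟶ H.obj o.out) := by
    rw [RingHom.id_apply, ← mul_smul]
    exact congrArg (fun a : End H.total => MulOpposite.op a • s)
      (Category.assoc (show H.total ⟶ H.total from a.unop) g (H.incl o))

lemma exists_evalMap_ne_zero {s : S} (hs : s ≠ 0) : ∃ o, H.evalMap o s ≠ 0 := by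
  by_contra! hzero
  have := H.finite_orbits (d + 1)
  have := Fintype.ofFinite (Orbits p L (d + 1))
  have hone : (1 : (End H.total)ᵐᵒᵖ) =
      ∑ o, MulOpposite.op (H.proj o ≫ H.incl o : End H.total) :=
    (congrArg MulOpposite.op (sum_piProj_comp_piSingle _).symm).trans
      (map_sum (MulOpposite.opAddEquiv : End H.total ≃+ (End H.total)ᵐᵒᵖ) _ _)
  refine hs ?_
  rw [← one_smul (End H.total)ᵐᵒᵖ s, hone, Finset.sum_smul]
  exact Finset.sum_eq_zero fun o _ => LinearMap.congr_fun (hzero o) (H.proj o)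

end EvalMap

section Descent

variable {κ ν : osL L (d + 1)}

lemma lower_le_upper_of_canHom_ne_zero (h : κ.1 ≤ ν.1) (h0 : H.canHom κ ν h ≠ 0) :
    lower ν.1 ≤ upper κ.1 := by
  classical
  by_contra hc
  refine h0 (ModuleCat.hom_ext (LinearMap.ext fun w =>
    interval_ext (h := H.isAdmissible ν.1 ν.2) fun x hlx hxh => ?_))
  refine (coeff_canMap (lower_mono h) (upper_mono h) w x).trans ?_
  rw [if_pos ⟨hlx, hxh⟩]
  exact (coeff_of_notMem _ fun hx => hc (hlx.trans hx.2)).trans (coeff_zero _).symm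

include H in
lemma sum_lower_add_le_of_lower_le_upper (h : lower ν.1 ≤ upper κ.1) :
    ∑ i, lower ν.1 i + L (lower ν.1 0) ≤ ∑ i, κ.1 i := by
  rw [Fin.sum_univ_castSucc]
  refine add_le_add (Finset.sum_le_sum fun i _ => h i) ((H.monotone (h 0)).trans ?_)
  simpa only [upper_zero, lastIdx_succ] using κ.2.2

variable {S : Type u} [AddCommGroup S] [Module (End H.total)ᵐᵒᵖ S]

lemma exists_lowerEntry_of_not_lowering_le_ker
    {ψ : (homFunctor H.total).obj (H.obj κ) →ₗ[(End H.total)ᵐᵒᵖ] S}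
    (h : ¬ H.lowering κ (d + 1) ≤ LinearMap.ker ψ) :
    ∃ (j : Fin (d + 1)) (hj : lowerEntry κ.1 j ∈ osL L (d + 1)),
      ψ.comp ((homFunctor H.total).map (H.canHom ⟨lowerEntry κ.1 j, hj⟩ κ
        (lowerEntry_le _ _))).hom ≠ 0 := by
  contrapose! h
  exact H.lowering_le_iff.2 fun j _ hj => LinearMap.range_le_ker_iff.2 (h j hj)

/-- If `φ` does not kill the maps that lower an entry, then one can lower an entry and repeat with
the composite of `φ` and a canonical map; this stops because canonical maps between interval
modules of sequences that are too far apart vanish. -/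
lemma exists_lowering_le_ker
    (φ : (homFunctor H.total).obj (H.obj ν) →ₗ[(End H.total)ᵐᵒᵖ] S) (n : ℕ) (hκ : κ.1 ≤ ν.1)
    (h0 : φ.comp ((homFunctor H.total).map (H.canHom κ ν hκ)).hom ≠ 0)
    (hn : ∑ i, κ.1 i < ∑ i, lower ν.1 i + L (lower ν.1 0) + n) :
    ∃ (μ : osL L (d + 1)) (ψ : (homFunctor H.total).obj (H.obj μ) →ₗ[(End H.total)ᵐᵒᵖ] S),
      ψ ≠ 0 ∧ H.lowering μ (d + 1) ≤ LinearMap.ker ψ := by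
  induction n generalizing κ with
  | zero =>
    have hcan : H.canHom κ ν hκ ≠ 0 := fun hcan => h0 <| by
      rw [hcan, Functor.map_zero]
      exact LinearMap.comp_zero φ
    rw [Nat.cast_zero, add_zero] at hn
    exact absurd hn
      (H.sum_lower_add_le_of_lower_le_upper (H.lower_le_upper_of_canHom_ne_zero hκ hcan)).not_gt
  | succ n ih =>
    by_cases hlow : H.lowering κ (d + 1) ≤
        LinearMap.ker (φ.comp ((homFunctor H.total).map (H.canHom κ ν hκ)).hom)
    · exact ⟨κ, _, h0, hlow⟩
    · obtain ⟨j, hj, hne⟩ := H.exists_lowerEntry_of_not_lowering_le_ker hlow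
      refine ih (κ := ⟨lowerEntry κ.1 j, hj⟩) ((lowerEntry_le _ _).trans hκ) ?_ ?_
      · rwa [LinearMap.comp_assoc, ← ModuleCat.hom_comp, ← Functor.map_comp,
          H.canHom_comp_canHom] at hne
      · rw [sum_lowerEntry]
        push_cast at hn
        linarith

end Descent

section Maximal

variable {lam ν : osL L (d + 1)}

lemma topCoeff_congr (g : H.obj lam ⟶ H.obj ν) {m m' : ℤ}
    (h : shift p m lam.1 = shift p m' lam.1) : H.topCoeff m g = H.topCoeff m' g :=
  congrArg (fun x => coeff (h := H.isAdmissible ν.1 ν.2)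
    (g.hom (basisVec (H.isAdmissible lam.1 lam.2) (upper lam.1))) x) (congrArg upper h)

lemma topCoeff_smul_id_comp (c : k) (g : H.obj lam ⟶ H.obj ν) (m : ℤ) :
    H.topCoeff m ((c • 𝟙 (H.obj lam)) ≫ g) = c * H.topCoeff m g :=
  (congrArg (fun w => coeff (h := H.isAdmissible ν.1 ν.2) w (shift p m (upper lam.1)))
    (g.hom.map_smul_of_tower c _)).trans (coeff_smul c _ _)

lemma exists_sub_comp_mem_lowering {f : H.total ⟶ H.obj ν} (hf : f ∉ H.lowering ν (d + 1))
    (g : H.total ⟶ H.obj ν) :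
    ∃ r : H.total ⟶ H.total, g - r ≫ f ∈ H.lowering ν (d + 1) := by
  obtain ⟨o, m, hm, hne⟩ : ∃ (o : Orbits p L (d + 1)) (m : ℤ),
      shift p m o.out.1 = ν.1 ∧ H.topCoeff m (H.incl o ≫ f) ≠ 0 := by
    contrapose! hf
    exact H.mem_lowering_iff.2 fun o m hm => hf o m (funext fun j => hm j j.2)
  let c := H.topCoeff m (H.incl o ≫ g) / H.topCoeff m (H.incl o ≫ f)
  refine ⟨H.proj o ≫ (c • 𝟙 _) ≫ H.incl o, H.mem_lowering_iff.2 fun o' m' hm' => ?_⟩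
  replace hm' : shift p m' o'.out.1 = ν.1 := funext fun j => hm' j j.2
  obtain rfl : o' = o := by
    rw [← Quotient.out_eq o, ← Quotient.out_eq o']
    refine Quotient.sound ⟨-m' + m, ?_⟩
    rw [← shift_shift, hm, ← hm', shift_shift, neg_add_cancel, shift_zero]
  have hincl : H.incl o' ≫ (H.proj o' ≫ (c • 𝟙 _) ≫ H.incl o') ≫ f =
      (c • 𝟙 _) ≫ H.incl o' ≫ f := by
    simp only [Category.assoc]
    rw [← Category.assoc (H.incl o'), piSingle_comp_piProj_self _ o', Category.id_comp]
  rw [H.topCoeff_congr _ (hm'.trans hm.symm), Preadditive.comp_sub, map_sub, hincl,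
    topCoeff_smul_id_comp, div_mul_cancel₀ _ hne, sub_self]

variable {S : Type u} [AddCommGroup S] [Module (End H.total)ᵐᵒᵖ S]

lemma ker_le_lowering {ψ : (homFunctor H.total).obj (H.obj ν) →ₗ[(End H.total)ᵐᵒᵖ] S}
    (h0 : ψ ≠ 0) (hψ : H.lowering ν (d + 1) ≤ LinearMap.ker ψ) :
    LinearMap.ker ψ ≤ H.lowering ν (d + 1) := by
  intro (f : H.total ⟶ H.obj ν) (hf : ψ f = 0)
  by_contra hmem
  refine h0 (LinearMap.ext fun (g : H.total ⟶ H.obj ν) => ?_)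
  obtain ⟨r, hr⟩ := H.exists_sub_comp_mem_lowering hmem g
  calc ψ g = ψ (r ≫ f) := sub_eq_zero.1 ((map_sub ψ g (r ≫ f)).symm.trans (hψ hr))
    _ = MulOpposite.op (show End H.total from r) • ψ f :=
      map_smul ψ (MulOpposite.op (show End H.total from r)) f
    _ = 0 := by rw [hf, smul_zero]

lemma hasProjectiveDimensionLT_of_isSimpleModule [IsSimpleModule (End H.total)ᵐᵒᵖ S] :
    HasProjectiveDimensionLT (ModuleCat.of (End H.total)ᵐᵒᵖ S) (d + 2) := by
  have := IsSimpleModule.nontrivial (End H.total)ᵐᵒᵖ S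
  obtain ⟨s, hs⟩ := exists_ne (0 : S)
  obtain ⟨o, ho⟩ := H.exists_evalMap_ne_zero hs
  obtain ⟨n, hn⟩ := exists_nat_gt
    (∑ i, o.out.1 i - (∑ i, lower o.out.1 i + L (lower o.out.1 0)))
  obtain ⟨ν, ψ, h0, hψ⟩ := H.exists_lowering_le_ker (H.evalMap o s) n (κ := o.out) le_rfl
    (by rwa [H.canHom_self, CategoryTheory.Functor.map_id]) (sub_lt_iff_lt_add'.1 hn)
  have hker := hψ.antisymm (H.ker_le_lowering h0 hψ)
  have := H.hasProjectiveDimensionLT_quotient_lowering (d + 1) le_rfl ν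
  exact hasProjectiveDimensionLT_of_iso ((Submodule.quotEquivOfEq _ _ hker).trans
    (ψ.quotKerEquivOfSurjective (LinearMap.surjective_of_ne_zero h0))).toModuleIso (d + 2)

end Maximal

end IsNakayama

lemma isNoetherianRing_and_isArtinianRing_end_op (k : Type u) [Field k] {Λ M : Type u} [Ring Λ]
    [Algebra k Λ] [AddCommGroup M] [Module k M] [Module Λ M] [IsScalarTower k Λ M]
    [Module.Finite k M] :
    IsNoetherianRing (End (ModuleCat.of Λ M))ᵐᵒᵖ ∧ IsArtinianRing (End (ModuleCat.of Λ M))ᵐᵒᵖ := by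
  have : Module.Finite k (Module.End Λ M) :=
    Module.Finite.of_injective (LinearMap.restrictScalarsₗ k Λ M M k)
      (LinearMap.restrictScalars_injective k)
  have : Module.Finite k (Module.End Λ M)ᵐᵒᵖ := Module.Finite.equiv (MulOpposite.opLinearEquiv k)
  have : IsNoetherianRing (Module.End Λ M)ᵐᵒᵖ := IsNoetherianRing.of_finite k _
  have : IsArtinianRing (Module.End Λ M)ᵐᵒᵖ := IsArtinianRing.of_finite k _
  let e : (Module.End Λ M)ᵐᵒᵖ ≃+* (End (ModuleCat.of Λ M))ᵐᵒᵖ :=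
    (RingEquiv.op (ModuleCat.endRingEquiv (ModuleCat.of Λ M))).symm
  exact ⟨isNoetherianRing_of_ringEquiv _ e, e.surjective.isArtinianRing⟩

namespace IsNakayama

variable {k : Type u} [Field k] {d p : ℕ} [NeZero d] {D : QuotientData d p} {L : ℤ → ℤ}
  (H : IsNakayama k D L)

lemma subsingleton_ext_total {i : ℕ} (hi₁ : 1 ≤ i) (hi : i < d) :
    Subsingleton (Ext H.total H.total i) := by
  have := H.finite_orbits (d + 1)
  have := Fintype.ofFinite (Orbits p L (d + 1))
  exact subsingleton_ext_right_of_sum_comp_eq_id (sum_piProj_comp_piSingle _) fun o =>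
    subsingleton_ext_left_of_sum_comp_eq_id (sum_piProj_comp_piSingle _) fun o' =>
      H.subsingleton_ext_obj _ _ hi₁ hi

theorem isClusterTilting : IsClusterTilting d H.total := by
  have := H.finite_orbits (d + 1)
  have : Module.Finite k (∀ o : Orbits p L (d + 1), H.obj o.out) := Module.Finite.pi
  obtain ⟨_, _⟩ := isNoetherianRing_and_isArtinianRing_end_op k (Λ := QuotAlg k D)
    (M := ∀ o : Orbits p L (d + 1), H.obj o.out)
  have := H.finite_quotAlg
  have : IsNoetherianRing (QuotAlg k D) := IsNoetherianRing.of_finite k _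
  have := H.finite_total
  exact isClusterTilting_of_projectiveDimension (NeZero.pos d) H.isSeparator_total
    H.cogenerates_total (fun i => H.subsingleton_ext_total) fun N _ =>
      hasProjectiveDimensionLT_of_isFiniteLength (N := N)
        (fun S _ _ _ => H.hasProjectiveDimensionLT_of_isSimpleModule)
        (isFiniteLength_iff_isNoetherian_isArtinian.2 ⟨inferInstance, inferInstance⟩)

end IsNakayama

lemma indecomposable_of_forall_idempotent {C : Type*} [Category* C] [Preadditive C]
    [HasBinaryBiproducts C] {X : C} (hX : ¬ IsZero X)
    (h : ∀ e : X ⟶ X, e ≫ e = e → e = 0 ∨ e = 𝟙 X) : Indecomposable X := by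
  refine ⟨hX, fun Y Z φ => ?_⟩
  simp only [IsZero.iff_id_eq_zero]
  refine (h (φ.hom ≫ biprod.fst ≫ biprod.inl ≫ φ.inv) (by simp)).imp (fun h0 => ?_) fun h1 => ?_
  · simpa using congrArg (fun f => (biprod.inl ≫ φ.inv) ≫ f ≫ φ.hom ≫ biprod.fst) h0
  · simpa using (congrArg (fun f => (biprod.inr ≫ φ.inv) ≫ f ≫ φ.hom ≫ biprod.snd) h1).symm

section Indecomposable

variable {k : Type u} [Field k] {d p : ℕ} {D : QuotientData d p} {lo hi : Vtx d}
  {h : IsAdmissible D lo hi}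

lemma coeff_hom_apply (g : Module.End (QuotAlg k D) (IntervalModule k h))
    (w : IntervalModule k h) (x : Vtx d) :
    coeff (g w) x =
      ∑ y ∈ Finset.Icc lo hi, coeff w y * coeff (quotArrow k D y hi • g (basisVec h hi)) x := by
  conv_lhs => rw [eq_sum_basisVec w]
  rw [map_sum, coeff_sum]
  refine Finset.sum_congr rfl fun y hy => ?_
  rw [map_smul, coeff_algebraMap_smul,
    ← quotArrow_smul_basisVec_top (Finset.mem_Icc.1 hy).2, map_smul]

lemma coeff_add_sub_ne_zero_of_quotArrow_smul {x y : Vtx d} (hy : y ≤ hi)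
    {w : IntervalModule k h} (hx : coeff (quotArrow k D y hi • w) x ≠ 0) :
    coeff w (x + (hi - y)) ≠ 0 := by
  classical
  rw [coeff_quotArrow_smul hy] at hx
  exact (ite_ne_right_iff.1 hx).2

lemma eq_of_add_sub_le {x y : Vtx d} (hy : y ≤ hi) (hx : x + (hi - y) ≤ x) : y = hi :=
  hy.antisymm (sub_nonpos.1 (nonpos_of_add_le_right hx))

lemma coeff_mul_apply_basisVec_top (hlh : lo ≤ hi)
    (g g' : Module.End (QuotAlg k D) (IntervalModule k h)) :
    coeff ((g * g') (basisVec h hi)) hi =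
      coeff (g (basisVec h hi)) hi * coeff (g' (basisVec h hi)) hi := by
  classical
  rw [Module.End.mul_apply, coeff_hom_apply,
    Finset.sum_eq_single_of_mem hi (Finset.mem_Icc.2 ⟨hlh, le_rfl⟩)]
  · rw [coeff_quotArrow_smul le_rfl, if_pos ⟨.refl _, hlh, le_rfl⟩, sub_self, add_zero, mul_comm]
  · intro y hy hne
    have hyhi := (Finset.mem_Icc.1 hy).2
    refine mul_eq_zero_of_right _ (by_contra fun h0 => hne (eq_of_add_sub_le (x := hi) hyhi ?_))
    exact (mem_of_coeff_ne_zero (coeff_add_sub_ne_zero_of_quotArrow_smul hyhi h0)).2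

/-- A maximal element of the support of the image of the generator would have to come from a
strictly larger one. -/
lemma eq_zero_of_isIdempotentElem {e : Module.End (QuotAlg k D) (IntervalModule k h)}
    (he : IsIdempotentElem e) (h0 : coeff (e (basisVec h hi)) hi = 0) : e = 0 := by
  classical
  refine interval_hom_ext (by_contra fun hne => ?_)
  set w := e (basisVec h hi) with hw
  have hew : e w = w := LinearMap.congr_fun he (basisVec h hi)
  let support := {z ∈ Finset.Icc lo hi | coeff w z ≠ 0}
  have mem_support {z : Vtx d} (hz : coeff w z ≠ 0) : z ∈ support :=
    Finset.mem_filter.2 ⟨Finset.mem_Icc.2 (mem_of_coeff_ne_zero hz), hz⟩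
  have hsupport : support.Nonempty := by
    obtain ⟨x, hx⟩ : ∃ x, coeff w x ≠ 0 := by
      contrapose! hne
      exact interval_ext fun x _ _ => (hne x).trans (coeff_zero x).symm
    exact ⟨x, mem_support hx⟩
  obtain ⟨z, hz⟩ := support.exists_maximal hsupport
  have hzw : coeff (e w) z ≠ 0 := hew.symm ▸ (Finset.mem_filter.1 hz.1).2
  rw [coeff_hom_apply] at hzw
  obtain ⟨y, hy, hyz⟩ := Finset.exists_ne_zero_of_sum_ne_zero hzw
  have hyhi := (Finset.mem_Icc.1 hy).2
  have hmem := mem_support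
    (coeff_add_sub_ne_zero_of_quotArrow_smul hyhi (right_ne_zero_of_mul hyz))
  obtain rfl := eq_of_add_sub_le hyhi
    (hz.2 hmem (le_add_of_nonneg_right (sub_nonneg.2 hyhi)))
  exact left_ne_zero_of_mul hyz h0

lemma eq_zero_or_eq_one_of_isIdempotentElem (hlh : lo ≤ hi)
    {e : Module.End (QuotAlg k D) (IntervalModule k h)} (he : IsIdempotentElem e) :
    e = 0 ∨ e = 1 := by
  have hcoeff : IsIdempotentElem (coeff (e (basisVec h hi)) hi) :=
    (coeff_mul_apply_basisVec_top hlh e e).symm.trans (by rw [he.eq])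
  refine (IsIdempotentElem.iff_eq_zero_or_one.1 hcoeff).imp (eq_zero_of_isIdempotentElem he)
    fun hone => (sub_eq_zero.1 (eq_zero_of_isIdempotentElem he.one_sub ?_)).symm
  have hsum := coeff_add ((1 - e) (basisVec h hi)) (e (basisVec h hi)) hi
  rwa [← LinearMap.add_apply, sub_add_cancel, Module.End.one_apply,
    coeff_basisVec_self ⟨hlh, le_rfl⟩, hone, right_eq_add] at hsum

lemma indecomposable_intervalObj (h : IsAdmissible D lo hi) (hlh : lo ≤ hi) :
    Indecomposable (intervalObj k h) := by
  refine indecomposable_of_forall_idempotent (fun hzero => ?_) fun e he => ?_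
  · have hbasis := congrArg (fun f => coeff (h := h) (f.hom (basisVec h hi)) hi)
      (hzero.eq_of_src (𝟙 _) 0)
    exact one_ne_zero (((coeff_basisVec_self ⟨hlh, le_rfl⟩).symm.trans hbasis).trans
      (coeff_zero hi))
  · exact (eq_zero_or_eq_one_of_isIdempotentElem hlh (e := e.hom)
      (congrArg ModuleCat.Hom.hom he)).imp ModuleCat.hom_ext ModuleCat.hom_ext

end Indecomposable

lemma isIso_i_of_retract {C : Type*} [Category* C] [Abelian C] {X Y : C} (hY : Indecomposable Y)
    (hX : ¬ IsZero X) (R : Retract X Y) : IsIso R.i := by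
  have hexact := (shortExact_cokernel R.i).exact
  let splitting := ShortComplex.Splitting.ofExactOfRetraction _ hexact R.r R.retract inferInstance
  have hcokernel := (hY.2 _ _ splitting.isoBinaryBiproduct).resolve_left hX
  have : Epi R.i := Preadditive.epi_of_isZero_cokernel R.i hcokernel
  exact isIso_of_epi_of_isSplitMono R.i

section KrullSchmidt

variable {Λ : Type u} [Ring Λ]

/-- Fitting's decomposition `X = ker (f ^ n) ⊕ range (f ^ n)` leaves only two cases. -/
lemma isNilpotent_or_isUnit_of_indecomposable {X : ModuleCat.{u} Λ} (hX : Indecomposable X)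
    [IsNoetherian Λ X] [IsArtinian Λ X] (f : Module.End Λ X) : IsNilpotent f ∨ IsUnit f := by
  obtain ⟨n, hn, hcompl⟩ := ((Filter.eventually_ne_atTop 0).and
    f.eventually_isCompl_ker_pow_range_pow).exists
  have e : X ≅ ModuleCat.of Λ (LinearMap.ker (f ^ n)) ⊞ ModuleCat.of Λ (LinearMap.range (f ^ n)) :=
    (Submodule.prodEquivOfIsCompl _ _ hcompl).symm.toModuleIso ≪≫
      (ModuleCat.biprodIsoProd (.of Λ (LinearMap.ker (f ^ n)))
        (.of Λ (LinearMap.range (f ^ n)))).symm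
  have hX' := hX.2 _ _ e
  simp only [ModuleCat.isZero_iff_subsingleton, Submodule.subsingleton_iff_eq_bot] at hX'
  rcases hX' with hker | hrange
  · have htop : LinearMap.range (f ^ n) = ⊤ := by
      simpa only [hker, bot_sup_eq] using hcompl.sup_eq_top
    exact .inr ((isUnit_pow_iff hn).1 ((Module.End.isUnit_iff _).2
      ⟨LinearMap.ker_eq_bot.1 hker, LinearMap.range_eq_top.1 htop⟩))
  · exact .inl ⟨n, LinearMap.range_eq_bot.1 hrange⟩

lemma isLocalRing_end_of_indecomposable {X : ModuleCat.{u} Λ} (hX : Indecomposable X)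
    [IsNoetherian Λ X] [IsArtinian Λ X] : IsLocalRing (Module.End Λ X) := by
  have : Nontrivial X := not_subsingleton_iff_nontrivial.1
    (mt ModuleCat.isZero_iff_subsingleton.2 hX.1)
  exact .of_isUnit_or_isUnit_one_sub_self fun f =>
    (isNilpotent_or_isUnit_of_indecomposable hX f).symm.imp_right IsNilpotent.isUnit_one_sub

lemma exists_iso_of_sum_comp_eq_id {X : ModuleCat.{u} Λ} (hX : Indecomposable X)
    [IsNoetherian Λ X] [IsArtinian Λ X] {ι : Type*} [Fintype ι] {N : ι → ModuleCat.{u} Λ}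
    (hN : ∀ i, Indecomposable (N i)) (p : ∀ i, X ⟶ N i) (q : ∀ i, N i ⟶ X)
    (h : ∑ i, p i ≫ q i = 𝟙 X) : ∃ i, Nonempty (X ≅ N i) := by
  have := isLocalRing_end_of_indecomposable hX
  obtain ⟨i, -, hi⟩ := IsLocalRing.exists_of_isUnit_sum (s := Finset.univ)
    (f := fun i => (p i ≫ q i).hom) (by rw [← ModuleCat.hom_sum, h]; exact isUnit_one)
  have : IsIso (p i ≫ q i) :=
    (ConcreteCategory.isIso_iff_bijective _).2 ((Module.End.isUnit_iff _).1 hi)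
  let R : Retract X (N i) := ⟨p i, q i ≫ inv (p i ≫ q i), by
    rw [← Category.assoc, IsIso.hom_inv_id]⟩
  have := isIso_i_of_retract (hN i) hX.1 R
  exact ⟨i, ⟨asIso R.i⟩⟩

lemma exists_iso_of_isSummand [IsNoetherianRing Λ] [IsArtinianRing Λ] {X M : ModuleCat.{u} Λ}
    [Module.Finite Λ M] (hX : Indecomposable X) (hXM : IsSummand X M) {ι : Type*} [Fintype ι]
    {N : ι → ModuleCat.{u} Λ} (hN : ∀ i, Indecomposable (N i)) (p : ∀ i, M ⟶ N i)
    (q : ∀ i, N i ⟶ M) (h : ∑ i, p i ≫ q i = 𝟙 M) : ∃ i, Nonempty (X ≅ N i) := by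
  obtain ⟨R⟩ := hXM
  have : Module.Finite Λ X :=
    .of_surjective R.r.hom ((ModuleCat.epi_iff_surjective R.r).1 inferInstance)
  refine exists_iso_of_sum_comp_eq_id hX hN (fun i => R.i ≫ p i) (fun i => q i ≫ R.r) ?_
  calc ∑ i, (R.i ≫ p i) ≫ q i ≫ R.r
    _ = R.i ≫ (∑ i, p i ≫ q i) ≫ R.r := by
      simp only [Preadditive.sum_comp, Preadditive.comp_sum, Category.assoc]
    _ = 𝟙 X := by rw [h, Category.id_comp, R.retract]

end KrullSchmidt

namespace IsNakayama

variable {k : Type u} [Field k] {d p : ℕ} [NeZero d] {D : QuotientData d p} {L : ℤ → ℤ}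
  (H : IsNakayama k D L)

lemma indecomposable_obj (lam : osL L (d + 1)) : Indecomposable (H.obj lam) :=
  indecomposable_intervalObj _ (lower_le_upper lam.2)

theorem summandsAre : SummandsAre H.total H.obj := by
  refine ⟨H.indecomposable_obj, fun X hX => ⟨fun hsummand => ?_, ?_⟩⟩
  · have := H.finite_orbits (d + 1)
    have := Fintype.ofFinite (Orbits p L (d + 1))
    have := H.finite_quotAlg
    have : IsNoetherianRing (QuotAlg k D) := .of_finite k _
    have : IsArtinianRing (QuotAlg k D) := .of_finite k _
    have := H.finite_total
    obtain ⟨o, ho⟩ := exists_iso_of_isSummand hX hsummand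
      (fun o => H.indecomposable_obj (Quotient.out o)) H.proj H.incl (sum_piProj_comp_piSingle _)
    exact ⟨_, ho⟩
  · rintro ⟨lam, ⟨e⟩⟩
    obtain ⟨R⟩ := H.isSummand_obj lam
    exact ⟨(Retract.ofIso e).trans R⟩

end IsNakayama

section Interlaced

variable {k : Type u} [Field k] {p : ℕ} {L : ℤ → ℤ}

lemma update_mem_verts_of_quotArrow_ne_zero {d : ℕ} {D : QuotientData d p} {u v : Vtx d}
    (huv : u ≤ v) (h : quotArrow k D u v ≠ 0) (i : Fin d) :
    Function.update u i (v i) ∈ D.verts := by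
  by_contra hnotMem
  exact h (quotArrow_eq_zero_of_between (le_update_self_iff.2 (huv i))
    (update_le_iff.2 ⟨le_rfl, fun j _ => huv j⟩) hnotMem)

/-- Otherwise `L` jumps at some `i` between `u` and `v` with `u < L i`, and then `f_{vu}` factors
through the killed arrow from `L i - 1` to `i`. -/
lemma le_of_quotArrow_ne_zero_of_rels {D : QuotientData 1 p} (hL : Monotone L)
    (hverts : D.verts = osL L 1)
    (hrels : ∀ i, L (i - 1) ≤ i - 1 → L i ≤ i → L (i - 1) < L i →
      ((fun _ => L i - 1, fun _ => i) : Vtx 1 × Vtx 1) ∈ D.rels)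
    {u v : Vtx 1} (huv : u ≤ v) (h : quotArrow k D u v ≠ 0) : L (v 0) ≤ u 0 := by
  have le_iff {x y : Vtx 1} : x ≤ y ↔ x 0 ≤ y 0 := by simp [Pi.le_def]
  have le_self {j : ℤ} (huj : u 0 ≤ j) (hjv : j ≤ v 0) : L j ≤ j := by
    by_contra hlt
    refine h (quotArrow_eq_zero_of_between (z := fun _ => j) (le_iff.2 huj) (le_iff.2 hjv) ?_)
    exact fun hmem => hlt (hverts ▸ hmem : (fun _ => j) ∈ osL L 1).2
  have lt_of_lt {i : ℤ} (hi : u 0 < L i) : u 0 < i :=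
    hL.reflect_lt ((le_self le_rfl (huv 0)).trans_lt hi)
  by_contra! hlt
  obtain ⟨i, hi, hmin⟩ := Int.exists_least_of_bdd (P := fun i => u 0 < L i)
    ⟨u 0, fun i hi => (lt_of_lt hi).le⟩ ⟨v 0, hlt⟩
  have hui := lt_of_lt hi
  have hiv := hmin _ hlt
  have hpred : L (i - 1) ≤ u 0 := not_lt.1 fun hlt => (sub_one_lt i).not_ge (hmin _ hlt)
  have hself := le_self hui.le hiv
  have hmem := hrels i (le_self (by omega) (by omega)) hself (hpred.trans_lt hi)
  have hua : u ≤ fun _ => L i - 1 := le_iff.2 (Int.le_sub_one_of_lt hi)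
  have hab : (fun _ => L i - 1 : Vtx 1) ≤ fun _ => i := le_iff.2 (by omega)
  have hbv : (fun _ => i) ≤ v := le_iff.2 hiv
  refine h ?_
  rw [← quotArrow_mul_quotArrow hua (hab.trans hbv), ← quotArrow_mul_quotArrow hab hbv,
    quotArrow_eq_zero_of_rels hmem, zero_mul, mul_zero]

lemma interlaced_of_rels {d : ℕ} [NeZero d] {D : QuotientData d p} (hL : Monotone L)
    (hverts : D.verts = osL L d)
    (hrels : d = 1 → ∀ i, L (i - 1) ≤ i - 1 → L i ≤ i → L (i - 1) < L i →
      ((fun _ => L i - 1, fun _ => i) : Vtx d × Vtx d) ∈ D.rels)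
    {u v : Vtx d} (huv : u ≤ v) (h : quotArrow k D u v ≠ 0) :
    (∀ i j : Fin d, (j : ℕ) = i + 1 → v j ≤ u i) ∧ L (v 0) ≤ u (lastIdx d) := by
  have update_mem (i : Fin d) : Function.update u i (v i) ∈ osL L d :=
    hverts ▸ update_mem_verts_of_quotArrow_ne_zero huv h i
  constructor
  · intro i j hij
    have hlt : i < j := by rw [Fin.lt_def]; omega
    simpa only [Function.update_self, Function.update_of_ne hlt.ne] using
      (update_mem j).1 hlt.le
  · by_cases hd : d = 1
    · subst hd
      exact le_of_quotArrow_ne_zero_of_rels hL hverts (hrels rfl) huv h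
    · have hlast : lastIdx d ≠ 0 := fun heq => hd (by rw [← val_lastIdx d, heq]; rfl)
      simpa only [Function.update_self, Function.update_of_ne hlast] using (update_mem 0).2

end Interlaced

lemma SummandsAre.comp_surjective {Λ : Type u} [Ring Λ] {ι ι' : Type} {M : ModuleCat.{u} Λ}
    {N : ι → ModuleCat.{u} Λ} (h : SummandsAre M N) {f : ι' → ι} (hf : Function.Surjective f) :
    SummandsAre M (N ∘ f) :=
  ⟨fun j => h.1 (f j), fun X hX => (h.2 X hX).trans hf.exists⟩

namespace KupischTilde

variable {n : ℕ} [NeZero n] (ℓ : KupischTilde n)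

/-- The index of the last composition factor of the indecomposable projective module with top of
index `j`, for `ℓ` of type `𝔸̃`. -/
def socle (j : ℤ) : ℤ := j - ℓ.len (j : ZMod n) + 1

lemma os_eq_osL (e : ℕ) [NeZero e] : ℓ.os e = osL ℓ.socle e := by
  ext μ
  refine and_congr Iff.rfl ?_
  rw [socle]
  omega

lemma socle_monotone : Monotone ℓ.socle := fun _ _ hij =>
  add_le_add_left (ℓ.mono hij) 1

lemma socle_add_mul (m j : ℤ) : ℓ.socle (j + m * n) = ℓ.socle j + m * n := by
  have hcast : ((j + m * n : ℤ) : ZMod n) = (j : ZMod n) := by simp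
  rw [socle, socle, hcast]
  ring

lemma sub_sum_le_socle (j : ℤ) : j - (∑ i, ℓ.len i : ℕ) ≤ ℓ.socle j := by
  have hlen : ℓ.len (j : ZMod n) ≤ ∑ i, ℓ.len i :=
    Finset.single_le_sum (fun _ _ => Nat.zero_le _) (Finset.mem_univ _)
  rw [socle]
  omega

lemma mem_rels (i : ℤ) (hlt : ℓ.socle (i - 1) < ℓ.socle i) :
    ((fun _ => ℓ.socle i - 1, fun _ => i) : Vtx 1 × Vtx 1) ∈ (ℓ.data 1).rels := by
  refine ⟨rfl, i, ?_, by rw [socle, add_sub_cancel_right]⟩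
  rw [socle, socle] at hlt
  omega

lemma isNakayama (k : Type u) [Field k] (d : ℕ) [NeZero d] :
    IsNakayama k (ℓ.data d) ℓ.socle where
  monotone := ℓ.socle_monotone
  periodic := ℓ.socle_add_mul
  bounded := ⟨_, ℓ.sub_sum_le_socle⟩
  finite := by
    have hn : (0 : ℤ) < n := mod_cast NeZero.pos n
    refine ⟨Finset.Ico 0 (n : ℤ), fun j _ => ⟨-(j / n), ?_⟩⟩
    have hmod : j + -(j / n) * n = j % n := by rw [Int.emod_def]; ring
    rw [hmod, Finset.mem_Ico]
    exact ⟨Int.emod_nonneg _ hn.ne', Int.emod_lt_of_pos _ hn⟩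
  verts_eq := ℓ.os_eq_osL d
  isAdmissible lam hlam := ℓ.isAdmissible (by rwa [ℓ.os_eq_osL])
  interlaced _ _ _ _ := interlaced_of_rels ℓ.socle_monotone (ℓ.os_eq_osL d) fun hd => by
    subst hd
    exact fun i _ _ => ℓ.mem_rels i

end KupischTilde

namespace KupischA

variable {n : ℕ} [NeZero n] (ℓ : KupischA n) {j : ℤ}

/-- The index of the last composition factor of the indecomposable projective module with top of
index `j`, for `ℓ` of type `𝔸`. Outside `{0, …, n - 1}` its value `j + 1` is chosen so that no
sequence in `osL ℓ.socle e` starts with `j`. -/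
def socle (j : ℤ) : ℤ :=
  if h : 0 ≤ j ∧ j < n then j - ℓ.len ⟨j.toNat, by omega⟩ + 1 else j + 1

lemma socle_of_mem (h : 0 ≤ j ∧ j < n) :
    ℓ.socle j = j - ℓ.len ⟨j.toNat, by omega⟩ + 1 := dif_pos h

lemma socle_of_notMem (h : ¬ (0 ≤ j ∧ j < n)) : ℓ.socle j = j + 1 := dif_neg h

lemma socle_le_iff : ℓ.socle j ≤ j ↔ 0 ≤ j ∧ j < n := by
  by_cases h : 0 ≤ j ∧ j < n
  · have := ℓ.pos ⟨j.toNat, by omega⟩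
    exact iff_of_true (by rw [ℓ.socle_of_mem h]; omega) h
  · exact iff_of_false (by rw [ℓ.socle_of_notMem h]; omega) h

lemma socle_nonneg (h : 0 ≤ j) : 0 ≤ ℓ.socle j := by
  by_cases hj : j < n
  · have hmono := ℓ.mono (i := 0) (j := ⟨j.toNat, by omega⟩) (Fin.zero_le _)
    rw [ℓ.first] at hmono
    simp only [Fin.val_zero, Nat.cast_zero, Nat.cast_one, Int.toNat_of_nonneg h] at hmono
    rw [ℓ.socle_of_mem ⟨h, hj⟩]
    omega
  · rw [ℓ.socle_of_notMem fun h => hj h.2]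
    omega

lemma socle_monotone : Monotone ℓ.socle := by
  refine monotone_int_of_le_succ fun j => ?_
  by_cases hj : 0 ≤ j ∧ j < n <;> by_cases hj' : 0 ≤ j + 1 ∧ j + 1 < n
  · have hmono := ℓ.mono (i := ⟨j.toNat, by omega⟩) (j := ⟨(j + 1).toNat, by omega⟩)
      (by rw [Fin.le_def]; simp only; omega)
    simp only [Int.toNat_of_nonneg hj.1, Int.toNat_of_nonneg hj'.1] at hmono
    rw [ℓ.socle_of_mem hj, ℓ.socle_of_mem hj']
    omega
  · have := ℓ.socle_le_iff.2 hj
    rw [ℓ.socle_of_notMem hj']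
    omega
  · have := ℓ.socle_nonneg hj'.1
    rw [ℓ.socle_of_notMem hj]
    omega
  · rw [ℓ.socle_of_notMem hj, ℓ.socle_of_notMem hj']
    omega

lemma sub_le_socle (j : ℤ) : j - n ≤ ℓ.socle j := by
  by_cases h : 0 ≤ j ∧ j < n
  · have := ℓ.socle_nonneg h.1
    omega
  · rw [ℓ.socle_of_notMem h]
    omega

lemma os_eq_osL (e : ℕ) [NeZero e] : ℓ.os e = osL ℓ.socle e := by
  ext μ
  constructor
  · rintro ⟨⟨hanti, -, -⟩, i, hi, hlen⟩
    have hmem : 0 ≤ μ 0 ∧ μ 0 < n := by omega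
    have hi' : (⟨(μ 0).toNat, by omega⟩ : Fin n) = i := by ext; simp only; omega
    refine ⟨hanti, ?_⟩
    rw [ℓ.socle_of_mem hmem, hi']
    omega
  · rintro ⟨hanti, hsocle⟩
    have hmem := ℓ.socle_le_iff.1 (hsocle.trans (last_le_of_os hanti 0))
    have hnonneg := ℓ.socle_nonneg hmem.1
    refine ⟨⟨hanti, by omega, by omega⟩, ⟨(μ 0).toNat, by omega⟩, by simp only; omega, ?_⟩
    rw [ℓ.socle_of_mem hmem] at hsocle
    omega

lemma mem_rels (i : ℤ) (hpred : ℓ.socle (i - 1) ≤ i - 1) (hi : ℓ.socle i ≤ i)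
    (hlt : ℓ.socle (i - 1) < ℓ.socle i) :
    ((fun _ => ℓ.socle i - 1, fun _ => i) : Vtx 1 × Vtx 1) ∈ (ℓ.data 1).rels := by
  rw [socle_le_iff] at hpred hi
  rw [ℓ.socle_of_mem hpred, ℓ.socle_of_mem hi] at hlt
  refine ⟨rfl, ⟨(i - 1).toNat, by omega⟩, ⟨i.toNat, by omega⟩, by simp only; omega, by omega, ?_⟩
  simp only [ℓ.socle_of_mem hi, Int.toNat_of_nonneg hi.1, add_sub_cancel_right]

lemma isNakayama (k : Type u) [Field k] (d : ℕ) [NeZero d] :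
    IsNakayama k (ℓ.data d) ℓ.socle where
  monotone := ℓ.socle_monotone
  periodic m j := by simp
  bounded := ⟨n, ℓ.sub_le_socle⟩
  finite := ⟨Finset.Ico 0 (n : ℤ), fun j hj => ⟨0, by simpa using ℓ.socle_le_iff.1 hj⟩⟩
  verts_eq := ℓ.os_eq_osL d
  isAdmissible lam hlam := ℓ.isAdmissible (by rwa [ℓ.os_eq_osL])
  interlaced _ _ _ _ := interlaced_of_rels ℓ.socle_monotone (ℓ.os_eq_osL d) fun hd => by
    subst hd
    exact ℓ.mem_rels

end KupischA

end HigherNakayama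

end

open CategoryTheory HigherNakayama in
theorem mainTheorem3 {k : Type*} [Field k] (d n : ℕ) [NeZero d] [NeZero n] :
    (∀ ℓ : KupischA n,
      IsWeaklyRepFinite k (NakayamaA k ℓ d) d ∧
        ∃ M : ModuleCat (NakayamaA k ℓ d),
          IsClusterTilting d M ∧ SummandsAre M (intervalA k ℓ d)) ∧
    (∀ ℓ : KupischTilde n,
      IsWeaklyRepFinite k (NakayamaTilde k ℓ d) d ∧
        ∃ M : ModuleCat (NakayamaTilde k ℓ d),
          IsClusterTilting d M ∧ SummandsAre M (intervalTilde k ℓ d)) := by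
  refine ⟨fun ℓ => ?_, fun ℓ => ?_⟩
  · have H := ℓ.isNakayama k d
    have hsummands := H.summandsAre.comp_surjective
      (Equiv.setCongr (ℓ.os_eq_osL (d + 1))).surjective
    exact ⟨⟨H.finite_quotAlg, H.total, H.isClusterTilting⟩, H.total, H.isClusterTilting, hsummands⟩
  · have H := ℓ.isNakayama k d
    have hsummands := H.summandsAre.comp_surjective
      (Equiv.setCongr (ℓ.os_eq_osL (d + 1))).surjective
    exact ⟨⟨H.finite_quotAlg, H.total, H.isClusterTilting⟩, H.total, H.isClusterTilting, hsummands⟩
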